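/- Let $V$ be a finite-dimensional simple real Jordan algebra (nonzero, with nondegenerate trace form $\mathrm{tr}\,L(xy)$, $L(x)y=xy$, and without proper ideals), with identity $e$, dimension $n$ and rank $r$, and let $dx$ be a Lebesgue (Haar) measure on $V$. Let $\Delta$ be the Jordan polynomial: the polynomial function with $\Delta(x)=(-1)^r f_x(0)$ whenever the minimal polynomial $f_x$ of $x$ has the maximal degree $r$. Let $\alpha$ be a Euclidean involution of $V$ (an involutive automorphism such that $\mathrm{tr}\,L(\alpha(x)y)$ is positive definite) and let $r_0$ be the rank of the Jordan algebra $V_0=\{x:\alpha(x)=x\}$. Let $\mathrm{Str}(V)=\{g\in GL(V):\exists\,\chi(g)\in\mathbb R,\ \Delta(gx)=\chi(g)\Delta(x)\ \forall x\in V\}$, let $N=\{n_v: x\mapsto x+v\}$ be the group of translations, let $j(x)=-x^{-1}$, and let $\mathrm{Conf}(V)$ be the group of rational transformations of $V$ generated by $N$, $\mathrm{Str}(V)$ and $j$. Put $\overline N=jNj$ and $\overline P=\mathrm{Str}(V)\overline N$. For $s\in\mathbb C$ let $\widetilde I_s$ be the space of all $F\in C^\infty(\mathrm{Conf}(V))$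 with $$F(h\,\ell\,\bar n)=|\chi(\ell)|^{s+\frac n{2r}}F(h)\qquad(h\in\mathrm{Conf}(V),\ \ell\in\mathrm{Str}(V),\ \bar n\in\overline N),$$ on which $\mathrm{Conf}(V)$ acts by left translations, let $I_s$ be the space of the functions $F_V(x)=F(n_x)$ on $V$ with $F\in\widetilde I_s$, and let $\pi_s$ be the resulting action of $\mathrm{Conf}(V)$ on $I_s$. Suppose that $\mathrm{Re}\,s>\frac n{2r_0}$. Then $\pi_s$ is given, for $g\in\mathrm{Conf}(V)$, $f\in I_s$ and $x$ outside the zero set of some nonzero polynomial (depending on $g$ and $f$), by $$\pi_s(g)f(x)=\bigl|\chi\bigl((Dg^{-1})_x\bigr)\bigr|^{s+\frac n{2r}}f(g^{-1}.x).$$ Moreover $$\mathfrak B_s(f_1,f_2)=\iint_{V\times V}|\Delta(x-y)|^{2s-\frac nr}f_1(x)f_2(y)\,dx\,dy$$ converges absolutely for all $f_1,f_2\in I_s$, it defines a bilinear form on $I_s\times I_s$, and this form is $\mathrm{Conf}(V)$-invariant: $$\mathfrak B_s(\pi_s(g)f_1,\pi_s(g)f_2)=\mathfrak B_s(f_1,f_2)\qquad(g\in\mathrm{Conf}(V),\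 f_1,f_2\in I_s).$$ -/

import Mathlib

open MeasureTheory Filter Topology
open scoped ContDiff

/-- A (not necessarily unital) real Jordan algebra structure on the space `V`: a commutative
bilinear product satisfying the Jordan identity. The product is carried by a structure, and not by
the ring type classes, so that `V` keeps the additive group of its (arbitrary) norm. -/
structure JordanAlg (V : Type*) [NormedAddCommGroup V] [NormedSpace ℝ V] where
  mul : V →ₗ[ℝ] V →ₗ[ℝ] V
  mul_comm : ∀ x y, mul x y = mul y x
  jordan : ∀ x y, mul x (mul (mul x x) y) = mul (mul x x) (mul x y)

/-- `p` is a polynomial function on `V` (a polynomial in linear forms). -/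
def IsPolyFun (V : Type*) [NormedAddCommGroup V] [NormedSpace ℝ V] (p : V → ℝ) : Prop :=
  ∃ Q : MvPolynomial (Module.Dual ℝ V) ℝ, ∀ x, p x = MvPolynomial.eval (fun φ => φ x) Q

/-- The filter of Zariski-generic sets: generated by the sets `{p ≠ 0}`, for `p` a nonzero
polynomial function. -/
def genericFilter (V : Type*) [NormedAddCommGroup V] [NormedSpace ℝ V] : Filter V :=
  ⨅ p ∈ {p : V → ℝ | IsPolyFun V p ∧ p ≠ 0}, 𝓟 {x | p x ≠ 0}

/-- Maps `V → V` pulling generic sets back to generic sets; they can be composed generically. -/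
def genericEnd (V : Type*) [NormedAddCommGroup V] [NormedSpace ℝ V] :
    Submonoid (Function.End V) where
  carrier := {f | Tendsto f (genericFilter V) (genericFilter V)}
  one_mem' := tendsto_id
  mul_mem' := fun hf hg => Tendsto.comp hf hg

/-- Two maps are identified when they agree generically, as rational maps are. -/
def genericCon (V : Type*) [NormedAddCommGroup V] [NormedSpace ℝ V] : Con (genericEnd V) where
  r f g := f.1 =ᶠ[genericFilter V] g.1
  iseqv := ⟨fun _ => EventuallyEq.rfl, fun h => h.symm, fun h h' => h.trans h'⟩
  mul' := by
    intro f f' g g' hf hg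
    have h1 : (f.1 ∘ g.1) =ᶠ[genericFilter V] (f'.1 ∘ g.1) := hf.comp_tendsto g.2
    have h2 : (f'.1 ∘ g.1) =ᶠ[genericFilter V] (f'.1 ∘ g'.1) := hg.fun_comp f'.1
    exact h1.trans h2

/-- The group of generically invertible transformations of `V`, up to generic equality. It contains
the birational transformations of `V`. -/
abbrev GenericAut (V : Type*) [NormedAddCommGroup V] [NormedSpace ℝ V] : Type _ :=
  ((genericCon V).Quotient)ˣ

/-- The transformation `u` is given generically by the map `f`. -/
def Represents {V : Type*} [NormedAddCommGroup V] [NormedSpace ℝ V]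
    (u : GenericAut V) (f : V → V) : Prop :=
  ∃ h : f ∈ genericEnd V, (u : (genericCon V).Quotient) = ((⟨f, h⟩ : genericEnd V) :
    (genericCon V).Quotient)

/-- The (unique) transformation given generically by the map `f`. -/
noncomputable def genericAut {V : Type*} [NormedAddCommGroup V] [NormedSpace ℝ V]
    (f : V → V) : GenericAut V :=
  Classical.epsilon fun u => Represents u f

namespace JordanAlg

/-- The trace form `(x, y) ↦ tr L(xy)`, where `L(x) y = xy`. -/
noncomputable def traceForm {V : Type*} [NormedAddCommGroup V] [NormedSpace ℝ V]
    (J : JordanAlg V) (x y : V) : ℝ :=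
  LinearMap.trace ℝ V (J.mul (J.mul x y))

/-- Simple: nonzero, semi-simple (the trace form is nondegenerate), without proper ideals. -/
structure IsSimple {V : Type*} [NormedAddCommGroup V] [NormedSpace ℝ V]
    (J : JordanAlg V) : Prop where
  nontrivial : Nontrivial V
  nondegenerate : ∀ x, (∀ y, J.traceForm x y = 0) → x = 0
  ideal : ∀ I : Submodule ℝ V, (∀ x, ∀ y ∈ I, J.mul x y ∈ I) → I = ⊥ ∨ I = ⊤

/-- The identity element `e` (a semi-simple Jordan algebra has exactly one). -/
noncomputable def one {V : Type*} [NormedAddCommGroup V] [NormedSpace ℝ V]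
    (J : JordanAlg V) : V :=
  Classical.epsilon fun e => ∀ x, J.mul e x = x

/-- The ideal of the polynomials `p` with `p(x) = 0`. As `x ^ k = L(x) ^ k e`, one has
`p(x) = p(L(x)) e`. -/
noncomputable def annIdeal {V : Type*} [NormedAddCommGroup V] [NormedSpace ℝ V]
    (J : JordanAlg V) (x : V) : Ideal (Polynomial ℝ) where
  carrier := {p | Polynomial.aeval (R := ℝ) (A := Module.End ℝ V) (J.mul x) p J.one = 0}
  zero_mem' := by simp
  add_mem' := by
    intro p q hp hq
    simp only [Set.mem_ofPred_eq] at hp hq ⊢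
    simp [hp, hq]
  smul_mem' := by
    intro c p hp
    simp only [Set.mem_ofPred_eq] at hp ⊢
    simp [hp]

/-- The minimal polynomial `f_x` of `x`: the monic generator of `{p | p(x) = 0}`. -/
noncomputable def minPoly {V : Type*} [NormedAddCommGroup V] [NormedSpace ℝ V]
    (J : JordanAlg V) (x : V) : Polynomial ℝ :=
  normalize (Submodule.IsPrincipal.generator (J.annIdeal x))

/-- The largest degree of the minimal polynomial of an element of `S`. If `S` is a subalgebra that
contains `e`, this is the rank of the Jordan algebra `S`. -/
noncomputable def rankOn {V : Type*} [NormedAddCommGroup V] [NormedSpace ℝ V]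
    (J : JordanAlg V) (S : Set V) : ℕ :=
  sSup {k | ∃ x ∈ S, (J.minPoly x).natDegree = k}

/-- The rank `r` of the Jordan algebra. -/
noncomputable def rank {V : Type*} [NormedAddCommGroup V] [NormedSpace ℝ V]
    (J : JordanAlg V) : ℕ :=
  J.rankOn Set.univ

/-- The Jordan polynomial `Δ`: the polynomial function which, at every regular `x`, is `a_r(x)`,
where `f_x(λ) = λ ^ r - a_1(x) λ ^ (r - 1) + ⋯ + (-1) ^ r a_r(x)`. -/
noncomputable def jdet {V : Type*} [NormedAddCommGroup V] [NormedSpace ℝ V]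
    (J : JordanAlg V) : V → ℝ :=
  Classical.epsilon fun D => IsPolyFun V D ∧
    ∀ x, (J.minPoly x).natDegree = J.rank → D x = (-1) ^ J.rank * (J.minPoly x).coeff 0

/-- The quadratic representation `P(x) = 2 L(x)² - L(x²)`. -/
def quad {V : Type*} [NormedAddCommGroup V] [NormedSpace ℝ V]
    (J : JordanAlg V) (x : V) : Module.End ℝ V :=
  (2 : ℝ) • (J.mul x ∘ₗ J.mul x) - J.mul (J.mul x x)

/-- The inversion `x ↦ -x⁻¹`, where `x⁻¹ = P(x)⁻¹ x` for `x` invertible, that is, for `P(x)`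
invertible. -/
noncomputable def negInv {V : Type*} [NormedAddCommGroup V] [NormedSpace ℝ V]
    (J : JordanAlg V) (x : V) : V :=
  -(Ring.inverse (J.quad x) x)

/-- The structure group `Str(V)`: all `g ∈ GL(V)` for which `Δ(g x) = c Δ(x)` with a constant
`c`. -/
def Str {V : Type*} [NormedAddCommGroup V] [NormedSpace ℝ V]
    (J : JordanAlg V) : Subgroup (V ≃L[ℝ] V) where
  carrier := {g | ∃ c : ℝ, ∀ x, J.jdet (g x) = c * J.jdet x}
  one_mem' := ⟨1, fun x => (one_mul _).symm⟩
  mul_mem' := by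
    rintro g h ⟨c, hc⟩ ⟨d, hd⟩
    refine ⟨c * d, fun x => ?_⟩
    change J.jdet (g (h x)) = _
    rw [hc, hd, mul_assoc]
  inv_mem' := by
    rintro g ⟨c, hc⟩
    have key : ∀ x, J.jdet x = c * J.jdet (g⁻¹ x) := by
      intro x
      rw [← hc]
      exact congrArg J.jdet (g.apply_symm_apply x).symm
    refine ⟨c⁻¹, fun x => ?_⟩
    by_cases h0 : c = 0
    · have hz : ∀ x, J.jdet x = 0 := fun x => by rw [key x, h0, zero_mul]
      rw [hz, hz, mul_zero]
    · rw [key x, ← mul_assoc, inv_mul_cancel₀ h0, one_mul]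

/-- The character `χ`: `Δ(h x) = χ(h) Δ(x)`. -/
noncomputable def chi {V : Type*} [NormedAddCommGroup V] [NormedSpace ℝ V]
    (J : JordanAlg V) (h : V →L[ℝ] V) : ℝ :=
  Classical.epsilon fun c => ∀ x, J.jdet (h x) = c * J.jdet x

/-- The conformal group `Conf(V)`: the group of rational transformations of `V` generated by the
translations, the structure group and the inversion `j : x ↦ -x⁻¹`. -/
noncomputable def Conf {V : Type*} [NormedAddCommGroup V] [NormedSpace ℝ V]
    (J : JordanAlg V) : Subgroup (GenericAut V) :=
  Subgroup.closure (Set.range (fun v : V => genericAut (fun x => x + v)) ∪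
    Set.range (fun l : J.Str => genericAut (fun x => (l : V ≃L[ℝ] V) x)) ∪
    {genericAut J.negInv})

/-- The translation `n_v : x ↦ x + v`. -/
noncomputable def nn {V : Type*} [NormedAddCommGroup V] [NormedSpace ℝ V]
    (J : JordanAlg V) (v : V) : J.Conf :=
  ⟨genericAut (fun x => x + v), Subgroup.subset_closure (Or.inl (Or.inl ⟨v, rfl⟩))⟩

/-- An element of `Str(V)` as a conformal transformation. -/
noncomputable def strConf {V : Type*} [NormedAddCommGroup V] [NormedSpace ℝ V]
    (J : JordanAlg V) (l : J.Str) : J.Conf :=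
  ⟨genericAut (fun x => (l : V ≃L[ℝ] V) x), Subgroup.subset_closure (Or.inl (Or.inr ⟨l, rfl⟩))⟩

/-- The inversion `j` as a conformal transformation. -/
noncomputable def jj {V : Type*} [NormedAddCommGroup V] [NormedSpace ℝ V]
    (J : JordanAlg V) : J.Conf :=
  ⟨genericAut J.negInv, Subgroup.subset_closure (Or.inr rfl)⟩

/-- The element `j n_y j` of the opposite group `N̄ = j N j`. -/
noncomputable def nbar {V : Type*} [NormedAddCommGroup V] [NormedSpace ℝ V]
    (J : JordanAlg V) (y : V) : J.Conf :=
  J.jj * J.nn y * J.jj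

/-- Smooth functions on the Lie group `Conf(V)`. The map `(x, l, n̄) ↦ n_x l n̄` is a diffeomorphism
of `N × Str(V) × N̄` onto an open subset, so `F` is smooth when it is smooth in all the left
translates `(x, l, y) ↦ h n_x l (j n_y j)` of this parametrization. As `Str(V)` is a closed subgroup
of `GL(V)`, smoothness on `V × Str(V) × V` is the existence of a smooth extension to the open set
`V × GL(V) × V`. -/
def IsSmooth {V : Type*} [NormedAddCommGroup V] [NormedSpace ℝ V]
    (J : JordanAlg V) (F : J.Conf → ℂ) : Prop :=
  ∀ h : J.Conf, ∃ Φ : V × (V →L[ℝ] V) × V → ℂ,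
    ContDiffOn ℝ ∞ Φ {p | IsUnit p.2.1} ∧
    ∀ (x : V) (l : J.Str) (y : V),
      Φ (x, ((l : V ≃L[ℝ] V) : V →L[ℝ] V), y) = F (h * J.nn x * J.strConf l * J.nbar y)

/-- The exponent `s + n / (2 r)`. -/
noncomputable def expo {V : Type*} [NormedAddCommGroup V] [NormedSpace ℝ V]
    (J : JordanAlg V) (s : ℂ) : ℂ :=
  s + (Module.finrank ℝ V : ℂ) / (2 * (J.rank : ℂ))

/-- The space `Ĩ_s` of the representation of `Conf(V)` induced from the character
`χ_s(l n̄) = |χ(l)| ^ (s + n / (2 r))` of `P̄ = Str(V) N̄`. -/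
noncomputable def indSpace {V : Type*} [NormedAddCommGroup V] [NormedSpace ℝ V]
    (J : JordanAlg V) (s : ℂ) : Submodule ℂ (J.Conf → ℂ) where
  carrier := {F | J.IsSmooth F ∧ ∀ (h : J.Conf) (l : J.Str) (y : V),
    F (h * (J.strConf l * J.nbar y)) =
      ((|J.chi ((l : V ≃L[ℝ] V) : V →L[ℝ] V)| : ℝ) : ℂ) ^ J.expo s * F h}
  zero_mem' := ⟨fun _ => ⟨0, contDiffOn_const, fun _ _ _ => rfl⟩, fun _ _ _ => by simp⟩
  add_mem' := by
    rintro F G ⟨hF, hF'⟩ ⟨hG, hG'⟩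
    refine ⟨fun h => ?_, fun h l y => ?_⟩
    · obtain ⟨Φ, h1, h2⟩ := hF h
      obtain ⟨Ψ, h3, h4⟩ := hG h
      exact ⟨Φ + Ψ, h1.add h3, fun x l y => by simp [h2, h4]⟩
    · simp only [Pi.add_apply, hF', hG', mul_add]
  smul_mem' := by
    rintro c F ⟨hF, hF'⟩
    refine ⟨fun h => ?_, fun h l y => ?_⟩
    · obtain ⟨Φ, h1, h2⟩ := hF h
      exact ⟨c • Φ, h1.const_smul c, fun x l y => by simp [h2]⟩
    · simp only [Pi.smul_apply, smul_eq_mul, hF']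
      ring

/-- The restriction `F ↦ F_V`, `F_V(x) = F(n_x)`. -/
noncomputable def restr {V : Type*} [NormedAddCommGroup V] [NormedSpace ℝ V]
    (J : JordanAlg V) : (J.Conf → ℂ) →ₗ[ℂ] (V → ℂ) :=
  LinearMap.funLeft ℂ ℂ J.nn

/-- The space `I_s` of the functions `F_V` with `F ∈ Ĩ_s`. -/
noncomputable def Ispace {V : Type*} [NormedAddCommGroup V] [NormedSpace ℝ V]
    (J : JordanAlg V) (s : ℂ) : Submodule ℂ (V → ℂ) :=
  (J.indSpace s).map J.restr

/-- The induced representation `π̃_s` of `Conf(V)` on `Ĩ_s`, by left translations. -/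
noncomputable def indRep {V : Type*} [NormedAddCommGroup V] [NormedSpace ℝ V]
    (J : JordanAlg V) (s : ℂ) (g : J.Conf) (F : J.indSpace s) : J.indSpace s :=
  ⟨fun h => F.1 (g⁻¹ * h), by
    refine ⟨fun h => ?_, fun h l y => ?_⟩
    · obtain ⟨Φ, h1, h2⟩ := F.2.1 (g⁻¹ * h)
      exact ⟨Φ, h1, fun x l y => by rw [h2]; simp only [mul_assoc]⟩
    · change F.1 (g⁻¹ * (h * _)) = _ * F.1 (g⁻¹ * h)
      rw [← mul_assoc, F.2.2]⟩

/-- The representation `π_s` on `I_s`: the operator `π_s(g)` sends `F_V` to `(π̃_s(g) F)_V`. -/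
noncomputable def rep {V : Type*} [NormedAddCommGroup V] [NormedSpace ℝ V]
    (J : JordanAlg V) (s : ℂ) (g : J.Conf) (f : J.Ispace s) : J.Ispace s :=
  ⟨J.restr (J.indRep s g ⟨f.2.choose, f.2.choose_spec.1⟩).1,
    ⟨_, (J.indRep s g ⟨f.2.choose, f.2.choose_spec.1⟩).2, rfl⟩⟩

/-- A Euclidean involution: an involutive automorphism `α` of the Jordan algebra for which the form
`tr L(α(x) y)` is positive definite. -/
structure IsEuclideanInvolution {V : Type*} [NormedAddCommGroup V] [NormedSpace ℝ V]
    (J : JordanAlg V) (α : V →ₗ[ℝ] V) : Prop where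
  involutive : ∀ x, α (α x) = x
  map_mul : ∀ x y, α (J.mul x y) = J.mul (α x) (α y)
  posDef : ∀ x, x ≠ 0 → 0 < J.traceForm (α x) x

/-- The integrand `|Δ(x - y)| ^ (2 s - n / r) f₁(x) f₂(y)` of the form `𝔅_s`. -/
noncomputable def formIntegrand {V : Type*} [NormedAddCommGroup V] [NormedSpace ℝ V]
    (J : JordanAlg V) (s : ℂ) (f₁ f₂ : V → ℂ) (p : V × V) : ℂ :=
  ((|J.jdet (p.1 - p.2)| : ℝ) : ℂ) ^ (2 * s - (Module.finrank ℝ V : ℂ) / (J.rank : ℂ)) *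
    f₁ p.1 * f₂ p.2

end JordanAlg

/-! Invariance is a change of variables. At a generic point the derivative of a conformal map g lies
in Str(V), and two identities hold: Δ(gx - gy)² = |χ(Dg_x)| |χ(Dg_y)| Δ(x - y)² and |det Dg_x| =
|χ(Dg_x)|^(n/r). Since n/r + (s - n/(2r)) = s + n/(2r), the integrand of the translated functions is
exactly the pull-back of the original integrand. It is enough to check this on generators. For j the
kernel identity comes from P(x) P(x⁻¹ + y⁻¹) P(y) = P(x + y) (`pol_inv_add_inv`), with P the
quadratic representation. The multiplier of π_s comes from j n_x = n_{j(x)} P(x)⁻¹ n̄ (`jj_mul_nn`),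
which is Hua's identity, together with Dj_x = P(x)⁻¹.

The algebra behind this rests on two devices. Identities between analytic functions are tested at
the points exp L(a) e, which fill a neighbourhood of e and satisfy P(exp L(a) y) = exp L(a) P(y) exp
L(a). The function Δ, known only through minimal polynomials, is shown to be a polynomial dividing
(det P)^r; as a divisor of a semi-invariant it is itself semi-invariant under exp L(a)
(`exists_jdet_expMul`). By simplicity and the Euclidean involution, associative α-invariant
functionals are proportional to tr L (`IsSimple.functional_eq`). This gives (det P)^r = Δ^(2n), and
then |det l|^r = |χ(l)|^n on Str(V) (`abs_det_pow_rank`).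

For convergence, r₀ ≤ r gives 2s - n/r positive real part, so the kernel is continuous and only
infinity matters. Finitely many charts x ↦ -(x - v)⁻¹ suffice to bring any two points simultaneously
into a fixed ball (`exists_uniform_inv`), and in such a chart the integrand becomes a continuous
function on a bounded set. The charts exist because x⁻¹ is the gradient of log |Δ| for a
nondegenerate form, while the functions v ↦ Δ(x - v) lie in one finite-dimensional space, whose norm
is read off from finitely many values. -/

set_option linter.unusedSectionVars false

/-! ### Linearized Jordan identities and associativity of the trace form. -/

namespace JordanAlg

section Linearization

variable {V : Type*} [NormedAddCommGroup V] [NormedSpace ℝ V] (J : JordanAlg V)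

/-- The full linearization of the Jordan identity. -/
theorem jordan_linearized (x y z w : V) :
    J.mul x (J.mul (J.mul y z) w) + J.mul y (J.mul (J.mul z x) w) + J.mul z (J.mul (J.mul x y) w) =
      J.mul (J.mul y z) (J.mul x w) + J.mul (J.mul z x) (J.mul y w) +
        J.mul (J.mul x y) (J.mul z w) := by
  have h1 := J.jordan (x + y + z) w
  have h2 := J.jordan (x + y) w
  have h3 := J.jordan (y + z) w
  have h4 := J.jordan (x + z) w
  have h5 := J.jordan x w
  have h6 := J.jordan y w
  have h7 := J.jordan z w
  have c1 := J.mul_comm y x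
  have c2 := J.mul_comm z y
  have c3 := J.mul_comm z x
  simp only [map_add, LinearMap.add_apply, c1, c2, c3] at h1 h2 h3 h4 h5 h6 h7 ⊢
  linear_combination (norm := module) (1 / 2 : ℝ) • (h1 - h2 - h3 - h4 + h5 + h6 + h7)

/-- The linearized Jordan identity, as an operator identity. -/
theorem jordan_operator (x y w : V) :
    J.mul x * J.mul w * J.mul y + J.mul y * J.mul w * J.mul x + J.mul (J.mul (J.mul x y) w) =
      J.mul (J.mul x w) * J.mul y + J.mul (J.mul y w) * J.mul x + J.mul (J.mul x y) * J.mul w := by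
  ext z
  have h := J.jordan_linearized x y z w
  simp only [LinearMap.add_apply, Module.End.mul_apply]
  rw [J.mul_comm w (J.mul y z), J.mul_comm w (J.mul x z), J.mul_comm (J.mul (J.mul x y) w) z,
    J.mul_comm w z]
  rw [J.mul_comm (J.mul y z) (J.mul x w), J.mul_comm (J.mul z x) (J.mul y w), J.mul_comm z x] at h
  linear_combination (norm := module) h

/-- The linearized Jordan identity, as a sum of commutators. -/
theorem jordan_commutator (x y z : V) :
    J.mul x * J.mul (J.mul y z) + J.mul y * J.mul (J.mul z x) + J.mul z * J.mul (J.mul x y) =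
      J.mul (J.mul y z) * J.mul x + J.mul (J.mul z x) * J.mul y + J.mul (J.mul x y) * J.mul z := by
  ext w
  simpa only [LinearMap.add_apply, Module.End.mul_apply] using J.jordan_linearized x y z w

/-- The commutator of two multiplications acts on multiplications as a derivation. -/
theorem mul_associator (x y z : V) :
    J.mul (J.mul x (J.mul y z)) - J.mul (J.mul y (J.mul x z)) =
      J.mul x * J.mul y * J.mul z - J.mul y * J.mul x * J.mul z -
        (J.mul z * J.mul x * J.mul y - J.mul z * J.mul y * J.mul x) := by
  have h1 := J.jordan_operator y z x
  have h2 := J.jordan_operator x z y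
  rw [J.mul_comm _ x] at h1
  rw [J.mul_comm _ y] at h2
  have h3 := J.jordan_commutator x y z
  rw [J.mul_comm y x] at h1
  rw [J.mul_comm z y, J.mul_comm z x] at *
  linear_combination (norm := module) h1 - h2

/-- The trace form is associative. -/
theorem traceForm_assoc (x y z : V) :
    J.traceForm (J.mul x y) z = J.traceForm y (J.mul x z) := by
  -- The right side of the identity is the commutator of [L(z), L(y)] with L(x), so its trace
  -- vanishes.
  have h := congrArg (LinearMap.trace ℝ V) (J.mul_associator z y x)
  simp only [map_sub] at h
  have h1 := LinearMap.trace_mul_comm ℝ (J.mul z * J.mul y) (J.mul x)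
  have h2 := LinearMap.trace_mul_comm ℝ (J.mul y * J.mul z) (J.mul x)
  rw [← mul_assoc] at h1 h2
  rw [traceForm, traceForm, J.mul_comm _ z, J.mul_comm x y, J.mul_comm x z]
  linarith

/-- The power `x ^ k`, computed as `L(x) ^ k e`, generates operators that commute with `L(x)`. -/
theorem commute_mul_pow (e : V) (he : ∀ x, J.mul e x = x) (x : V) (k : ℕ) :
    J.mul (((J.mul x) ^ k) e) ∈ Algebra.adjoin ℝ {J.mul x, J.mul (J.mul x x)} := by
  have h1 : J.mul x ∈ Algebra.adjoin ℝ {J.mul x, J.mul (J.mul x x)} :=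
    Algebra.subset_adjoin (by simp)
  have h2 : J.mul (J.mul x x) ∈ Algebra.adjoin ℝ {J.mul x, J.mul (J.mul x x)} :=
    Algebra.subset_adjoin (by simp)
  -- The operator identity at (x^k, x, x) expresses L(x^(k+2)) through L(x^(k+1)), L(x^k), L(x) and
  -- L(x²), so the induction must carry two consecutive powers.
  have key : ∀ k, J.mul (((J.mul x) ^ k) e) ∈ Algebra.adjoin ℝ {J.mul x, J.mul (J.mul x x)} ∧
      J.mul (((J.mul x) ^ (k + 1)) e) ∈ Algebra.adjoin ℝ {J.mul x, J.mul (J.mul x x)} := by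
    intro k
    induction k with
    | zero =>
      have : J.mul e = 1 := by ext y; simp [he]
      refine ⟨by simp [this], ?_⟩
      simpa [J.mul_comm x e, he] using h1
    | succ k ih =>
      refine ⟨ih.2, ?_⟩
      set y := ((J.mul x) ^ k) e
      have hy : ((J.mul x) ^ (k + 1)) e = J.mul x y := by simp [y, pow_succ']
      have hy' : ((J.mul x) ^ (k + 1 + 1)) e = J.mul x (J.mul x y) := by simp [y, pow_succ']
      rw [hy] at ih
      rw [hy']
      have h := J.jordan_operator y x x
      have e1 : J.mul x (J.mul x y) = J.mul (J.mul y x) x := by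
        rw [J.mul_comm x, J.mul_comm x]
      rw [e1, eq_sub_of_add_eq' h]
      rw [J.mul_comm y x]
      have := ih.1
      have := ih.2
      exact sub_mem (add_mem (add_mem (mul_mem ih.2 h1) (mul_mem h2 ih.1)) (mul_mem ih.2 h1))
        (add_mem (mul_mem (mul_mem ih.1 h1) h1) (mul_mem (mul_mem h1 h1) ih.1))
  exact (key k).1

end Linearization
end JordanAlg

/-! ### The identity element, the quadratic representation and the exponentials of multiplications.
-/

namespace JordanAlg

section Unit

variable {V : Type*} [NormedAddCommGroup V] [NormedSpace ℝ V] [FiniteDimensional ℝ V]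
  {J : JordanAlg V}

/-- A Jordan algebra with nondegenerate trace form has an identity element. -/
theorem IsSimple.one_mul (hJ : J.IsSimple) (x : V) : J.mul J.one x = x := by
  suffices h : ∃ e, ∀ x, J.mul e x = x from Classical.epsilon_spec h x
  let B : V →ₗ[ℝ] Module.Dual ℝ V :=
    LinearMap.mk₂ ℝ J.traceForm (by simp [traceForm]) (by simp [traceForm]) (by simp [traceForm])
      (by simp [traceForm])
  have hinj : Function.Injective B := by
    rw [← LinearMap.ker_eq_bot, LinearMap.ker_eq_bot']
    intro x hx
    exact hJ.nondegenerate x fun y => congrArg (fun φ => φ y) hx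
  have hsurj : Function.Surjective B :=
    (LinearMap.injective_iff_surjective_of_finrank_eq_finrank
      (Subspace.dual_finrank_eq (K := ℝ) (V := V)).symm).1 hinj
  -- The identity is the element representing the functional tr L through the trace form: by
  -- associativity, ex - x is then in the radical of the form.
  obtain ⟨e, he⟩ := hsurj (LinearMap.trace ℝ V ∘ₗ J.mul)
  have he' : ∀ x, J.traceForm e x = LinearMap.trace ℝ V (J.mul x) := fun x =>
    congrArg (fun φ => φ x) he
  refine ⟨e, fun x => ?_⟩
  rw [← sub_eq_zero]
  refine hJ.nondegenerate _ fun z => ?_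
  have h1 : J.traceForm (J.mul e x) z = J.traceForm x z := by
    rw [J.mul_comm, J.traceForm_assoc, he']; rfl
  simp only [traceForm] at h1
  simp [traceForm, h1]

theorem IsSimple.mul_one (hJ : J.IsSimple) (x : V) : J.mul x J.one = x := by
  rw [J.mul_comm, hJ.one_mul]

theorem IsSimple.one_ne_zero (hJ : J.IsSimple) : J.one ≠ 0 := by
  intro h
  obtain ⟨x, hx⟩ := @exists_ne V hJ.nontrivial 0
  apply hx
  rw [← hJ.one_mul x, h]
  simp

end Unit

section Continuous

variable {V : Type*} [NormedAddCommGroup V] [NormedSpace ℝ V] [FiniteDimensional ℝ V]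
  (J : JordanAlg V)

/-- The product as a continuous bilinear map. -/
noncomputable def cmul : V →L[ℝ] V →L[ℝ] V := J.mul.toContinuousBilinearMap

@[simp] theorem cmul_apply (x y : V) : J.cmul x y = J.mul x y := rfl

/-- The polarization `P(x, y) = L(x) L(y) + L(y) L(x) - L(xy)` of the quadratic representation. -/
noncomputable def pol (x y : V) : V →L[ℝ] V :=
  J.cmul x * J.cmul y + J.cmul y * J.cmul x - J.cmul (J.cmul x y)

theorem pol_apply (x y z : V) :
    J.pol x y z = J.mul x (J.mul y z) + J.mul y (J.mul x z) - J.mul (J.mul x y) z := rfl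

theorem pol_comm (x y : V) : J.pol x y = J.pol y x := by
  ext z; simp only [pol_apply, J.mul_comm x y]; abel

theorem pol_add_left (x y z : V) : J.pol (x + y) z = J.pol x z + J.pol y z := by
  ext w; simp [pol_apply]; abel

theorem pol_smul_left (c : ℝ) (x z : V) : J.pol (c • x) z = c • J.pol x z := by
  ext w; simp [pol_apply, smul_add, smul_sub]

theorem pol_add_right (x y z : V) : J.pol x (y + z) = J.pol x y + J.pol x z := by
  rw [pol_comm, pol_add_left, pol_comm, J.pol_comm z]

theorem pol_smul_right (c : ℝ) (x z : V) : J.pol x (c • z) = c • J.pol x z := by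
  rw [pol_comm, pol_smul_left, pol_comm]

theorem pol_self_apply (x z : V) : J.pol x x z = J.quad x z := by
  simp only [pol_apply, quad, LinearMap.sub_apply, LinearMap.smul_apply, LinearMap.comp_apply]
  module

/-- The elements `exp L(a)` of the structure group. -/
noncomputable def expMul (a : V) : V →L[ℝ] V := NormedSpace.exp (J.cmul a)

theorem expMul_mul_neg (a : V) : J.expMul a * J.expMul (-a) = 1 := by
  rw [expMul, expMul, map_neg]
  let _ : NormedAlgebra ℚ (V →L[ℝ] V) := NormedAlgebra.restrictScalars ℚ ℝ _
  rw [← NormedSpace.exp_add_of_commute (Commute.neg_right (Commute.refl _))]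
  simp

theorem expMul_neg_mul (a : V) : J.expMul (-a) * J.expMul a = 1 := by
  simpa using J.expMul_mul_neg (-a)

/-- Infinitesimal version of `pol_expMul`: the left side is the derivative of y ↦ P(y) in the
direction ay. -/
theorem two_pol_mul (a y : V) :
    (2 : ℝ) • J.pol (J.mul a y) y = J.cmul a * J.pol y y + J.pol y y * J.cmul a := by
  have h1 := J.jordan_operator a y y
  have h2 := J.jordan_commutator a y y
  rw [J.mul_comm (J.mul a y) y, J.mul_comm y a] at *
  ext z
  have h1 := congrArg (fun f => f z) h1
  have h2 := congrArg (fun f => f z) h2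
  simp only [LinearMap.add_apply, Module.End.mul_apply, pol_apply, smul_apply,
    add_apply, mul_apply_eq_comp, cmul_apply, map_add, map_sub] at *
  rw [J.mul_comm (J.mul a y) y]
  linear_combination (norm := module) (-2 : ℝ) • h1 + h2

/-- The curve exp(-tL(a)) P(exp(tL(a)) y) exp(-tL(a)) has zero derivative by `two_pol_mul`; compare
t = 0 and t = 1. -/
theorem pol_expMul (a y : V) :
    J.pol (J.expMul a y) (J.expMul a y) = J.expMul a * J.pol y y * J.expMul a := by
  set A := J.cmul a with hA
  let F : ℝ → (V →L[ℝ] V) := fun t => NormedSpace.exp (t • (-A)) *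
    J.pol (NormedSpace.exp (t • A) y) (NormedSpace.exp (t • A) y) * NormedSpace.exp (t • (-A))
  have hF : ∀ t, HasDerivAt F 0 t := by
    intro t
    have d1 := hasDerivAt_exp_smul_const (𝕂 := ℝ) (-A) t
    have d2 := hasDerivAt_exp_smul_const' (𝕂 := ℝ) (-A) t
    have d3 : HasDerivAt (fun t : ℝ => NormedSpace.exp (t • A) y)
        (A (NormedSpace.exp (t • A) y)) t :=
      (hasDerivAt_exp_smul_const' (𝕂 := ℝ) A t).clm_apply (hasDerivAt_const t y) |>.congr_deriv
        (by simp)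
    set u := NormedSpace.exp (t • A) y
    have d4 : HasDerivAt (fun t : ℝ => J.pol (NormedSpace.exp (t • A) y)
        (NormedSpace.exp (t • A) y)) ((2 : ℝ) • J.pol (A u) u) t := by
      have e1 : HasDerivAt (fun t : ℝ => J.cmul (NormedSpace.exp (t • A) y)) (J.cmul (A u)) t :=
        J.cmul.hasFDerivAt.comp_hasDerivAt t d3
      have e2 := e1.mul e1
      have e3 : HasDerivAt (fun t : ℝ => J.cmul (J.cmul (NormedSpace.exp (t • A) y)
          (NormedSpace.exp (t • A) y))) (J.cmul (J.cmul (A u) u + J.cmul u (A u))) t :=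
        J.cmul.hasFDerivAt.comp_hasDerivAt t (e1.clm_apply d3)
      refine ((e2.add e2).sub e3).congr_deriv ?_
      ext z
      simp only [pol_apply, sub_apply, add_apply,
        mul_apply_eq_comp, cmul_apply, map_add, smul_apply]
      rw [J.mul_comm u (A u)]
      module
    refine ((d1.mul d4).mul d2).congr_deriv ?_
    have key := J.two_pol_mul a u
    rw [← cmul_apply, ← hA] at key
    rw [key]
    have ring_id : ∀ E B P : V →L[ℝ] V,
        (E * -B * P + E * (B * P + P * B)) * E + E * P * (-B * E) = 0 := by
      intro E B P; noncomm_ring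
    exact ring_id (NormedSpace.exp (t • -A)) A (J.pol u u)
  have h01 : F 1 = F 0 := is_const_of_deriv_eq_zero (fun t => (hF t).differentiableAt)
    (fun t => (hF t).deriv) 1 0
  have h0 : F 0 = J.pol y y := by simp [F]
  have h1 : F 1 = J.expMul (-a) * J.pol (J.expMul a y) (J.expMul a y) * J.expMul (-a) := by
    simp [F, expMul, hA]
  rw [← h0, ← h01, h1]
  simp only [← mul_assoc, J.expMul_mul_neg, _root_.one_mul]
  rw [mul_assoc, expMul_neg_mul, _root_.mul_one]

/-- The derivative at 0 is v ↦ ve = v, so the inverse function theorem applies to a ↦ exp L(a) e. -/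
theorem hasStrictFDerivAt_expMul_apply (e : V) (he : ∀ x, J.mul x e = x) :
    HasStrictFDerivAt (fun a => J.expMul a e) ((ContinuousLinearEquiv.refl ℝ V : V →L[ℝ] V)) 0 := by
  have h1 : HasStrictFDerivAt (NormedSpace.exp : (V →L[ℝ] V) → (V →L[ℝ] V))
      (1 : (V →L[ℝ] V) →L[ℝ] (V →L[ℝ] V)) (J.cmul 0) := by
    rw [map_zero]; exact hasStrictFDerivAt_exp_zero
  have h2 := (h1.comp 0 J.cmul.hasStrictFDerivAt).clm_apply (hasStrictFDerivAt_const e 0)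
  refine h2.congr_fderiv ?_
  ext v
  simp [he]

/-- The elements `exp L(a) e` fill a neighbourhood of `e`. -/
theorem eventually_expMul_apply (e : V) (he : ∀ x, J.mul x e = x) {Q : V → Prop}
    (h : ∀ a, Q (J.expMul a e)) : ∀ᶠ x in 𝓝 e, Q x := by
  have h1 := (J.hasStrictFDerivAt_expMul_apply e he).map_nhds_eq_of_equiv
  have h2 : J.expMul 0 e = e := by simp [expMul]
  rw [h2] at h1
  rw [← h1]
  exact Filter.mem_map.2 (Eventually.of_forall h)

/-- Analytic functions are determined by their values at the points `exp L(a) e`. -/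
theorem analytic_ext {E : Type*} [NormedAddCommGroup E] [NormedSpace ℝ E] [CompleteSpace E] (e : V)
    (he : ∀ x, J.mul x e = x) {F G : V → E} (hF : AnalyticOnNhd ℝ F Set.univ)
    (hG : AnalyticOnNhd ℝ G Set.univ) (h : ∀ a, F (J.expMul a e) = G (J.expMul a e)) : F = G :=
  hF.eq_of_eventuallyEq hG (J.eventually_expMul_apply e he h)

theorem analyticAt_cmul {E : Type*} [NormedAddCommGroup E] [NormedSpace ℝ E] {f g : E → V} {x : E}
    (hf : AnalyticAt ℝ f x) (hg : AnalyticAt ℝ g x) :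
    AnalyticAt ℝ (fun x => J.mul (f x) (g x)) x :=
  (J.cmul.analyticAt_bilinear (f x, g x)).comp₂ hf hg

theorem analyticAt_pol {E : Type*} [NormedAddCommGroup E] [NormedSpace ℝ E] {f g : E → V} {x : E}
    (hf : AnalyticAt ℝ f x) (hg : AnalyticAt ℝ g x) : AnalyticAt ℝ (fun x => J.pol (f x) (g x)) x := by
  have h1 : AnalyticAt ℝ (fun x => J.cmul (f x)) x := (J.cmul.analyticAt _).comp hf
  have h2 : AnalyticAt ℝ (fun x => J.cmul (g x)) x := (J.cmul.analyticAt _).comp hg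
  have h3 : AnalyticAt ℝ (fun x => J.cmul (J.cmul (f x) (g x))) x :=
    (J.cmul.analyticAt _).comp (J.analyticAt_cmul hf hg)
  exact ((h1.mul h2).add (h2.mul h1)).sub h3

theorem analyticAt_pol_apply {E : Type*} [NormedAddCommGroup E] [NormedSpace ℝ E] {f g h : E → V}
    {x : E} (hf : AnalyticAt ℝ f x) (hg : AnalyticAt ℝ g x) (hh : AnalyticAt ℝ h x) :
    AnalyticAt ℝ (fun x => J.pol (f x) (g x) (h x)) x :=
  ((ContinuousLinearMap.id ℝ (V →L[ℝ] V)).analyticAt_bilinear (J.pol (f x) (g x), h x)).comp₂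
    (J.analyticAt_pol hf hg) hh

end Continuous
end JordanAlg

/-! ### Powers, the fundamental formula, inverses and Hua's identity. -/

namespace JordanAlg

section Powers

variable {V : Type*} [NormedAddCommGroup V] [NormedSpace ℝ V] (J : JordanAlg V)

/-- Evaluation `p ↦ p(x)` of polynomials at `x`. -/
noncomputable def ev (x : V) : Polynomial ℝ →ₗ[ℝ] V :=
  LinearMap.applyₗ J.one ∘ₗ (Polynomial.aeval (R := ℝ) (A := Module.End ℝ V) (J.mul x)).toLinearMap

theorem ev_apply (x : V) (p : Polynomial ℝ) :
    J.ev x p = Polynomial.aeval (R := ℝ) (A := Module.End ℝ V) (J.mul x) p J.one := rfl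

theorem ev_X_mul (x : V) (p : Polynomial ℝ) : J.ev x (Polynomial.X * p) = J.mul x (J.ev x p) := by
  simp [ev_apply]

theorem mul_commute_sq (x : V) : J.mul (J.mul x x) * J.mul x = J.mul x * J.mul (J.mul x x) := by
  ext y; exact (J.jordan x y).symm

variable {J}

theorem mul_ev_commute (h1 : ∀ x, J.mul J.one x = x) (x : V) (p : Polynomial ℝ) :
    J.mul (J.ev x p) * J.mul x = J.mul x * J.mul (J.ev x p) := by
  have hle : Algebra.adjoin ℝ {J.mul x, J.mul (J.mul x x)} ≤
      Subalgebra.centralizer ℝ {J.mul x} := by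
    rw [Algebra.adjoin_le_iff]
    rintro y (rfl | rfl)
    · exact (Subalgebra.mem_centralizer_iff ℝ).2 (by rintro _ rfl; rfl)
    · exact (Subalgebra.mem_centralizer_iff ℝ).2 (by rintro _ rfl; exact (J.mul_commute_sq x).symm)
  have hmem : J.mul (J.ev x p) ∈ Algebra.adjoin ℝ {J.mul x, J.mul (J.mul x x)} := by
    induction p using Polynomial.induction_on' with
    | add p q hp hq => rw [map_add, map_add]; exact add_mem hp hq
    | monomial n a =>
      have : J.ev x (Polynomial.monomial n a) = a • ((J.mul x) ^ n) J.one := by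
        simp [ev_apply, Polynomial.aeval_monomial]
      rw [this, map_smul]
      exact Subalgebra.smul_mem _ (J.commute_mul_pow _ h1 x n) a
  have := Subalgebra.mem_centralizer_iff ℝ |>.1 (hle hmem)
  exact (this _ rfl).symm

theorem quad_ev (h1 : ∀ x, J.mul J.one x = x) (x : V) (p : Polynomial ℝ) :
    J.quad x (J.ev x p) = J.mul x (J.mul x (J.ev x p)) := by
  have hc : J.mul (J.mul x x) (J.ev x p) = J.mul x (J.mul x (J.ev x p)) := by
    induction p using Polynomial.induction_on' with
    | add p q hp hq => simp only [map_add, hp, hq]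
    | monomial n a =>
      have : J.ev x (Polynomial.monomial n a) = a • ((J.mul x) ^ n) J.one := by
        simp [ev_apply, Polynomial.aeval_monomial]
      rw [this]
      simp only [map_smul]
      congr 1
      induction n with
      | zero => simp [J.mul_comm _ J.one, h1]
      | succ n ih =>
        have h := LinearMap.congr_fun (J.mul_commute_sq x) (((J.mul x) ^ n) J.one)
        simp only [Module.End.mul_apply] at h
        rw [pow_succ', Module.End.mul_apply, h, ih]
        · simp [ev_apply, Polynomial.aeval_monomial]
  simp only [quad, LinearMap.sub_apply, LinearMap.smul_apply, LinearMap.comp_apply, hc]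
  module

end Powers

section Inverse

variable {V : Type*} [NormedAddCommGroup V] [NormedSpace ℝ V] [FiniteDimensional ℝ V]
  {J : JordanAlg V}

theorem pol_of_quadratic {g : V →L[ℝ] V} (hg : ∀ y, J.pol (g y) (g y) = g * J.pol y y * g)
    (u v : V) : J.pol (g u) (g v) = g * J.pol u v * g := by
  have h := hg (u + v)
  simp only [map_add, pol_add_left, pol_add_right, hg u, hg v, J.pol_comm v u,
    J.pol_comm (g v) (g u), _root_.mul_add, _root_.add_mul] at h
  ext z
  have := congrArg (fun f => f z) h
  simp only [add_apply, mul_apply_eq_comp] at this ⊢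
  linear_combination (norm := module) (1 / 2 : ℝ) • this

theorem pol_expMul_apply (a u v : V) :
    J.pol (J.expMul a u) (J.expMul a v) = J.expMul a * J.pol u v * J.expMul a :=
  pol_of_quadratic (J.pol_expMul a) u v

variable (h1 : ∀ x, J.mul J.one x = x)
include h1

theorem pol_one_left (x : V) : J.pol J.one x = J.cmul x := by
  ext z; simp [pol_apply, h1]

theorem pol_one_one : J.pol J.one J.one = 1 := by
  ext z; simp [pol_apply, h1]

theorem pol_expMul_one (a : V) :
    J.pol (J.expMul a J.one) (J.expMul a J.one) = J.expMul a * J.expMul a := by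
  rw [pol_expMul, pol_one_one h1, _root_.mul_one]

/-- The fundamental formula `P(P(x) y) = P(x) P(y) P(x)`. -/
theorem fundamental_formula (x y : V) :
    J.pol (J.pol x x y) (J.pol x x y) = J.pol x x * J.pol y y * J.pol x x := by
  have h1' : ∀ x, J.mul x J.one = x := fun x => by rw [J.mul_comm, h1]
  have an : ∀ x : V, AnalyticAt ℝ (fun x : V => J.pol x x) x := fun x =>
    J.analyticAt_pol analyticAt_id analyticAt_id
  have an' : ∀ x : V, AnalyticAt ℝ (fun x : V => J.pol x x y) x := fun x =>
    J.analyticAt_pol_apply analyticAt_id analyticAt_id analyticAt_const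
  refine congrFun (J.analytic_ext J.one h1' (F := fun x => J.pol (J.pol x x y) (J.pol x x y))
    (G := fun x => J.pol x x * J.pol y y * J.pol x x) (fun x _ => J.analyticAt_pol (an' x) (an' x))
    (fun x _ => ((an x).mul analyticAt_const).mul (an x)) fun a => ?_) x
  -- At x = exp L(a) e one has P(x) = (exp L(a))², so both sides unfold by applying `pol_expMul`
  -- twice.
  rw [pol_expMul_one h1]
  simp only [mul_apply_eq_comp, pol_expMul]
  noncomm_ring

theorem fundamental_formula_pol (x u v : V) :
    J.pol (J.pol x x u) (J.pol x x v) = J.pol x x * J.pol u v * J.pol x x :=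
  pol_of_quadratic (fundamental_formula h1 x) u v

/-- The identity `P(x, P(x) u) z = P(x) P(u, z) x`. -/
theorem pol_pol_apply (x u z : V) : J.pol x (J.pol x x u) z = J.pol x x (J.pol u z x) := by
  have h1' : ∀ x, J.mul x J.one = x := fun x => by rw [J.mul_comm, h1]
  have an' : ∀ x : V, AnalyticAt ℝ (fun x : V => J.pol x x u) x := fun x =>
    J.analyticAt_pol_apply analyticAt_id analyticAt_id analyticAt_const
  refine congrFun (J.analytic_ext J.one h1' (F := fun x => J.pol x (J.pol x x u) z)
    (G := fun x => J.pol x x (J.pol u z x))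
    (fun x _ => J.analyticAt_pol_apply analyticAt_id (an' x) analyticAt_const)
    (fun x _ => J.analyticAt_pol_apply analyticAt_id analyticAt_id
      (J.analyticAt_pol_apply analyticAt_const analyticAt_const analyticAt_id)) fun a => ?_) x
  rw [pol_expMul_one h1]
  -- For x = ge, with P(x) = g², both sides become g applied to the product of gu and gz.
  set g := J.expMul a
  have e1 : J.pol (g J.one) ((g * g) u) = g * J.pol J.one (g u) * g := by
    rw [mul_apply_eq_comp, pol_expMul_apply]
  have e2 : g (J.pol u z (g J.one)) = J.pol (g u) (g z) J.one := by
    rw [pol_expMul_apply]; rfl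
  rw [e1, mul_apply_eq_comp, mul_apply_eq_comp, mul_apply_eq_comp, e2, pol_one_left h1]
  congr 1
  simp only [pol_apply, h1', cmul_apply]
  rw [J.mul_comm (g z) (g u)]
  abel

omit h1

/-- The inverse `x⁻¹ = P(x)⁻¹ x`. -/
noncomputable def inv (J : JordanAlg V) (x : V) : V := Ring.inverse (J.pol x x) x

theorem isUnit_quad_iff (x : V) : IsUnit (J.quad x) ↔ IsUnit (J.pol x x) := by
  have e : J.quad x = ((J.pol x x : V →L[ℝ] V) : V →ₗ[ℝ] V) := by
    ext z; exact (J.pol_self_apply x z).symm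
  constructor
  · intro h
    obtain ⟨u, hu⟩ := h
    have h1 : J.quad x * (u⁻¹ : (Module.End ℝ V)ˣ) = 1 := by rw [← hu]; simp
    have h2 : (u⁻¹ : (Module.End ℝ V)ˣ) * J.quad x = 1 := by rw [← hu]; simp
    refine ⟨⟨J.pol x x, LinearMap.toContinuousLinearMap ((u⁻¹ : (Module.End ℝ V)ˣ) : V →ₗ[ℝ] V),
      ?_, ?_⟩, rfl⟩
    · ext z; rw [mul_apply_eq_comp, pol_self_apply]; exact LinearMap.congr_fun h1 z
    · ext z; rw [mul_apply_eq_comp, pol_self_apply]; exact LinearMap.congr_fun h2 z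
  · intro h
    rw [e]
    exact h.map (ContinuousLinearMap.toLinearMapRingHom (R₁ := ℝ) (M₁ := V))

theorem negInv_eq {x : V} (hx : IsUnit (J.pol x x)) : J.negInv x = -J.inv x := by
  have h := isUnit_quad_iff x |>.2 hx
  rw [negInv, inv]
  congr 1
  apply (Module.End.isUnit_iff _ |>.1 h).1
  have e1 : J.quad x (Ring.inverse (J.quad x) x) = x := by
    rw [← Module.End.mul_apply, Ring.mul_inverse_cancel _ h]; rfl
  rw [e1, ← pol_self_apply, ← mul_apply_eq_comp, Ring.mul_inverse_cancel _ hx]; rfl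

section
variable {x : V} (hx : IsUnit (J.pol x x))
include hx

theorem pol_mul_inverse : J.pol x x * Ring.inverse (J.pol x x) = 1 := Ring.mul_inverse_cancel _ hx

theorem inverse_mul_pol : Ring.inverse (J.pol x x) * J.pol x x = 1 := Ring.inverse_mul_cancel _ hx

theorem pol_apply_inv : J.pol x x (J.inv x) = x := by
  rw [inv, ← mul_apply_eq_comp, pol_mul_inverse hx]; rfl

theorem inverse_pol_eq {g : V →L[ℝ] V} (hg : J.pol x x * g = 1) : Ring.inverse (J.pol x x) = g := by
  rw [← _root_.mul_one (Ring.inverse _), ← hg, ← mul_assoc, inverse_mul_pol hx, _root_.one_mul]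

include h1

theorem pol_inv : J.pol (J.inv x) (J.inv x) = Ring.inverse (J.pol x x) := by
  have h := fundamental_formula h1 x (J.inv x)
  rw [pol_apply_inv hx] at h
  symm
  apply inverse_pol_eq hx
  calc _ = J.pol x x * J.pol (J.inv x) (J.inv x) * (J.pol x x * Ring.inverse (J.pol x x)) := by
        rw [pol_mul_inverse hx, _root_.mul_one]
    _ = 1 := by rw [← mul_assoc, ← h, pol_mul_inverse hx]

theorem isUnit_pol_inv : IsUnit (J.pol (J.inv x) (J.inv x)) := by
  rw [pol_inv h1 hx]; exact isUnit_ringInverse.2 hx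

theorem inverse_pol_inv : Ring.inverse (J.pol (J.inv x) (J.inv x)) = J.pol x x :=
  inverse_pol_eq (isUnit_pol_inv h1 hx) (by rw [pol_inv h1 hx, inverse_mul_pol hx])

theorem inv_inv : J.inv (J.inv x) = x := by
  rw [inv, inverse_pol_inv h1 hx, pol_apply_inv hx]

/-- The inverse of `x` is a polynomial in `x`, and an inverse for the product. -/
theorem exists_inv_eq_ev : ∃ q, J.inv x = J.ev x q ∧ J.mul x (J.inv x) = J.one := by
  -- On the span S of the powers of x, P(x) acts as L(x)² and so preserves S. Being injective on a
  -- finite-dimensional space, it is onto S, whence x⁻¹ ∈ S.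
  let S := LinearMap.range (J.ev x)
  have hS : ∀ w ∈ S, J.quad x w ∈ S := by
    rintro _ ⟨p, rfl⟩
    rw [quad_ev h1, ← ev_X_mul, ← ev_X_mul]
    exact ⟨_, rfl⟩
  have hinj : Function.Injective (J.quad x) :=
    (Module.End.isUnit_iff _ |>.1 (isUnit_quad_iff x |>.2 hx)).1
  have hsurj : Function.Surjective ((J.quad x).restrict hS) := by
    apply LinearMap.injective_iff_surjective.1
    intro a b hab
    exact Subtype.ext (hinj (congrArg Subtype.val hab))
  have hxS : x ∈ S := ⟨Polynomial.X, by simp [ev_apply, J.mul_comm x, h1]⟩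
  obtain ⟨⟨_, q, rfl⟩, hw⟩ := hsurj ⟨x, hxS⟩
  have hw' : J.quad x (J.ev x q) = x := congrArg Subtype.val hw
  have hq : J.inv x = J.ev x q := by
    apply hinj
    rw [hw', ← pol_self_apply, pol_apply_inv hx]
  refine ⟨q, hq, ?_⟩
  have h1e : J.ev x 1 = J.one := by simp [ev_apply]
  have hk : J.quad x (J.ev x (Polynomial.X * q - 1)) = 0 := by
    rw [quad_ev h1, map_sub, ev_X_mul, h1e, map_sub, ← quad_ev h1, hw', J.mul_comm x J.one, h1]
    simp
  have := hinj (hk.trans (map_zero _).symm)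
  rw [map_sub, ev_X_mul, h1e, sub_eq_zero] at this
  rw [hq, this]

theorem mul_inv : J.mul x (J.inv x) = J.one := (exists_inv_eq_ev h1 hx).choose_spec.2

theorem commute_mul_inv : J.mul (J.inv x) * J.mul x = J.mul x * J.mul (J.inv x) := by
  obtain ⟨q, hq, -⟩ := exists_inv_eq_ev h1 hx
  rw [hq, mul_ev_commute h1]

theorem pol_apply_inv_right (u : V) : J.pol x u (J.inv x) = u := by
  have h := LinearMap.congr_fun (commute_mul_inv h1 hx) u
  simp only [Module.End.mul_apply] at h
  rw [pol_apply, J.mul_comm (J.mul x u), h, mul_inv h1 hx, J.mul_comm u (J.inv x), J.mul_comm u, h1]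
  abel

/-- The identity `P(x) P(x⁻¹, v) z = P(x, z) v`. -/
theorem pol_pol_inv (v z : V) : J.pol x x (J.pol (J.inv x) v z) = J.pol x z v := by
  obtain ⟨z, rfl⟩ : ∃ z', z = J.pol x x z' :=
    ⟨Ring.inverse (J.pol x x) z, by rw [← mul_apply_eq_comp, pol_mul_inverse hx]; rfl⟩
  have h := fundamental_formula_pol h1 x (J.inv x) v
  rw [pol_apply_inv hx] at h
  have h2 := congrArg (fun f => f z) h
  simp only [mul_apply_eq_comp] at h2
  rw [← h2, pol_pol_apply h1, pol_pol_apply h1, J.pol_comm v z]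

end

include h1

/-- The identity `P(x) P(x⁻¹ + y⁻¹) P(y) = P(x + y)`. -/
theorem pol_inv_add_inv {x y : V} (hx : IsUnit (J.pol x x)) (hy : IsUnit (J.pol y y)) :
    J.pol x x * J.pol (J.inv x + J.inv y) (J.inv x + J.inv y) * J.pol y y =
      J.pol (x + y) (x + y) := by
  -- Only the mixed term needs an argument; the two pure terms follow from P(x⁻¹) = P(x)⁻¹.
  have key : J.pol x x * J.pol (J.inv x) (J.inv y) * J.pol y y = J.pol x y := by
    ext z
    simp only [mul_apply_eq_comp]
    rw [pol_pol_inv h1 hx]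
    have hw : IsUnit (J.pol (J.inv y) (J.inv y)) := isUnit_pol_inv h1 hy
    have hwi : ∀ v, J.pol (J.inv y) (J.inv y) (J.pol y y v) = v := fun v => by
      rw [← mul_apply_eq_comp, pol_inv h1 hy, inverse_mul_pol hy]; rfl
    have hinj : Function.Injective (J.pol (J.inv y) (J.inv y)) := fun a b hab => by
      have := congrArg (J.pol y y) hab
      rwa [← mul_apply_eq_comp, ← mul_apply_eq_comp, pol_inv h1 hy, pol_mul_inverse hy] at this
    have h2 := pol_pol_inv h1 hw x z
    rw [inv_inv h1 hy] at h2
    apply hinj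
    rw [J.pol_comm x y, h2, J.pol_comm x, ← pol_pol_apply h1, hwi]
  have e : ∀ a b : V, J.pol (a + b) (a + b) = J.pol a a + (2 : ℝ) • J.pol a b + J.pol b b := by
    intro a b
    rw [pol_add_left, pol_add_right, pol_add_right, J.pol_comm b a, two_smul]; abel
  rw [e, e, pol_inv h1 hx, pol_inv h1 hy, _root_.mul_add, _root_.mul_add, _root_.add_mul,
    _root_.add_mul, pol_mul_inverse hx, _root_.one_mul, mul_assoc, mul_assoc,
    inverse_mul_pol hy, _root_.mul_one, smul_mul_assoc, mul_smul_comm, ← mul_assoc, key]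
  abel

/-- Hua's identity. -/
theorem hua {x z : V} (hx : IsUnit (J.pol x x)) (hz : IsUnit (J.pol z z))
    (hxz : IsUnit (J.pol (x + z) (x + z))) :
    IsUnit (J.pol (J.inv z + J.inv x) (J.inv z + J.inv x)) ∧
    J.inv (x + z) = J.inv x - Ring.inverse (J.pol x x) (J.inv (J.inv z + J.inv x)) := by
  have h := pol_inv_add_inv h1 hz hx
  rw [add_comm z x] at h
  set s := J.inv z + J.inv x with hs
  have hsu : IsUnit (J.pol s s) := by
    have e : J.pol s s =
        Ring.inverse (J.pol z z) * J.pol (x + z) (x + z) * Ring.inverse (J.pol x x) := by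
      rw [← h, mul_assoc, mul_assoc, pol_mul_inverse hx, _root_.mul_one, ← mul_assoc,
        inverse_mul_pol hz, _root_.one_mul]
    rw [e]
    exact ((isUnit_ringInverse.2 hz).mul hxz).mul (isUnit_ringInverse.2 hx)
  refine ⟨hsu, ?_⟩
  have inj : ∀ {y : V}, IsUnit (J.pol y y) → Function.Injective (J.pol y y) := fun {y} hy a b hab => by
    have := congrArg (fun v => Ring.inverse (J.pol y y) v) hab
    rwa [← mul_apply_eq_comp, ← mul_apply_eq_comp, inverse_mul_pol hy] at this
  -- Applying P(s) and then P(z), and using P(z) P(s) P(x) = P(x + z), reduces the claim to P(x +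
  -- z)(x⁻¹ - (x + z)⁻¹) = P(z) s, which is bilinear expansion.
  have h2 : J.inv s = J.pol x x (J.inv x - J.inv (x + z)) := by
    apply inj hsu
    rw [pol_apply_inv hsu]
    apply inj hz
    have h3 : J.pol z z (J.pol s s (J.pol x x (J.inv x - J.inv (x + z)))) =
        J.pol (x + z) (x + z) (J.inv x - J.inv (x + z)) := by rw [← h]; rfl
    rw [h3, map_sub, pol_apply_inv hxz, hs, map_add, pol_apply_inv hz, pol_add_left, pol_add_right,
      pol_add_right, J.pol_comm z x]
    simp only [add_apply, pol_apply_inv hx, pol_apply_inv_right h1 hx]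
    abel
  rw [h2, ← mul_apply_eq_comp, inverse_mul_pol hx]
  simp

end Inverse
end JordanAlg

/-! ### Polynomial functions on a vector space. -/

section PolyFun

variable {V : Type*} [NormedAddCommGroup V] [NormedSpace ℝ V]

namespace IsPolyFun

theorem const (c : ℝ) : IsPolyFun V fun _ => c := ⟨MvPolynomial.C c, by simp⟩

theorem dual (φ : Module.Dual ℝ V) : IsPolyFun V φ := ⟨MvPolynomial.X φ, by simp⟩

theorem add {p q : V → ℝ} (hp : IsPolyFun V p) (hq : IsPolyFun V q) :
    IsPolyFun V fun x => p x + q x := by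
  obtain ⟨P, hP⟩ := hp
  obtain ⟨Q, hQ⟩ := hq
  exact ⟨P + Q, fun x => by simp [hP, hQ]⟩

theorem mul {p q : V → ℝ} (hp : IsPolyFun V p) (hq : IsPolyFun V q) :
    IsPolyFun V fun x => p x * q x := by
  obtain ⟨P, hP⟩ := hp
  obtain ⟨Q, hQ⟩ := hq
  exact ⟨P * Q, fun x => by simp [hP, hQ]⟩

theorem pow {p : V → ℝ} (hp : IsPolyFun V p) (k : ℕ) : IsPolyFun V fun x => p x ^ k := by
  obtain ⟨P, hP⟩ := hp
  exact ⟨P ^ k, fun x => by simp [hP]⟩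

theorem sub {p q : V → ℝ} (hp : IsPolyFun V p) (hq : IsPolyFun V q) :
    IsPolyFun V fun x => p x - q x := by
  obtain ⟨P, hP⟩ := hp
  obtain ⟨Q, hQ⟩ := hq
  exact ⟨P - Q, fun x => by simp [hP, hQ]⟩

theorem sum {ι : Type*} (s : Finset ι) {p : ι → V → ℝ} (hp : ∀ i ∈ s, IsPolyFun V (p i)) :
    IsPolyFun V fun x => ∑ i ∈ s, p i x := by
  classical
  induction s using Finset.induction_on with
  | empty => simpa using const 0
  | insert i s hi ih =>
    simp only [Finset.sum_insert hi]
    exact (hp i (by simp)).add (ih fun j hj => hp j (by simp [hj]))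

theorem prod {ι : Type*} (s : Finset ι) {p : ι → V → ℝ} (hp : ∀ i ∈ s, IsPolyFun V (p i)) :
    IsPolyFun V fun x => ∏ i ∈ s, p i x := by
  classical
  induction s using Finset.induction_on with
  | empty => simpa using const 1
  | insert i s hi ih =>
    simp only [Finset.prod_insert hi]
    exact (hp i (by simp)).mul (ih fun j hj => hp j (by simp [hj]))

/-- A map whose components are polynomial pulls polynomial functions back to such. -/
theorem comp {W : Type*} [NormedAddCommGroup W] [NormedSpace ℝ W] {f : W → V}
    (hf : ∀ φ : Module.Dual ℝ V, IsPolyFun W fun x => φ (f x)) {p : V → ℝ} (hp : IsPolyFun V p) :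
    IsPolyFun W fun x => p (f x) := by
  obtain ⟨P, hP⟩ := hp
  have key : ∀ P : MvPolynomial (Module.Dual ℝ V) ℝ,
      IsPolyFun W fun x => MvPolynomial.eval (fun φ : Module.Dual ℝ V => φ (f x)) P := by
    intro P
    induction P using MvPolynomial.induction_on with
    | C a => simpa using const a
    | add P Q hP' hQ' => simp only [map_add]; exact hP'.add hQ'
    | mul_X P φ hP' => simp only [map_mul, MvPolynomial.eval_X]; exact hP'.mul (hf φ)
  simp only [hP]
  exact key P

theorem comp_linear {W : Type*} [NormedAddCommGroup W] [NormedSpace ℝ W] (f : W →ₗ[ℝ] V)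
    {p : V → ℝ} (hp : IsPolyFun V p) : IsPolyFun W fun x => p (f x) :=
  hp.comp fun φ => dual (φ ∘ₗ f)

theorem comp_add {p : V → ℝ} (hp : IsPolyFun V p) (v : V) : IsPolyFun V fun x => p (x + v) :=
  hp.comp fun φ => by simpa using (dual φ).add (const (φ v))

end IsPolyFun

variable [FiniteDimensional ℝ V]

/-- The polynomial function on `V` given by a polynomial in the coordinates. -/
noncomputable def coordEval (x : V) : MvPolynomial (Fin (Module.finrank ℝ V)) ℝ →+* ℝ :=
  MvPolynomial.eval fun i => (Module.finBasis ℝ V).repr x i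

theorem coordEval_ext {P Q : MvPolynomial (Fin (Module.finrank ℝ V)) ℝ}
    (h : ∀ x : V, coordEval x P = coordEval x Q) : P = Q := by
  refine MvPolynomial.funext fun c => ?_
  have := h ((Module.finBasis ℝ V).equivFun.symm c)
  have e : (fun i => (Module.finBasis ℝ V).repr ((Module.finBasis ℝ V).equivFun.symm c) i) = c := by
    ext i
    rw [← Module.Basis.equivFun_apply, LinearEquiv.apply_symm_apply]
  simpa only [coordEval, e] using this

/-- Linear forms satisfy linear relations, so the polynomial in `IsPolyFun` is not unique.
Coordinates make it unique (`coordEval_ext`), and polynomial functions then inherit the arithmetic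
of `MvPolynomial`: no zero divisors, unique factorization. -/
theorem isPolyFun_iff {p : V → ℝ} :
    IsPolyFun V p ↔ ∃ P : MvPolynomial (Fin (Module.finrank ℝ V)) ℝ, ∀ x, p x = coordEval x P := by
  constructor
  · rintro ⟨Q, hQ⟩
    refine ⟨MvPolynomial.aeval (fun φ : Module.Dual ℝ V => ∑ i, MvPolynomial.C
      (φ (Module.finBasis ℝ V i)) * MvPolynomial.X i) Q, fun x => ?_⟩
    rw [hQ, coordEval, MvPolynomial.aeval_def, MvPolynomial.eval_eval₂, MvPolynomial.eval,
      MvPolynomial.coe_eval₂Hom]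
    congr 1
    · ext; simp
    · ext φ
      have h := congrArg φ ((Module.finBasis ℝ V).sum_repr x)
      simp only [map_sum, map_smul, smul_eq_mul] at h
      simp [← h, mul_comm]
  · rintro ⟨P, hP⟩
    refine ⟨MvPolynomial.rename (fun i => (Module.finBasis ℝ V).coord i) P, fun x => ?_⟩
    rw [hP, MvPolynomial.eval_rename, coordEval]
    rfl

namespace IsPolyFun

theorem analyticAt {p : V → ℝ} (hp : IsPolyFun V p) (x : V) : AnalyticAt ℝ p x := by
  obtain ⟨P, hP⟩ := isPolyFun_iff.1 hp
  have : p = fun x => MvPolynomial.eval ((Module.finBasis ℝ V).equivFun.toLinearMap x) P := by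
    ext x; rw [hP]; rfl
  rw [this]
  exact AnalyticOnNhd.eval_linearMap _ P x trivial

theorem continuous {p : V → ℝ} (hp : IsPolyFun V p) : Continuous p :=
  continuous_iff_continuousAt.2 fun x => (hp.analyticAt x).continuousAt

theorem mul_ne_zero {p q : V → ℝ} (hp : IsPolyFun V p) (hq : IsPolyFun V q) (hp0 : p ≠ 0)
    (hq0 : q ≠ 0) : (fun x => p x * q x) ≠ 0 := by
  obtain ⟨P, hP⟩ := isPolyFun_iff.1 hp
  obtain ⟨Q, hQ⟩ := isPolyFun_iff.1 hq
  intro h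
  have : P * Q = 0 := coordEval_ext (V := V) fun x => by
    rw [map_mul, ← hP, ← hQ, map_zero]; exact congrFun h x
  rcases mul_eq_zero.1 this with h' | h'
  · exact hp0 (funext fun x => by rw [hP, h', map_zero]; rfl)
  · exact hq0 (funext fun x => by rw [hQ, h', map_zero]; rfl)

/-- Polynomial functions that agree on a nonempty Zariski open set are equal. -/
theorem ext_of_ne_zero {m p q : V → ℝ} (hm : IsPolyFun V m) (hm0 : m ≠ 0) (hp : IsPolyFun V p)
    (hq : IsPolyFun V q) (h : ∀ x, m x ≠ 0 → p x = q x) : p = q := by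
  by_contra hpq
  apply mul_ne_zero hm (hp.sub hq) hm0
  · intro h0
    exact hpq (funext fun x => sub_eq_zero.1 (congrFun h0 x))
  · ext x
    by_cases hx : m x = 0
    · simp [hx]
    · simp [h x hx]

end IsPolyFun

theorem isPolyFun_linearMap_det {f : V → Module.End ℝ V}
    (hf : ∀ (φ : Module.Dual ℝ V) (v : V), IsPolyFun V fun x => φ (f x v)) :
    IsPolyFun V fun x => LinearMap.det (f x) := by
  have e : (fun x => LinearMap.det (f x)) = fun x => ∑ σ : Equiv.Perm (Fin (Module.finrank ℝ V)),
      ((Equiv.Perm.sign σ : ℤ) : ℝ) * ∏ i, (Module.finBasis ℝ V).coord (σ i)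
        (f x (Module.finBasis ℝ V i)) := by
    ext x
    rw [← LinearMap.det_toMatrix (Module.finBasis ℝ V), Matrix.det_apply']
    simp [LinearMap.toMatrix_apply]
  rw [e]
  exact IsPolyFun.sum _ fun σ _ => (IsPolyFun.const _).mul (IsPolyFun.prod _ fun i _ => hf _ _)

end PolyFun

/-! ### Minimal polynomials of elements. -/

namespace JordanAlg

section MinPoly

open Polynomial

variable {V : Type*} [NormedAddCommGroup V] [NormedSpace ℝ V] [FiniteDimensional ℝ V]
  {J : JordanAlg V}

omit [FiniteDimensional ℝ V] in
theorem mem_annIdeal {x : V} {p : ℝ[X]} : p ∈ J.annIdeal x ↔ J.ev x p = 0 := Iff.rfl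

omit [FiniteDimensional ℝ V] in
theorem minPoly_dvd_iff {x : V} {p : ℝ[X]} : J.minPoly x ∣ p ↔ J.ev x p = 0 := by
  rw [minPoly, normalize_dvd_iff, ← Submodule.IsPrincipal.mem_iff_generator_dvd, mem_annIdeal]

theorem ev_minPoly (x : V) : J.ev x (J.minPoly x) = 0 := minPoly_dvd_iff.1 dvd_rfl

/-- Cayley–Hamilton for L(x) makes the annihilator nonzero; otherwise the normalized generator would
be 0. -/
theorem minPoly_monic (x : V) : (J.minPoly x).Monic := by
  apply Polynomial.monic_normalize
  intro h
  have h1 : LinearMap.charpoly (J.mul x) ∈ J.annIdeal x := by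
    rw [mem_annIdeal, ev_apply, LinearMap.aeval_self_charpoly]; rfl
  rw [Submodule.IsPrincipal.mem_iff_generator_dvd, h, zero_dvd_iff] at h1
  exact (LinearMap.charpoly_monic (J.mul x)).ne_zero h1

theorem natDegree_minPoly_le {x : V} {p : ℝ[X]} (hp : J.ev x p = 0) (h0 : p ≠ 0) :
    (J.minPoly x).natDegree ≤ p.natDegree :=
  Polynomial.natDegree_le_of_dvd (minPoly_dvd_iff.2 hp) h0

theorem minPoly_eq {x : V} {p : ℝ[X]} (hp : J.ev x p = 0) (h0 : p.Monic)
    (hd : p.natDegree ≤ (J.minPoly x).natDegree) : J.minPoly x = p :=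
  (Polynomial.eq_of_monic_of_dvd_of_natDegree_le (minPoly_monic x) h0 (minPoly_dvd_iff.2 hp) hd).symm

/-- Without this bound the supremum in `rankOn` could take the default value 0. -/
theorem natDegree_minPoly_le_finrank (x : V) :
    (J.minPoly x).natDegree ≤ Module.finrank ℝ V := by
  rw [← LinearMap.charpoly_natDegree (J.mul x)]
  refine natDegree_minPoly_le ?_ (LinearMap.charpoly_monic (J.mul x)).ne_zero
  rw [ev_apply, LinearMap.aeval_self_charpoly]; rfl

theorem natDegree_minPoly_le_rankOn {S : Set V} {x : V} (hx : x ∈ S) :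
    (J.minPoly x).natDegree ≤ J.rankOn S :=
  le_csSup ⟨Module.finrank ℝ V, by rintro _ ⟨y, -, rfl⟩; exact natDegree_minPoly_le_finrank y⟩
    ⟨x, hx, rfl⟩

theorem natDegree_minPoly_le_rank (x : V) : (J.minPoly x).natDegree ≤ J.rank :=
  natDegree_minPoly_le_rankOn (Set.mem_univ x)

theorem rankOn_le_rank {S : Set V} (hS : S.Nonempty) : J.rankOn S ≤ J.rank := by
  obtain ⟨x, hx⟩ := hS
  exact csSup_le ⟨_, x, hx, rfl⟩ (by rintro _ ⟨y, -, rfl⟩; exact natDegree_minPoly_le_rank y)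

theorem one_le_rankOn (h0 : J.one ≠ 0) {S : Set V} (hS : S.Nonempty) : 1 ≤ J.rankOn S := by
  obtain ⟨x, hx⟩ := hS
  refine le_trans ?_ (natDegree_minPoly_le_rankOn hx)
  rw [Nat.one_le_iff_ne_zero]
  intro h
  have h1 := ev_minPoly (J := J) x
  rw [(Polynomial.Monic.natDegree_eq_zero (minPoly_monic x)).1 h] at h1
  exact h0 (by simpa [ev_apply] using h1)

theorem minPoly_smul {t : ℝ} (ht : t ≠ 0) (x : V) :
    J.minPoly (t • x) = (J.minPoly x).scaleRoots t := by
  have key : ∀ (t : ℝ) (x : V) (p : ℝ[X]), J.ev x p = 0 → J.ev (t • x) (p.scaleRoots t) = 0 := by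
    intro t x p hp
    have h : aeval (R := ℝ) (A := Module.End ℝ V) (J.mul (t • x)) (p.scaleRoots t) =
        t ^ p.natDegree • aeval (R := ℝ) (A := Module.End ℝ V) (J.mul x) p := by
      have := scaleRoots_eval₂_mul_of_commute (p := p) (algebraMap ℝ (Module.End ℝ V)) (J.mul x) t
        (Algebra.commutes _ _) (fun s₁ s₂ => (Algebra.commutes _ _))
      rw [map_smul, Algebra.smul_def, aeval_def, this, Algebra.smul_def, map_pow, aeval_def]
    rw [ev_apply, h, LinearMap.smul_apply, ← ev_apply, hp, smul_zero]
  refine minPoly_eq (key t x _ (ev_minPoly x)) ((monic_scaleRoots_iff t).2 (minPoly_monic x)) ?_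
  have h := key t⁻¹ (t • x) _ (ev_minPoly _)
  rw [inv_smul_smul₀ ht] at h
  have h2 := natDegree_minPoly_le h
    ((monic_scaleRoots_iff t⁻¹).2 (minPoly_monic (J := J) (t • x))).ne_zero
  rwa [natDegree_scaleRoots, ← natDegree_scaleRoots (J.minPoly x) t] at h2

theorem minPoly_map {α : V →ₗ[ℝ] V} (hα : Function.Injective α)
    (hmul : ∀ x y, α (J.mul x y) = J.mul (α x) (α y)) (hone : α J.one = J.one) (x : V) :
    J.minPoly (α x) = J.minPoly x := by
  have key : ∀ p, J.ev (α x) p = α (J.ev x p) := by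
    intro p
    induction p using Polynomial.induction_on' with
    | add p q hp hq => simp only [map_add, hp, hq]
    | monomial n a =>
      rw [← C_mul_X_pow_eq_monomial, ← smul_eq_C_mul, map_smul, map_smul, map_smul]
      congr 1
      induction n with
      | zero => simp [ev_apply, hone]
      | succ n ih => rw [pow_succ', ev_X_mul, ev_X_mul, ih, hmul]
  refine Polynomial.eq_of_monic_of_associated (minPoly_monic _) (minPoly_monic _)
    (associated_of_dvd_dvd ?_ ?_)
  · rw [minPoly_dvd_iff, key, ev_minPoly, map_zero]
  · rw [minPoly_dvd_iff, ← map_eq_zero_iff α hα, ← key, ev_minPoly]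

/-- Reversing coefficients exchanges annihilators of x and of x⁻¹. At a regular x no degree is lost,
so the minimal polynomial of x⁻¹ is the reversal of f_x divided by its leading coefficient f_x(0).
This is the source of Δ(x) Δ(x⁻¹) = 1. -/
theorem minPoly_coeff_zero_mul_inv (h1 : ∀ x, J.mul J.one x = x) {x : V} (hx : IsUnit (J.pol x x))
    (hr : (J.minPoly x).natDegree = J.rank) :
    (J.minPoly (J.inv x)).natDegree = J.rank ∧
      (J.minPoly x).coeff 0 * (J.minPoly (J.inv x)).coeff 0 = 1 := by
  -- Multiplying the reversed polynomial at x⁻¹ by x^N turns each x^(-(N-n)) into x^n, because L(x)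
  -- and L(x⁻¹) commute.
  have key : ∀ {x : V}, IsUnit (J.pol x x) → ∀ (N : ℕ) (p : ℝ[X]), p.natDegree ≤ N →
      ((J.mul x) ^ N) (J.ev (J.inv x) (p.reflect N)) = J.ev x p := by
    intro x hx N p hp
    refine Polynomial.induction_with_natDegree_le
      (fun p => ((J.mul x) ^ N) (J.ev (J.inv x) (p.reflect N)) = J.ev x p) N ?_ ?_ ?_ p hp
    · simp
    · intro n r _ hn
      rw [reflect_C_mul_X_pow, revAt_le hn, ← smul_eq_C_mul, ← smul_eq_C_mul, map_smul, map_smul,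
        map_smul]
      congr 1
      have hc : Commute (J.mul x) (J.mul (J.inv x)) := (commute_mul_inv h1 hx).symm
      have hpow : ∀ m, ((J.mul x) ^ m * (J.mul (J.inv x)) ^ m) J.one = J.one := by
        intro m
        rw [← hc.mul_pow]
        induction m with
        | zero => simp
        | succ m ih =>
          rw [pow_succ, Module.End.mul_apply, Module.End.mul_apply, J.mul_comm (J.inv x), h1,
            mul_inv h1 hx, ih]
      have e : (J.mul x) ^ N = (J.mul x) ^ n * (J.mul x) ^ (N - n) := by
        rw [← pow_add]; congr 1; omega
      have := hpow (N - n)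
      simp only [ev_apply, map_pow, aeval_X]
      rw [e, Module.End.mul_apply, ← Module.End.mul_apply ((J.mul x) ^ (N - n)), this]
    · intro p q _ _ hp hq
      simp only [reflect_add, map_add, hp, hq]
  have key2 : ∀ {x : V}, IsUnit (J.pol x x) → ∀ (N : ℕ) (p : ℝ[X]), p.natDegree ≤ N →
      J.ev (J.inv x) p = 0 → J.ev x (p.reflect N) = 0 := by
    intro x hx N p hp h0
    rw [← key hx N _ (by
      refine natDegree_reflect_le.trans (max_le le_rfl hp)), reflect_reflect, h0, map_zero]
  have hx' := isUnit_pol_inv h1 hx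
  set y := J.inv x with hy
  have hxy : J.inv y = x := inv_inv h1 hx
  have hd : (J.minPoly y).natDegree = J.rank := by
    apply le_antisymm (natDegree_minPoly_le_rank y)
    have h := natDegree_minPoly_le (key2 hx _ _ le_rfl (ev_minPoly y)) (by
      rw [Ne, reflect_eq_zero_iff]; exact (minPoly_monic y).ne_zero)
    rw [hr] at h
    exact h.trans (natDegree_reflect_le.trans (by simp))
  refine ⟨hd, ?_⟩
  have h2 : J.ev y ((J.minPoly x).reflect J.rank) = 0 := by
    apply key2 hx' _ _ hr.le
    rw [hxy]; exact ev_minPoly x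
  obtain ⟨c, hc⟩ := minPoly_dvd_iff.2 h2
  have hf0 : (J.minPoly x).reflect J.rank ≠ 0 := by
    rw [Ne, reflect_eq_zero_iff]; exact (minPoly_monic x).ne_zero
  have hc0 : c ≠ 0 := by rintro rfl; exact hf0 (by simpa using hc)
  have hdeg : c.natDegree = 0 := by
    have h3 := congrArg natDegree hc
    rw [natDegree_mul (minPoly_monic y).ne_zero hc0, hd] at h3
    have h4 : ((J.minPoly x).reflect J.rank).natDegree ≤ J.rank :=
      natDegree_reflect_le.trans (by simp [hr])
    omega
  rw [Polynomial.eq_C_of_natDegree_eq_zero hdeg] at hc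
  have c0 := congrArg (fun p => coeff p 0) hc
  have cr := congrArg (fun p => coeff p J.rank) hc
  simp only [coeff_reflect, coeff_mul_C, revAt_zero, revAt_le le_rfl, Nat.sub_self] at c0 cr
  have l1 : (J.minPoly x).coeff J.rank = 1 := by rw [← hr]; exact minPoly_monic x
  have l2 : (J.minPoly y).coeff J.rank = 1 := by rw [← hd]; exact minPoly_monic y
  rw [l1] at c0
  rw [l2] at cr
  rw [cr, _root_.one_mul, _root_.mul_comm, ← c0]

end MinPoly

end JordanAlg

/-! ### Minimal annihilator of a vector over an integrally closed domain. -/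

section KrylovVector

open Polynomial Matrix

/-- The vector `p(M) v`. -/
noncomputable def krylov {R : Type*} [CommRing R] {n : ℕ} (M : Matrix (Fin n) (Fin n) R)
    (v : Fin n → R) : R[X] →ₗ[R] (Fin n → R) where
  toFun p := aeval M p *ᵥ v
  map_add' p q := by rw [map_add, Matrix.add_mulVec]
  map_smul' c p := by rw [map_smul, Matrix.smul_mulVec]; rfl

theorem krylov_apply {R : Type*} [CommRing R] {n : ℕ} (M : Matrix (Fin n) (Fin n) R)
    (v : Fin n → R) (p : R[X]) : krylov M v p = aeval M p *ᵥ v := rfl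

theorem map_krylov {R S : Type*} [CommRing R] [CommRing S] (f : R →+* S) {n : ℕ}
    (M : Matrix (Fin n) (Fin n) R) (v : Fin n → R) (p : R[X]) (i : Fin n) :
    f (krylov M v p i) = krylov (M.map f) (f ∘ v) (p.map f) i := by
  have h : (aeval M p).map f = aeval (M.map f) (p.map f) := by
    have h1 : (f.mapMatrix : Matrix (Fin n) (Fin n) R →+* _).comp
        (algebraMap R (Matrix (Fin n) (Fin n) R)) =
        (algebraMap S (Matrix (Fin n) (Fin n) S)).comp f := by
      ext c i j
      by_cases hij : i = j
      · subst hij; simp [Matrix.algebraMap_matrix_apply]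
      · simp [Matrix.algebraMap_matrix_apply, hij]
    rw [aeval_def, aeval_def, eval₂_map, ← h1]
    exact hom_eval₂ p _ (f.mapMatrix : Matrix (Fin n) (Fin n) R →+* _) M
  rw [krylov_apply, krylov_apply, ← h, RingHom.map_mulVec]

/-- The minimal annihilating polynomial of a vector over an integrally closed domain, with a
certificate for its minimality. -/
theorem exists_minimal_annihilator {R : Type*} [CommRing R] [IsDomain R] [IsIntegrallyClosed R]
    {n : ℕ} (M : Matrix (Fin n) (Fin n) R) (v : Fin n → R) :
    ∃ (μ : R[X]) (b : R) (N : Fin μ.natDegree → Fin n → R), μ.Monic ∧ krylov M v μ = 0 ∧ b ≠ 0 ∧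
      ∀ j k : Fin μ.natDegree, ∑ i, N k i * krylov M v (X ^ (j : ℕ)) i = if k = j then b else 0 := by
  classical
  let K := FractionRing R
  have hinj : Function.Injective (algebraMap R K) := IsFractionRing.injective R K
  set MK := M.map (algebraMap R K) with hMK
  set vK := algebraMap R K ∘ v with hvK
  let I : Ideal K[X] :=
    { carrier := {p | krylov MK vK p = 0}
      zero_mem' := map_zero _
      add_mem' := fun {p q} hp hq => by
        rw [Set.mem_ofPred_eq] at hp hq ⊢
        rw [map_add, hp, hq, add_zero]
      smul_mem' := fun c p hp => by
        rw [Set.mem_ofPred_eq] at hp ⊢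
        rw [krylov_apply] at hp ⊢
        rw [smul_eq_mul, map_mul, ← Matrix.mulVec_mulVec, hp, Matrix.mulVec_zero] }
  have hI : ∀ p, p ∈ I ↔ krylov MK vK p = 0 := fun p => Iff.rfl
  set g := Submodule.IsPrincipal.generator I with hg
  have hgI : ∀ p, krylov MK vK p = 0 ↔ normalize g ∣ p := fun p => by
    rw [normalize_dvd_iff, ← hI, ← Submodule.IsPrincipal.mem_iff_generator_dvd]
  have hchar : normalize g ∣ M.charpoly.map (algebraMap R K) := by
    rw [← hgI, ← Matrix.charpoly_map, krylov_apply, Matrix.aeval_self_charpoly, Matrix.zero_mulVec]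
  have hcm : (M.charpoly.map (algebraMap R K)).Monic := (Matrix.charpoly_monic M).map _
  have hg0 : g ≠ 0 := by
    intro h0
    rw [h0, normalize_zero, zero_dvd_iff] at hchar
    exact hcm.ne_zero hchar
  have hmon : (normalize g).Monic := Polynomial.monic_normalize hg0
  -- Gauss's lemma: a monic divisor, over the fraction field, of the characteristic polynomial
  -- already has coefficients in R.
  obtain ⟨μ, hμ⟩ := IsIntegrallyClosed.eq_map_mul_C_of_dvd K (Matrix.charpoly_monic M) hchar
  rw [hmon.leadingCoeff, map_one, mul_one] at hμ
  have hμm : μ.Monic := by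
    apply Polynomial.monic_of_injective hinj
    rw [hμ]; exact hmon
  have hd : μ.natDegree = (normalize g).natDegree := by
    rw [← hμ, Polynomial.natDegree_map_eq_of_injective hinj]
  have hμ0 : krylov M v μ = 0 := by
    ext i
    apply hinj
    rw [map_krylov, hμ, (hgI _).2 dvd_rfl]
    simp
  let u : Fin μ.natDegree → (Fin n → K) := fun k => krylov MK vK (X ^ (k : ℕ))
  have hu : LinearIndependent K u := by
    rw [Fintype.linearIndependent_iff]
    intro c hc
    set p : K[X] := ∑ k : Fin μ.natDegree, c k • X ^ (k : ℕ) with hp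
    have hp0 : krylov MK vK p = 0 := by rw [hp, map_sum, ← hc]; simp [u]
    have hcoeff : ∀ k : Fin μ.natDegree, p.coeff k = c k := by
      intro k
      simp only [hp, finsetSum_coeff, coeff_smul, coeff_X_pow, smul_eq_mul, mul_ite, mul_one,
        mul_zero, Fin.val_inj]
      simp
    have hdeg : p.degree < (normalize g).degree := by
      rw [Polynomial.degree_eq_natDegree hmon.ne_zero, ← hd]
      refine lt_of_le_of_lt (Polynomial.degree_sum_le _ _) ?_
      rw [Finset.sup_lt_iff (by exact WithBot.bot_lt_coe _)]
      intro k _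
      refine lt_of_le_of_lt (degree_smul_le _ _) ?_
      rw [degree_X_pow]
      exact_mod_cast k.2
    have hz : p = 0 := Polynomial.eq_zero_of_dvd_of_degree_lt ((hgI p).1 hp0) hdeg
    intro k
    rw [← hcoeff, hz, coeff_zero]
  -- The certificate is a left inverse of the independent family M^j v, multiplied by a common
  -- denominator b of its entries.
  obtain ⟨S, hS⟩ := LinearMap.exists_leftInverse_of_injective (Fintype.linearCombination K u)
    (LinearMap.ker_eq_bot.2 hu.fintypeLinearCombination_injective)
  have hSu : ∀ j k, S (u j) k = if k = j then 1 else 0 := by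
    intro j k
    have h := LinearMap.congr_fun hS (Pi.single j 1)
    simp only [LinearMap.comp_apply, Fintype.linearCombination_apply_single, one_smul,
      LinearMap.id_apply] at h
    rw [h, Pi.single_apply]
  obtain ⟨b, hb⟩ := IsLocalization.exist_integer_multiples_of_finite (nonZeroDivisors R)
    (fun ki : Fin μ.natDegree × Fin n => (LinearMap.toMatrix' S) ki.1 ki.2)
  choose N hN using hb
  refine ⟨μ, b, fun k i => N (k, i), hμm, hμ0, nonZeroDivisors.ne_zero b.2, fun j k => ?_⟩
  apply hinj
  rw [map_sum]
  have e : ∀ i, algebraMap R K (N (k, i) * krylov M v (X ^ (j : ℕ)) i) =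
      algebraMap R K b * ((LinearMap.toMatrix' S) k i * u j i) := by
    intro i
    rw [map_mul, map_krylov, hN, Algebra.smul_def, mul_assoc]
    simp only [Polynomial.map_pow, map_X, u, hMK, hvK]
  simp only [e, ← Finset.mul_sum]
  have h2 : ∑ i, (LinearMap.toMatrix' S) k i * u j i = S (u j) k := by
    rw [← LinearMap.toMatrix'_mulVec S (u j)]; rfl
  rw [h2, hSu]
  split_ifs <;> simp

end KrylovVector

/-! ### The generic minimal polynomial and the Jordan polynomial. -/

namespace JordanAlg

section JordanPolynomial

open Polynomial Matrix

variable {V : Type*} [NormedAddCommGroup V] [NormedSpace ℝ V] [FiniteDimensional ℝ V]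
  {J : JordanAlg V}

theorem krylov_eq_ev (x : V) (p : ℝ[X]) (i : Fin (Module.finrank ℝ V)) :
    krylov (LinearMap.toMatrix (Module.finBasis ℝ V) (Module.finBasis ℝ V) (J.mul x))
      (fun i => (Module.finBasis ℝ V).repr J.one i) p i =
      (Module.finBasis ℝ V).repr (J.ev x p) i := by
  have h := LinearMap.toMatrix_mulVec_repr (Module.finBasis ℝ V) (Module.finBasis ℝ V)
    (aeval (R := ℝ) (A := Module.End ℝ V) (J.mul x) p) J.one
  rw [ev_apply, ← h, krylov_apply]
  congr 2
  have := Polynomial.aeval_algHom_apply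
    (LinearMap.toMatrixAlgEquiv (Module.finBasis ℝ V)).toAlgHom (J.mul x) p
  exact this

/-- Apply `exists_minimal_annihilator` to the matrix of multiplication by the generic element, over
the ring of polynomials in the coordinates. Specialization keeps the annihilation everywhere and
keeps the minimality wherever the denominator m of the certificate is nonzero. -/
theorem exists_generic_minPoly (J : JordanAlg V) :
    ∃ (μ : (MvPolynomial (Fin (Module.finrank ℝ V)) ℝ)[X])
      (m : MvPolynomial (Fin (Module.finrank ℝ V)) ℝ), μ.Monic ∧ m ≠ 0 ∧
      (∀ x, J.ev x (μ.map (coordEval x)) = 0) ∧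
      ∀ x, coordEval x m ≠ 0 → μ.natDegree ≤ (J.minPoly x).natDegree := by
  set B := Module.finBasis ℝ V
  let M : Matrix (Fin (Module.finrank ℝ V)) (Fin (Module.finrank ℝ V))
      (MvPolynomial (Fin (Module.finrank ℝ V)) ℝ) := fun i j =>
    ∑ k, MvPolynomial.X k * MvPolynomial.C (B.repr (J.mul (B k) (B j)) i)
  let v : Fin (Module.finrank ℝ V) → MvPolynomial (Fin (Module.finrank ℝ V)) ℝ :=
    fun i => MvPolynomial.C (B.repr J.one i)
  have hM : ∀ x, M.map (coordEval x) = LinearMap.toMatrix B B (J.mul x) := by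
    intro x
    ext i j
    rw [LinearMap.toMatrix_apply]
    have h := congrArg (fun y => B.repr (J.mul y (B j)) i) (B.sum_repr x)
    simp only [map_sum, map_smul, LinearMap.sum_apply, LinearMap.smul_apply, Finsupp.coe_finsetSum,
      Finset.sum_apply, Finsupp.smul_apply, smul_eq_mul] at h
    rw [← h, Matrix.map_apply]
    simp [M, coordEval, B]
  have hv : ∀ x : V, coordEval x ∘ v = fun i => B.repr J.one i := by
    intro x; ext i; simp [v, coordEval]
  have hev : ∀ (x : V) p i, coordEval x (krylov M v p i) = B.repr (J.ev x (p.map (coordEval x))) i := by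
    intro x p i
    rw [map_krylov, hM, hv, krylov_eq_ev]
  obtain ⟨μ, m, N, hμ, hμ0, hm, hN⟩ := exists_minimal_annihilator M v
  refine ⟨μ, m, hμ, hm, fun x => ?_, fun x hx => ?_⟩
  · apply B.repr.injective
    ext i
    rw [← hev, hμ0]
    simp
  · by_contra! hlt
    -- Pairing the relation f_x(x) = 0, of degree k < deg μ, with row k of the certificate isolates
    -- its leading coefficient 1 and gives m(x) = 0.
    set k : Fin μ.natDegree := ⟨_, hlt⟩ with hk
    have h0 := ev_minPoly (J := J) x
    rw [Polynomial.as_sum_range_C_mul_X_pow' (J.minPoly x) hlt] at h0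
    have h1 : ∑ i, coordEval x (N k i) * B.repr (J.ev x
        (∑ j ∈ Finset.range μ.natDegree, C ((J.minPoly x).coeff j) * X ^ j)) i = 0 := by
      rw [h0]; simp
    have h2 : ∀ i, B.repr (J.ev x
        (∑ j ∈ Finset.range μ.natDegree, C ((J.minPoly x).coeff j) * X ^ j)) i =
        ∑ j : Fin μ.natDegree, (J.minPoly x).coeff j * coordEval x (krylov M v (X ^ (j : ℕ)) i) := by
      intro i
      rw [Finset.sum_range, map_sum, map_sum, Finsupp.finsetSum_apply]
      refine Finset.sum_congr rfl fun j _ => ?_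
      rw [hev, ← smul_eq_C_mul, map_smul, map_smul, Finsupp.smul_apply, smul_eq_mul]
      simp
    simp only [h2, Finset.mul_sum] at h1
    rw [Finset.sum_comm] at h1
    have h3 : ∀ j : Fin μ.natDegree, ∑ i, coordEval x (N k i) * ((J.minPoly x).coeff j *
        coordEval x (krylov M v (X ^ (j : ℕ)) i)) =
        (J.minPoly x).coeff j * if k = j then coordEval x m else 0 := by
      intro j
      have := congrArg (coordEval x) (hN j k)
      rw [map_sum] at this
      rw [apply_ite (coordEval x), map_zero] at this
      rw [← this, Finset.mul_sum]
      refine Finset.sum_congr rfl fun i _ => ?_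
      rw [map_mul]; ring
    simp only [h3] at h1
    simp only [mul_ite, mul_zero, Finset.sum_ite_eq, Finset.mem_univ, if_true] at h1
    have h4 : (J.minPoly x).coeff k = 1 := minPoly_monic x
    rw [h4, _root_.one_mul] at h1
    exact hx h1

/-- The Jordan polynomial is a polynomial function, given at generic points by the constant
coefficient of the minimal polynomial. -/
theorem jdet_spec (J : JordanAlg V) : IsPolyFun V J.jdet ∧
    ∀ x, (J.minPoly x).natDegree = J.rank → J.jdet x = (-1) ^ J.rank * (J.minPoly x).coeff 0 := by
  obtain ⟨μ, m, hμ, hm, hμ0, hmd⟩ := exists_generic_minPoly J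
  have hle : ∀ x, (J.minPoly x).natDegree ≤ μ.natDegree := fun x => by
    have := natDegree_minPoly_le (hμ0 x) (hμ.map _).ne_zero
    rwa [hμ.natDegree_map] at this
  have hr : J.rank ≤ μ.natDegree :=
    csSup_le ⟨_, 0, Set.mem_univ _, rfl⟩ (by rintro _ ⟨y, -, rfl⟩; exact hle y)
  -- The witness is, up to sign, the constant coefficient of the generic minimal polynomial, which
  -- at a regular x specializes to f_x.
  refine Classical.epsilon_spec (p := fun D : V → ℝ => IsPolyFun V D ∧ ∀ x,
    (J.minPoly x).natDegree = J.rank → D x = (-1) ^ J.rank * (J.minPoly x).coeff 0)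
    ⟨fun x => coordEval x (MvPolynomial.C ((-1) ^ J.rank) * μ.coeff 0),
      isPolyFun_iff.2 ⟨_, fun _ => rfl⟩, fun x hx => ?_⟩
  have hd : μ.natDegree ≤ J.rank := by
    obtain ⟨y, hy⟩ : ∃ y : V, coordEval y m ≠ 0 := by
      by_contra! h
      exact hm (coordEval_ext fun y => by rw [h y, map_zero])
    exact (hmd y hy).trans (natDegree_minPoly_le_rank y)
  rw [minPoly_eq (hμ0 x) (hμ.map _) (by rw [hμ.natDegree_map, hx]; exact hd), coeff_map]
  simp [coordEval]

theorem exists_regular (J : JordanAlg V) : ∃ m : V → ℝ, IsPolyFun V m ∧ m ≠ 0 ∧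
    ∀ x, m x ≠ 0 → (J.minPoly x).natDegree = J.rank := by
  obtain ⟨μ, m, hμ, hm, hμ0, hmd⟩ := exists_generic_minPoly J
  have hr : J.rank ≤ μ.natDegree :=
    csSup_le ⟨_, 0, Set.mem_univ _, rfl⟩ (by
      rintro _ ⟨y, -, rfl⟩
      have := natDegree_minPoly_le (hμ0 y) (hμ.map _).ne_zero
      rwa [hμ.natDegree_map] at this)
  refine ⟨fun x => coordEval x m, isPolyFun_iff.2 ⟨m, fun _ => rfl⟩, fun h => hm
    (coordEval_ext fun x => by rw [congrFun h x, map_zero]; rfl), fun x hx => ?_⟩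
  exact le_antisymm (natDegree_minPoly_le_rank x) (hr.trans (hmd x hx))

end JordanPolynomial

end JordanAlg

/-! ### The determinant of P, and semi-invariance of Δ as one of its divisors. -/

theorem isPolyFun_matrix_det {V : Type*} [NormedAddCommGroup V] [NormedSpace ℝ V] {n : ℕ}
    {f : V → Matrix (Fin n) (Fin n) ℝ} (hf : ∀ i j, IsPolyFun V fun x => f x i j) :
    IsPolyFun V fun x => (f x).det := by
  simp only [Matrix.det_apply']
  exact IsPolyFun.sum _ fun σ _ => (IsPolyFun.const _).mul (IsPolyFun.prod _ fun i _ => hf _ _)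

namespace JordanAlg

section Det

variable {V : Type*} [NormedAddCommGroup V] [NormedSpace ℝ V] [FiniteDimensional ℝ V]
  {J : JordanAlg V}

theorem isPolyFun_dual_mul (φ : Module.Dual ℝ V) {f g : V → V}
    (hf : ∀ φ : Module.Dual ℝ V, IsPolyFun V fun x => φ (f x))
    (hg : ∀ φ : Module.Dual ℝ V, IsPolyFun V fun x => φ (g x)) :
    IsPolyFun V fun x => φ (J.mul (f x) (g x)) := by
  have e : (fun x => φ (J.mul (f x) (g x))) = fun x => ∑ i, ∑ j,
      (Module.finBasis ℝ V).coord i (f x) * (Module.finBasis ℝ V).coord j (g x) *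
        φ (J.mul (Module.finBasis ℝ V i) (Module.finBasis ℝ V j)) := by
    ext x
    conv_lhs => rw [← (Module.finBasis ℝ V).sum_repr (f x), ← (Module.finBasis ℝ V).sum_repr (g x)]
    simp only [map_sum, map_smul, LinearMap.sum_apply, LinearMap.smul_apply, smul_eq_mul,
      Finset.mul_sum, Module.Basis.coord_apply]
    rw [Finset.sum_comm]
    refine Finset.sum_congr rfl fun i _ => Finset.sum_congr rfl fun j _ => ?_
    ring
  rw [e]
  exact IsPolyFun.sum _ fun i _ => IsPolyFun.sum _ fun j _ =>
    ((hf _).mul (hg _)).mul (IsPolyFun.const _)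

theorem isPolyFun_dual_quad (φ : Module.Dual ℝ V) (v : V) :
    IsPolyFun V fun x => φ (J.quad x v) := by
  have hi : ∀ φ : Module.Dual ℝ V, IsPolyFun V fun x => φ x := fun φ => IsPolyFun.dual φ
  have hc : ∀ φ : Module.Dual ℝ V, IsPolyFun V fun _ => φ v := fun φ => IsPolyFun.const _
  have e : (fun x => φ (J.quad x v)) =
      fun x => (2 : ℝ) * φ (J.mul x (J.mul x v)) - φ (J.mul (J.mul x x) v) := by
    ext x; simp [quad]
  rw [e]
  exact ((IsPolyFun.const 2).mul (isPolyFun_dual_mul φ hi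
    fun φ => isPolyFun_dual_mul φ hi hc)).sub (isPolyFun_dual_mul φ
      (fun φ => isPolyFun_dual_mul φ hi hi) hc)

/-- The determinant of the quadratic representation. -/
noncomputable def quadDet (J : JordanAlg V) (x : V) : ℝ := LinearMap.det (J.quad x)

theorem isPolyFun_quadDet : IsPolyFun V J.quadDet :=
  isPolyFun_linearMap_det fun φ v => isPolyFun_dual_quad φ v

theorem isUnit_pol_iff {x : V} : IsUnit (J.pol x x) ↔ J.quadDet x ≠ 0 := by
  rw [← isUnit_quad_iff, quadDet, LinearMap.isUnit_iff_isUnit_det, isUnit_iff_ne_zero]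

theorem pol_coe (x : V) : ((J.pol x x : V →L[ℝ] V) : V →ₗ[ℝ] V) = J.quad x := by
  ext z; exact J.pol_self_apply x z

/-- The polynomial map `x ↦ det P(x) x⁻¹`. -/
noncomputable def adj (J : JordanAlg V) (x : V) : V :=
  (Module.finBasis ℝ V).equivFun.symm (Matrix.mulVec
    (Matrix.adjugate (LinearMap.toMatrix (Module.finBasis ℝ V) (Module.finBasis ℝ V) (J.quad x)))
      ((Module.finBasis ℝ V).repr x))

theorem isPolyFun_dual_adj (φ : Module.Dual ℝ V) : IsPolyFun V fun x => φ (J.adj x) := by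
  simp only [adj, Module.Basis.equivFun_symm_apply, map_sum, map_smul, smul_eq_mul, Matrix.mulVec,
    dotProduct]
  refine IsPolyFun.sum _ fun i _ => IsPolyFun.mul (IsPolyFun.sum _ fun j _ => IsPolyFun.mul ?_
    (IsPolyFun.dual ((Module.finBasis ℝ V).coord j))) (IsPolyFun.const _)
  simp only [Matrix.adjugate_apply]
  refine isPolyFun_matrix_det fun k l => ?_
  by_cases hk : k = j
  · subst hk
    simpa using IsPolyFun.const _
  · simp only [Matrix.updateRow_apply, hk, if_false, LinearMap.toMatrix_apply]
    exact isPolyFun_dual_quad ((Module.finBasis ℝ V).coord k) _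

theorem quad_adj (x : V) : J.quad x (J.adj x) = J.quadDet x • x := by
  apply (Module.finBasis ℝ V).repr.injective
  ext i
  have h := LinearMap.toMatrix_mulVec_repr (Module.finBasis ℝ V) (Module.finBasis ℝ V) (J.quad x)
    (J.adj x)
  have h2 : ((Module.finBasis ℝ V).repr (J.adj x) : Fin (Module.finrank ℝ V) → ℝ) = Matrix.mulVec
    (Matrix.adjugate (LinearMap.toMatrix (Module.finBasis ℝ V) (Module.finBasis ℝ V) (J.quad x)))
      ((Module.finBasis ℝ V).repr x) := by
    rw [← Module.Basis.equivFun_apply, adj, LinearEquiv.apply_symm_apply]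
  rw [h2, Matrix.mulVec_mulVec, Matrix.mul_adjugate, LinearMap.det_toMatrix, Matrix.smul_mulVec,
    Matrix.one_mulVec] at h
  rw [← h, map_smul]
  rfl

theorem adj_eq {x : V} (hx : IsUnit (J.pol x x)) : J.adj x = J.quadDet x • J.inv x := by
  apply (Module.End.isUnit_iff _ |>.1 (isUnit_quad_iff x |>.2 hx)).1
  rw [quad_adj, map_smul, ← pol_self_apply, pol_apply_inv hx]

theorem isPolyFun_jdet : IsPolyFun V J.jdet := (jdet_spec J).1

theorem jdet_smul {t : ℝ} (ht : t ≠ 0) (x : V) : J.jdet (t • x) = t ^ J.rank * J.jdet x := by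
  obtain ⟨m, hm, hm0, hreg⟩ := exists_regular J
  refine congrFun (IsPolyFun.ext_of_ne_zero hm hm0
    (isPolyFun_jdet.comp_linear (t • (LinearMap.id : V →ₗ[ℝ] V)))
    ((IsPolyFun.const (t ^ J.rank)).mul isPolyFun_jdet) fun x hx => ?_) x
  have h1 := hreg x hx
  have h2 : (J.minPoly (t • x)).natDegree = J.rank := by
    rw [minPoly_smul ht, Polynomial.natDegree_scaleRoots, h1]
  simp only [LinearMap.smul_apply, LinearMap.id_apply]
  rw [(jdet_spec J).2 _ h1, (jdet_spec J).2 _ h2, minPoly_smul ht, Polynomial.coeff_scaleRoots, h1,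
    Nat.sub_zero]
  ring

theorem jdet_map {α : V →ₗ[ℝ] V} (hα : Function.Injective α)
    (hmul : ∀ x y, α (J.mul x y) = J.mul (α x) (α y)) (hone : α J.one = J.one) (x : V) :
    J.jdet (α x) = J.jdet x := by
  obtain ⟨m, hm, hm0, hreg⟩ := exists_regular J
  refine congrFun (IsPolyFun.ext_of_ne_zero hm hm0 (isPolyFun_jdet.comp_linear α)
    isPolyFun_jdet fun x hx => ?_) x
  have h1 := hreg x hx
  have h2 := minPoly_map hα hmul hone x
  rw [(jdet_spec J).2 _ h1, (jdet_spec J).2 _ (by rw [h2, h1]), h2]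

section
variable (h1 : ∀ x, J.mul J.one x = x)
include h1

theorem isUnit_pol_one : IsUnit (J.pol J.one J.one) := by
  rw [pol_one_one h1]; exact isUnit_one

theorem inv_one : J.inv J.one = J.one := by
  rw [inv, pol_one_one h1]; simp

theorem quadDet_one : J.quadDet J.one = 1 := by
  rw [quadDet, ← pol_coe, pol_one_one h1]; exact LinearMap.det_id

theorem quadDet_ne_zero : J.quadDet ≠ 0 := fun h => by
  have := quadDet_one h1; rw [h] at this; simp at this

/-- This is Δ(x) Δ(x⁻¹) = 1 with denominators cleared through the homogeneity of Δ. Its purpose is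
to exhibit Δ as a polynomial divisor of (det P)^r. -/
theorem jdet_mul_jdet_adj (x : V) : J.jdet x * J.jdet (J.adj x) = J.quadDet x ^ J.rank := by
  obtain ⟨m, hm, hm0, hreg⟩ := exists_regular J
  refine congrFun (IsPolyFun.ext_of_ne_zero (hm.mul isPolyFun_quadDet)
    (IsPolyFun.mul_ne_zero hm isPolyFun_quadDet hm0 (quadDet_ne_zero h1))
    (isPolyFun_jdet.mul (isPolyFun_jdet.comp isPolyFun_dual_adj))
    (isPolyFun_quadDet.pow J.rank) fun x hx => ?_) x
  have hr := hreg x (left_ne_zero_of_mul hx)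
  have hd := right_ne_zero_of_mul hx
  have hu := isUnit_pol_iff.2 hd
  obtain ⟨h2, h3⟩ := minPoly_coeff_zero_mul_inv h1 hu hr
  rw [adj_eq hu, jdet_smul hd, (jdet_spec J).2 _ hr, (jdet_spec J).2 _ h2]
  have h4 : ((-1 : ℝ) ^ J.rank) * (-1) ^ J.rank = 1 := by
    rw [← mul_pow]; simp
  linear_combination (J.quadDet x ^ J.rank * ((J.minPoly x).coeff 0 * (J.minPoly (J.inv x)).coeff 0)) *
    h4 + J.quadDet x ^ J.rank * h3

theorem jdet_mul_jdet_inv {x : V} (hx : IsUnit (J.pol x x)) : J.jdet x * J.jdet (J.inv x) = 1 := by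
  have h := jdet_mul_jdet_adj h1 x
  have hd := isUnit_pol_iff.1 hx
  rw [adj_eq hx, jdet_smul hd] at h
  have h0 := pow_ne_zero J.rank hd
  apply mul_left_cancel₀ h0
  linear_combination h

theorem jdet_one_sq : J.jdet J.one ^ 2 = 1 := by
  have h := jdet_mul_jdet_inv h1 (isUnit_pol_one h1)
  rw [inv_one h1] at h
  rw [sq, h]

theorem jdet_one_ne_zero : J.jdet J.one ≠ 0 := fun h => by
  have := jdet_one_sq h1; rw [h] at this; simp at this

theorem jdet_ne_zero : J.jdet ≠ 0 := fun h => jdet_one_ne_zero h1 (congrFun h _)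

end

/-- A divisor of a semi-invariant polynomial function is semi-invariant under divisible groups. -/
theorem isPolyFun_divisor_semiinvariant {f g h : V → ℝ} (hf : IsPolyFun V f) (hg : IsPolyFun V g)
    (hh : IsPolyFun V h) (hh0 : h ≠ 0) (hfg : ∀ x, f x * g x = h x) (T : ℕ → (V →L[ℝ] V))
    (hT : ∀ n, Function.Surjective (T n)) (c : ℕ → ℝ) (hc : ∀ n x, h (T n x) = c n * h x)
    (A : V →L[ℝ] V) (hA : ∀ n, 0 < n → (T n) ^ n = A) : ∃ k, ∀ x, f (A x) = k * f x := by
  classical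
  obtain ⟨F, hF⟩ := isPolyFun_iff.1 hf
  obtain ⟨G, hG⟩ := isPolyFun_iff.1 hg
  obtain ⟨H, hH⟩ := isPolyFun_iff.1 hh
  have hH0 : H ≠ 0 := by
    rintro rfl; exact hh0 (funext fun x => by rw [hH, map_zero]; rfl)
  let R := MvPolynomial (Fin (Module.finrank ℝ V)) ℝ
  -- Let N be the number of divisors of h up to units and S an N!-th root of A. The N + 1
  -- polynomials f ∘ S^k all divide h, so two of them, i < j, are associated and f ∘ S^(j-i) is a
  -- multiple of f. As j - i divides N!, so is f ∘ A.
  let _ : Fintype { x : Associates R // x ∣ Associates.mk H } :=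
    UniqueFactorizationMonoid.fintypeSubtypeDvd _ (Associates.mk_ne_zero.2 hH0)
  set N := Fintype.card { x : Associates R // x ∣ Associates.mk H }
  set S := T N.factorial with hS
  have hSN : S ^ N.factorial = A := hA _ N.factorial_pos
  have hSs : ∀ k : ℕ, Function.Surjective (S ^ k) := by
    intro k
    induction k with
    | zero => exact fun x => ⟨x, rfl⟩
    | succ k ih => rw [pow_succ]; exact ih.comp (hT _)
  have hSh : ∀ (k : ℕ) (x : V), h ((S ^ k) x) = c N.factorial ^ k * h x := by
    intro k
    induction k with
    | zero => simp
    | succ k ih =>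
      intro x
      rw [pow_succ, mul_apply_eq_comp, ih, hS, hc]; ring
  have hc0 : c N.factorial ≠ 0 := by
    intro h0
    apply hh0
    ext x
    obtain ⟨y, rfl⟩ := hT N.factorial x
    rw [hc, h0, zero_mul]; rfl
  have hE : ∀ k : ℕ, ∃ E : R, (∀ x, f ((S ^ k) x) = coordEval x E) ∧ E ∣ H := by
    intro k
    obtain ⟨E, hE⟩ := isPolyFun_iff.1 (hf.comp_linear ((S ^ k : V →L[ℝ] V) : V →ₗ[ℝ] V))
    obtain ⟨E', hE'⟩ := isPolyFun_iff.1 (hg.comp_linear ((S ^ k : V →L[ℝ] V) : V →ₗ[ℝ] V))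
    refine ⟨E, hE, E' * MvPolynomial.C ((c N.factorial ^ k)⁻¹), coordEval_ext (V := V) fun x => ?_⟩
    rw [map_mul, map_mul, ← hE, ← hE', ← hH]
    have h2 : f ((S ^ k) x) * g ((S ^ k) x) = c N.factorial ^ k * h x := by rw [hfg, hSh]
    have h3 : coordEval x (MvPolynomial.C ((c N.factorial ^ k)⁻¹)) = (c N.factorial ^ k)⁻¹ := by
      simp [coordEval]
    rw [h3]
    have h4 := pow_ne_zero k hc0
    field_simp
    exact (_root_.mul_comm _ _).trans h2.symm
  choose E hE hEd using hE
  obtain ⟨i, j, hij, heq⟩ := Fintype.exists_ne_map_eq_of_card_lt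
    (fun k : Fin (N + 1) => (⟨Associates.mk (E k), Associates.mk_dvd_mk.2 (hEd k)⟩ :
      { x : Associates R // x ∣ Associates.mk H })) (by simp [N])
  have key : ∀ i j : ℕ, i < j → j ≤ N → Associates.mk (E i) = Associates.mk (E j) →
      ∃ k, ∀ x, f (A x) = k * f x := by
    intro i j hij hj heq
    obtain ⟨u, hu⟩ := Associates.mk_eq_mk_iff_associated.1 heq
    obtain ⟨r, -, hr⟩ := MvPolynomial.isUnit_iff_eq_C_of_isReduced.1 u.isUnit
    have h2 : ∀ y, f ((S ^ (j - i)) y) = r * f y := by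
      intro y
      obtain ⟨x, rfl⟩ := hSs i y
      rw [← mul_apply_eq_comp, ← pow_add, Nat.sub_add_cancel hij.le, hE, hE, ← hu, hr, map_mul]
      simp [coordEval, _root_.mul_comm]
    have h3 : ∀ m y, f ((S ^ ((j - i) * m)) y) = r ^ m * f y := by
      intro m
      induction m with
      | zero => simp
      | succ m ih =>
        intro y
        rw [Nat.mul_succ, pow_add, mul_apply_eq_comp, ih, h2]; ring
    obtain ⟨m, hm⟩ := Nat.dvd_factorial (Nat.sub_pos_of_lt hij) ((Nat.sub_le j i).trans hj)
    refine ⟨r ^ m, fun x => ?_⟩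
    rw [← hSN, hm, h3]
  have heq' : Associates.mk (E i) = Associates.mk (E j) := congrArg Subtype.val heq
  rcases lt_or_gt_of_ne (fun h => hij (Fin.ext h) : (i : ℕ) ≠ j) with h | h
  · exact key i j h (Nat.lt_succ_iff.1 j.2) heq'
  · exact key j i h (Nat.lt_succ_iff.1 i.2) heq'.symm

theorem expMul_nsmul (k : ℕ) (a : V) : J.expMul (k • a) = J.expMul a ^ k := by
  let _ : NormedAlgebra ℚ (V →L[ℝ] V) := NormedAlgebra.restrictScalars ℚ ℝ _
  rw [expMul, expMul, map_nsmul, NormedSpace.exp_nsmul]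

theorem expMul_surjective (a : V) : Function.Surjective (J.expMul a) := fun x =>
  ⟨J.expMul (-a) x, by rw [← mul_apply_eq_comp, expMul_mul_neg]; rfl⟩

theorem quadDet_expMul (a x : V) :
    J.quadDet (J.expMul a x) = LinearMap.det (J.expMul a : V →ₗ[ℝ] V) ^ 2 * J.quadDet x := by
  rw [quadDet, ← pol_coe, pol_expMul, ContinuousLinearMap.toLinearMap_mul, ContinuousLinearMap.toLinearMap_mul,
    map_mul, map_mul, pol_coe, quadDet]
  ring

/-- The roots required by the divisor lemma are exp L(a/n), and each of them multiplies (det P)^r by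
a constant. -/
theorem exists_jdet_expMul (h1 : ∀ x, J.mul J.one x = x) (a : V) :
    ∃ k, ∀ x, J.jdet (J.expMul a x) = k * J.jdet x := by
  refine isPolyFun_divisor_semiinvariant isPolyFun_jdet (isPolyFun_jdet.comp isPolyFun_dual_adj)
    (isPolyFun_quadDet.pow J.rank) ?_ (jdet_mul_jdet_adj h1) (fun n => J.expMul ((n : ℝ)⁻¹ • a))
    (fun n => expMul_surjective _)
    (fun n => (LinearMap.det (J.expMul ((n : ℝ)⁻¹ • a) : V →ₗ[ℝ] V) ^ 2) ^ J.rank)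
    (fun n x => by rw [quadDet_expMul, mul_pow]) (J.expMul a) fun n hn => ?_
  · intro h
    have := congrFun h J.one
    simp [quadDet_one h1] at this
  · rw [← expMul_nsmul, ← Nat.cast_smul_eq_nsmul ℝ, smul_inv_smul₀ (by positivity)]

end Det

end JordanAlg

/-! ### Semi-invariants and their logarithmic derivatives. -/

namespace JordanAlg

section Involution

variable {V : Type*} [NormedAddCommGroup V] [NormedSpace ℝ V] [FiniteDimensional ℝ V]
  {J : JordanAlg V} {α : V →ₗ[ℝ] V}

omit [FiniteDimensional ℝ V] in
theorem IsEuclideanInvolution.injective (hα : J.IsEuclideanInvolution α) : Function.Injective α :=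
  Function.LeftInverse.injective hα.involutive

theorem IsEuclideanInvolution.map_one (hα : J.IsEuclideanInvolution α) (hJ : J.IsSimple) :
    α J.one = J.one := by
  have h := hα.map_mul J.one (α J.one)
  rw [hα.involutive, hJ.one_mul, hα.involutive, hJ.mul_one] at h
  exact h.symm

omit [FiniteDimensional ℝ V] in
theorem IsEuclideanInvolution.trace_mul (hα : J.IsEuclideanInvolution α) (x : V) :
    LinearMap.trace ℝ V (J.mul (α x)) = LinearMap.trace ℝ V (J.mul x) := by
  have h : J.mul (α x) = α * (J.mul x * α) := by
    ext y
    simp only [Module.End.mul_apply]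
    rw [hα.map_mul, hα.involutive]
  rw [h, LinearMap.trace_mul_comm, mul_assoc]
  have h2 : α * α = 1 := by ext y; exact hα.involutive y
  rw [h2, _root_.mul_one]

end Involution

/-- A polynomial function that is multiplied by constants under the transformations `exp L(a)`. -/
structure IsSemiInvariant {V : Type*} [NormedAddCommGroup V] [NormedSpace ℝ V]
    [FiniteDimensional ℝ V] (J : JordanAlg V) (f : V → ℝ) : Prop where
  isPolyFun : IsPolyFun V f
  one_ne_zero : f J.one ≠ 0
  expMul : ∀ a, ∃ c, ∀ x, f (J.expMul a x) = c * f x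

namespace IsSemiInvariant

variable {V : Type*} [NormedAddCommGroup V] [NormedSpace ℝ V] [FiniteDimensional ℝ V]
  {J : JordanAlg V} {f g : V → ℝ}

/-- The logarithmic derivative of `f` at the identity element. -/
noncomputable def logDeriv (J : JordanAlg V) (f : V → ℝ) : V →L[ℝ] ℝ :=
  (f J.one)⁻¹ • fderiv ℝ f J.one

theorem differentiable (hf : J.IsSemiInvariant f) : Differentiable ℝ f := fun x =>
  (hf.isPolyFun.analyticAt x).differentiableAt

theorem expMul_eq (hf : J.IsSemiInvariant f) (a x : V) :
    f (J.expMul a x) * f J.one = f (J.expMul a J.one) * f x := by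
  obtain ⟨c, hc⟩ := hf.expMul a
  rw [hc, hc]; ring

theorem hasDerivAt_expMul (hf : J.IsSemiInvariant f) (a x : V) (t : ℝ) :
    HasDerivAt (fun t : ℝ => f (J.expMul (t • a) x))
      (fderiv ℝ f (J.expMul (t • a) x) (J.mul a (J.expMul (t • a) x))) t := by
  have h1 : HasDerivAt (fun t : ℝ => J.expMul (t • a) x) (J.mul a (J.expMul (t • a) x)) t := by
    simp only [JordanAlg.expMul, map_smul]
    exact ((hasDerivAt_exp_smul_const' (𝕂 := ℝ) (J.cmul a) t).clm_apply
      (hasDerivAt_const t x)).congr_deriv (by simp)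
  exact (hf.differentiable _).hasFDerivAt.comp_hasDerivAt t h1

variable (h1 : ∀ x, J.mul J.one x = x)
include h1

/-- Differentiate the semi-invariance along exp(tL(a)) at t = 0. -/
theorem fderiv_mul (hf : J.IsSemiInvariant f) (a x : V) :
    fderiv ℝ f x (J.mul a x) = logDeriv J f a * f x := by
  have d1 := (hf.hasDerivAt_expMul a x 0).mul_const (f J.one)
  have d2 := (hf.hasDerivAt_expMul a J.one 0).mul_const (f x)
  have e : (fun t : ℝ => f (J.expMul (t • a) x) * f J.one) =
      fun t : ℝ => f (J.expMul (t • a) J.one) * f x := funext fun t => hf.expMul_eq _ _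
  rw [e] at d1
  have h := d1.unique d2
  have h0 : J.expMul ((0 : ℝ) • a) = 1 := by simp [JordanAlg.expMul]
  rw [h0] at h
  simp only [one_apply_eq_self] at h
  rw [J.mul_comm a J.one, h1] at h
  have hne := hf.one_ne_zero
  simp only [logDeriv, smul_apply, smul_eq_mul]
  field_simp
  linarith

/-- By `fderiv_mul`, t ↦ f(exp(tL(a)) e) solves a linear differential equation whose rate is the
logarithmic derivative at a. Hence a semi-invariant is determined by that functional and its value
at e. -/
theorem apply_expMul_one (hf : J.IsSemiInvariant f) (a : V) :
    f (J.expMul a J.one) = f J.one * Real.exp (logDeriv J f a) := by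
  let F : ℝ → ℝ := fun t => f (J.expMul (t • a) J.one) * Real.exp (-(t * logDeriv J f a))
  have hF : ∀ t, HasDerivAt F 0 t := by
    intro t
    have d1 := hf.hasDerivAt_expMul a J.one t
    rw [hf.fderiv_mul h1] at d1
    have d2 : HasDerivAt (fun t : ℝ => Real.exp (-(t * logDeriv J f a)))
        (Real.exp (-(t * logDeriv J f a)) * (-(1 * logDeriv J f a))) t :=
      (((hasDerivAt_id t).mul_const (logDeriv J f a)).neg).exp
    refine (d1.mul d2).congr_deriv ?_
    ring
  have h01 : F 1 = F 0 := is_const_of_deriv_eq_zero (fun t => (hF t).differentiableAt)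
    (fun t => (hF t).deriv) 1 0
  have h0 : J.expMul ((0 : ℝ) • a) = 1 := by simp [JordanAlg.expMul]
  simp only [F, h0, one_smul, _root_.one_mul, zero_mul, neg_zero, Real.exp_zero, _root_.mul_one,
    one_apply_eq_self] at h01
  rw [← h01, mul_assoc, ← Real.exp_add]
  simp

theorem apply_expMul (hf : J.IsSemiInvariant f) (a x : V) :
    f (J.expMul a x) = Real.exp (logDeriv J f a) * f x := by
  have h := hf.expMul_eq a x
  rw [hf.apply_expMul_one h1] at h
  apply mul_right_cancel₀ hf.one_ne_zero
  rw [h]; ring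

theorem fderiv_expMul (hf : J.IsSemiInvariant f) (a x u : V) :
    fderiv ℝ f (J.expMul a x) (J.expMul a u) = Real.exp (logDeriv J f a) * fderiv ℝ f x u := by
  have d1 : HasFDerivAt (fun x => f (J.expMul a x))
      ((fderiv ℝ f (J.expMul a x)).comp (J.expMul a)) x :=
    (hf.differentiable _).hasFDerivAt.comp x (J.expMul a).hasFDerivAt
  have d2 : HasFDerivAt (fun x => Real.exp (logDeriv J f a) * f x)
      (Real.exp (logDeriv J f a) • fderiv ℝ f x) x :=
    (hf.differentiable x).hasFDerivAt.const_mul _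
  have e : (fun x => f (J.expMul a x)) = fun x => Real.exp (logDeriv J f a) * f x :=
    funext fun x => hf.apply_expMul h1 a x
  rw [e] at d1
  exact congrArg (fun φ => φ u) (d1.unique d2)

/-- The functional `logDeriv J f` is associative. -/
theorem logDeriv_assoc (hf : J.IsSemiInvariant f) (a b u : V) :
    logDeriv J f (J.mul a (J.mul b u)) = logDeriv J f (J.mul b (J.mul a u)) := by
  -- The value of df_y on exp(-tL(b)) L(a) exp(tL(b)) y does not depend on t, by semi-invariance;
  -- its derivative at t = 0 is df_y applied to the commutator.
  have key : ∀ y, fderiv ℝ f y (J.mul a (J.mul b y) - J.mul b (J.mul a y)) = 0 := by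
    intro y
    let A := J.cmul a
    let B := J.cmul b
    have hc : ∀ t : ℝ, fderiv ℝ f y (NormedSpace.exp (t • (-B)) (A (NormedSpace.exp (t • B) y))) =
        logDeriv J f a * f y := by
      intro t
      have e1 : NormedSpace.exp (t • B) = J.expMul (t • b) := by simp [JordanAlg.expMul, B]
      have e2 : NormedSpace.exp (t • (-B)) = J.expMul (-(t • b)) := by simp [JordanAlg.expMul, B]
      rw [e1, e2]
      have h := hf.fderiv_mul h1 a (J.expMul (t • b) y)
      have h2 : J.mul a (J.expMul (t • b) y) =
          J.expMul (t • b) (J.expMul (-(t • b)) (A (J.expMul (t • b) y))) := by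
        rw [← mul_apply_eq_comp (J.expMul (t • b)), expMul_mul_neg]; rfl
      rw [h2, hf.fderiv_expMul h1, hf.apply_expMul h1] at h
      apply mul_left_cancel₀ (Real.exp_ne_zero (logDeriv J f (t • b)))
      rw [h]; ring
    have d1 : HasDerivAt (fun t : ℝ => NormedSpace.exp (t • (-B)) (A (NormedSpace.exp (t • B) y)))
        (A (B y) - B (A y)) 0 := by
      have d2 := hasDerivAt_exp_smul_const' (𝕂 := ℝ) (-B) (0 : ℝ)
      have d3 : HasDerivAt (fun t : ℝ => A (NormedSpace.exp (t • B) y)) (A (B y)) 0 :=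
        A.hasFDerivAt.comp_hasDerivAt 0 (((hasDerivAt_exp_smul_const' (𝕂 := ℝ) B 0).clm_apply
          (hasDerivAt_const (0 : ℝ) y)).congr_deriv (by simp))
      refine (d2.clm_apply d3).congr_deriv ?_
      simp
      abel
    have d2 := (fderiv ℝ f y).hasFDerivAt.comp_hasDerivAt (0 : ℝ) d1
    have e : (fderiv ℝ f y) ∘ (fun t : ℝ => NormedSpace.exp (t • (-B))
        (A (NormedSpace.exp (t • B) y))) = fun _ => logDeriv J f a * f y := funext hc
    rw [e] at d2
    exact d2.unique (hasDerivAt_const _ _)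
  set w := J.mul a (J.mul b u) - J.mul b (J.mul a u) with hw
  -- The commutator [L(a), L(b)] kills e, so at y = e + su it contributes s w. Divide by s, then let
  -- s tend to 0.
  have h2 : ∀ s : ℝ, s ≠ 0 → fderiv ℝ f (J.one + s • u) w = 0 := by
    intro s hs
    have h := key (J.one + s • u)
    have e : J.mul a (J.mul b (J.one + s • u)) - J.mul b (J.mul a (J.one + s • u)) = s • w := by
      simp only [map_add, map_smul, hw, smul_sub]
      rw [J.mul_comm b J.one, J.mul_comm a J.one, h1, h1, J.mul_comm b a]
      abel
    rw [e, map_smul, smul_eq_mul] at h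
    exact (mul_eq_zero.1 h).resolve_left hs
  have hcont : Continuous fun s : ℝ => fderiv ℝ f (J.one + s • u) w := by
    have : Continuous (fderiv ℝ f) := continuous_iff_continuousAt.2 fun x =>
      (hf.isPolyFun.analyticAt x).fderiv.continuousAt
    exact (this.comp (by fun_prop : Continuous fun s : ℝ => J.one + s • u)).clm_apply
      continuous_const
  have h3 : fderiv ℝ f (J.one + (0 : ℝ) • u) w = 0 := by
    have hl := (hcont.tendsto 0).mono_left (nhdsWithin_le_nhds (s := {0}ᶜ))
    refine tendsto_nhds_unique hl ?_
    refine (tendsto_congr' ?_).2 tendsto_const_nhds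
    filter_upwards [self_mem_nhdsWithin] with s hs using h2 s hs
  rw [zero_smul, add_zero, hw, map_sub, sub_eq_zero] at h3
  simp only [logDeriv, smul_apply, h3]

omit h1 in
theorem logDeriv_one (hf : J.IsSemiInvariant f) {k : ℕ}
    (hk : ∀ t : ℝ, t ≠ 0 → f (t • J.one) = t ^ k * f J.one) : logDeriv J f J.one = k := by
  have d1 : HasDerivAt (fun t : ℝ => f (t • J.one)) (fderiv ℝ f ((1 : ℝ) • J.one) J.one) 1 := by
    refine (hf.differentiable _).hasFDerivAt.comp_hasDerivAt 1 ?_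
    simpa using (hasDerivAt_id (1 : ℝ)).smul_const J.one
  have d2 : HasDerivAt (fun t : ℝ => t ^ k * f J.one) ((k * 1 ^ (k - 1)) * f J.one) 1 :=
    (hasDerivAt_pow k 1).mul_const _
  have he : (fun t : ℝ => f (t • J.one)) =ᶠ[𝓝 1] fun t : ℝ => t ^ k * f J.one := by
    filter_upwards [isOpen_ne.mem_nhds (_root_.one_ne_zero : (1 : ℝ) ≠ 0)] with t ht using hk t ht
  have d3 := d2.congr_of_eventuallyEq he
  have h := d1.unique d3
  rw [one_smul, one_pow, _root_.mul_one] at h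
  have hne := hf.one_ne_zero
  simp only [logDeriv, smul_apply, h, smul_eq_mul]
  field_simp

omit h1 in
theorem logDeriv_map (hf : J.IsSemiInvariant f) {α : V →ₗ[ℝ] V} (h : ∀ x, f (α x) = f x)
    (hone : α J.one = J.one) (x : V) : logDeriv J f (α x) = logDeriv J f x := by
  have d1 : HasFDerivAt (fun x => f (α x)) ((fderiv ℝ f (α J.one)).comp
      (LinearMap.toContinuousLinearMap α)) J.one :=
    (hf.differentiable _).hasFDerivAt.comp J.one
      (LinearMap.toContinuousLinearMap α).hasFDerivAt
  simp only [h] at d1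
  have h2 := d1.unique (hf.differentiable J.one).hasFDerivAt
  rw [hone] at h2
  have h3 := congrArg (fun φ => φ x) h2
  simp only [ContinuousLinearMap.comp_apply, LinearMap.coe_toContinuousLinearMap'] at h3
  simp only [logDeriv, smul_apply, h3]

omit h1 in
/-- On a simple Jordan algebra with a Euclidean involution, an associative invariant functional is
proportional to the trace. -/
theorem _root_.JordanAlg.IsSimple.functional_eq (hJ : J.IsSimple) {α : V →ₗ[ℝ] V}
    (hα : J.IsEuclideanInvolution α) (τ : V →L[ℝ] ℝ) (hτα : ∀ x, τ (α x) = τ x)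
    (hτ : ∀ a b u, τ (J.mul a (J.mul b u)) = τ (J.mul b (J.mul a u))) (x : V) :
    τ x * Module.finrank ℝ V = τ J.one * LinearMap.trace ℝ V (J.mul x) := by
  let α' := LinearMap.toContinuousLinearMap α
  let tr : V →L[ℝ] ℝ := LinearMap.toContinuousLinearMap (LinearMap.trace ℝ V ∘ₗ J.mul)
  have htr : ∀ x, tr x = LinearMap.trace ℝ V (J.mul x) := fun _ => rfl
  have htrf : ∀ x y, J.traceForm x y = tr (J.mul x y) := fun _ _ => rfl
  have symm : ∀ σ : V →L[ℝ] ℝ, (∀ x, σ (α x) = σ x) → ∀ x y,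
      σ (J.mul (α x) y) = σ (J.mul (α y) x) := by
    intro σ hσ x y
    rw [← hσ, hα.map_mul, hα.involutive, J.mul_comm]
  have hsT := symm tr hα.trace_mul
  have hsS := symm τ hτα
  have cont : ∀ σ : V →L[ℝ] ℝ, Continuous fun x => σ (J.mul (α x) x) := fun σ =>
    σ.continuous.comp ((J.cmul.continuous.comp α'.continuous).clm_apply continuous_id)
  have hpos : ∀ x, x ≠ 0 → 0 < tr (J.mul (α x) x) := fun x hx => hα.posDef x hx
  have := hJ.nontrivial
  -- Rayleigh quotient: l is the maximum of τ(α(x)x) relative to the positive definite form tr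
  -- L(α(x)x), and a maximizer lies in the kernel of the difference of the two symmetric forms.
  obtain ⟨x₀, hx₀, hmax⟩ := (isCompact_sphere (0 : V) 1).exists_isMaxOn
    (NormedSpace.sphere_nonempty.2 zero_le_one)
    (f := fun x => τ (J.mul (α x) x) / tr (J.mul (α x) x))
    ((cont τ).continuousOn.div (cont tr).continuousOn fun x hx =>
      (hpos x (by rintro rfl; simp at hx)).ne')
  have hx0 : x₀ ≠ 0 := by rintro rfl; simp at hx₀
  set l := τ (J.mul (α x₀) x₀) / tr (J.mul (α x₀) x₀) with hl
  have hle : ∀ x, τ (J.mul (α x) x) ≤ l * tr (J.mul (α x) x) := by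
    intro x
    by_cases hx : x = 0
    · simp [hx]
    · have hn : 0 < ‖x‖ := norm_pos_iff.2 hx
      have hmem : ‖x‖⁻¹ • x ∈ Metric.sphere (0 : V) 1 := by
        simp [norm_smul, hn.ne']
      have h := hmax hmem
      simp only [Set.mem_ofPred_eq, map_smul, LinearMap.smul_apply, smul_eq_mul] at h
      rw [← hl, mul_div_mul_left _ _ (inv_ne_zero hn.ne'), mul_div_mul_left _ _ (inv_ne_zero hn.ne'),
        div_le_iff₀ (hpos x hx)] at h
      exact h
  have heq : τ (J.mul (α x₀) x₀) = l * tr (J.mul (α x₀) x₀) := by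
    rw [hl, div_mul_cancel₀ _ (hpos x₀ hx0).ne']
  have hker : ∀ y, τ (J.mul (α x₀) y) = l * tr (J.mul (α x₀) y) := by
    intro y
    have hq : ∀ t : ℝ, 0 ≤ t * (2 * (l * tr (J.mul (α x₀) y) - τ (J.mul (α x₀) y))) +
        (l * tr (J.mul (α y) y) - τ (J.mul (α y) y)) := by
      intro t
      have h := hle (t • x₀ + y)
      simp only [map_add, map_smul, LinearMap.add_apply, LinearMap.smul_apply, smul_eq_mul] at h
      rw [hsS y x₀, hsT y x₀, heq] at h
      linarith
    set p := 2 * (l * tr (J.mul (α x₀) y) - τ (J.mul (α x₀) y)) with hp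
    set q := l * tr (J.mul (α y) y) - τ (J.mul (α y) y)
    by_contra hne
    have hp0 : p ≠ 0 := by
      intro h0; apply hne; rw [hp] at h0; linarith
    -- An affine function with nonzero slope is not bounded below; this t gives it the value -1.
    have h := hq (-(q + 1) / p)
    rw [div_mul_cancel₀ _ hp0] at h
    linarith
  -- The radical of (τ - l tr L)(zy) is an ideal, both functionals being associative. It contains
  -- α(x₀) ≠ 0, so by simplicity it is all of V.
  let W : Submodule ℝ V :=
    { carrier := {z | ∀ y, τ (J.mul z y) = l * tr (J.mul z y)}
      zero_mem' := by intro y; simp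
      add_mem' := by
        intro a b ha hb y
        rw [map_add, LinearMap.add_apply, map_add, map_add, ha y, hb y]; ring
      smul_mem' := by
        intro c a ha y
        rw [map_smul, LinearMap.smul_apply, map_smul, map_smul, ha y, smul_eq_mul, smul_eq_mul]
        ring }
  have hW : ∀ z, z ∈ W ↔ ∀ y, τ (J.mul z y) = l * tr (J.mul z y) := fun z => Iff.rfl
  have hWI : ∀ x, ∀ y ∈ W, J.mul x y ∈ W := by
    intro x z hz
    rw [hW] at hz ⊢
    intro y
    have e1 : τ (J.mul (J.mul x z) y) = τ (J.mul z (J.mul x y)) := by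
      rw [J.mul_comm _ y, J.mul_comm x z, hτ, J.mul_comm y x]
    have e2 : tr (J.mul (J.mul x z) y) = tr (J.mul z (J.mul x y)) := J.traceForm_assoc x z y
    rw [e1, e2, hz]
  have hWtop : W = ⊤ := by
    refine (hJ.ideal W hWI).resolve_left fun h => hx0 ?_
    have : α x₀ ∈ W := hker
    rw [h, Submodule.mem_bot] at this
    rw [← hα.involutive x₀, this, map_zero]
  have hall : ∀ z, τ z = l * tr z := by
    intro z
    have := (hW z).1 (by rw [hWtop]; trivial) J.one
    rwa [hJ.mul_one] at this
  have hone : tr J.one = Module.finrank ℝ V := by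
    have : J.mul J.one = 1 := by ext y; exact hJ.one_mul y
    rw [htr, this, LinearMap.trace_one]
  rw [hall, hall J.one, hone, htr]
  ring

/-- Semi-invariants of the same degree are proportional. -/
theorem eq_of_degree_eq (hJ : J.IsSimple) {α : V →ₗ[ℝ] V} (hα : J.IsEuclideanInvolution α)
    (hf : J.IsSemiInvariant f) (hg : J.IsSemiInvariant g) (hfα : ∀ x, f (α x) = f x)
    (hgα : ∀ x, g (α x) = g x) {k : ℕ} (hfk : ∀ t : ℝ, t ≠ 0 → f (t • J.one) = t ^ k * f J.one)
    (hgk : ∀ t : ℝ, t ≠ 0 → g (t • J.one) = t ^ k * g J.one) (hone : f J.one = g J.one) : f = g := by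
  refine J.analytic_ext J.one (fun x => by rw [J.mul_comm, h1])
    (fun x _ => hf.isPolyFun.analyticAt x) (fun x _ => hg.isPolyFun.analyticAt x) fun a => ?_
  rw [hf.apply_expMul_one h1, hg.apply_expMul_one h1, hone]
  congr 2
  -- Both logarithmic derivatives are multiples of tr L, and their common value k at e, the degree,
  -- fixes the multiple.
  have e1 := hJ.functional_eq hα (logDeriv J f) (hf.logDeriv_map hfα (hα.map_one hJ))
    (hf.logDeriv_assoc h1) a
  have e2 := hJ.functional_eq hα (logDeriv J g) (hg.logDeriv_map hgα (hα.map_one hJ))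
    (hg.logDeriv_assoc h1) a
  rw [hf.logDeriv_one hfk] at e1
  rw [hg.logDeriv_one hgk, ← e1] at e2
  have := hJ.nontrivial
  have hn : (Module.finrank ℝ V : ℝ) ≠ 0 := by exact_mod_cast Module.finrank_pos.ne'
  exact (mul_right_cancel₀ hn e2).symm

end IsSemiInvariant

end JordanAlg

/-! ### The derivative of the inverse, the gradient of Δ and the structure group. -/

namespace JordanAlg

section InverseDerivative

variable {V : Type*} [NormedAddCommGroup V] [NormedSpace ℝ V] [FiniteDimensional ℝ V]
  {J : JordanAlg V}

theorem hasFDerivAt_pol_self (x : V) :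
    ∃ D : V →L[ℝ] V →L[ℝ] V, HasFDerivAt (fun x => J.pol x x) D x ∧
      ∀ u, D u = (2 : ℝ) • J.pol x u := by
  have h : HasFDerivAt (fun x => J.pol x x) (fderiv ℝ (fun x => J.pol x x) x) x :=
    (J.analyticAt_pol analyticAt_id analyticAt_id).differentiableAt.hasFDerivAt
  refine ⟨_, h, fun u => ?_⟩
  have d1 : HasDerivAt (fun t : ℝ => J.pol (x + t • u) (x + t • u))
      (fderiv ℝ (fun x => J.pol x x) x u) 0 := by
    have hl : HasDerivAt (fun t : ℝ => x + t • u) u 0 := by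
      simpa using ((hasDerivAt_id (0 : ℝ)).smul_const u).const_add x
    have h' : HasFDerivAt (fun x => J.pol x x) (fderiv ℝ (fun x => J.pol x x) x)
        (x + (0 : ℝ) • u) := by simpa using h
    exact h'.comp_hasDerivAt (0 : ℝ) hl
  have d2 : HasDerivAt (fun t : ℝ => J.pol x x + t • ((2 : ℝ) • J.pol x u) + t ^ 2 • J.pol u u)
      ((2 : ℝ) • J.pol x u) 0 := by
    have e1 := ((hasDerivAt_id (0 : ℝ)).smul_const ((2 : ℝ) • J.pol x u)).const_add (J.pol x x)
    have e2 := (hasDerivAt_pow 2 (0 : ℝ)).smul_const (J.pol u u)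
    refine (e1.add e2).congr_deriv ?_
    simp
  have e : (fun t : ℝ => J.pol (x + t • u) (x + t • u)) =
      fun t : ℝ => J.pol x x + t • ((2 : ℝ) • J.pol x u) + t ^ 2 • J.pol u u := by
    ext1 t
    simp only [pol_add_left, pol_add_right, pol_smul_left, pol_smul_right, J.pol_comm u x]
    module
  rw [e] at d1
  exact d1.unique d2

theorem isOpen_isUnit_pol : IsOpen {x | IsUnit (J.pol x x)} :=
  Units.isOpen.preimage (continuous_iff_continuousAt.2 fun _ =>
    (J.analyticAt_pol analyticAt_id analyticAt_id).continuousAt)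

/-- Differentiating P(y) y⁻¹ = y gives 2 P(x, u) x⁻¹ + P(x) Du = u, and P(x, u) x⁻¹ = u. -/
theorem hasFDerivAt_inv (h1 : ∀ x, J.mul J.one x = x) {x : V} (hx : IsUnit (J.pol x x)) :
    HasFDerivAt J.inv (-Ring.inverse (J.pol x x)) x := by
  obtain ⟨D, hD, hDu⟩ := hasFDerivAt_pol_self (J := J) x
  have hdiff : DifferentiableAt ℝ J.inv x := by
    obtain ⟨u, hu⟩ := hx
    have h2 : HasFDerivAt Ring.inverse _ (J.pol x x) := hu ▸ hasFDerivAt_ringInverse (𝕜 := ℝ) u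
    have h3 : HasFDerivAt (fun x => Ring.inverse (J.pol x x)) _ x :=
      HasFDerivAt.comp (g := Ring.inverse) (f := fun x => J.pol x x) x h2 hD
    exact (h3.clm_apply (hasFDerivAt_id x)).differentiableAt
  have h3 := hD.clm_apply hdiff.hasFDerivAt
  have h4 : (fun y => J.pol y y (J.inv y)) =ᶠ[𝓝 x] id := by
    filter_upwards [isOpen_isUnit_pol.mem_nhds hx] with y hy using pol_apply_inv hy
  have h5 := h3.unique ((hasFDerivAt_id x).congr_of_eventuallyEq h4)
  have h6 : fderiv ℝ J.inv x = -Ring.inverse (J.pol x x) := by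
    ext u
    have h7 := congrArg (fun φ => Ring.inverse (J.pol x x) (φ u)) h5
    simp only [add_apply, ContinuousLinearMap.comp_apply, ContinuousLinearMap.flip_apply, hDu,
      smul_apply, pol_apply_inv_right h1 hx, map_add, ContinuousLinearMap.id_apply, map_smul] at h7
    rw [← mul_apply_eq_comp (Ring.inverse (J.pol x x)), inverse_mul_pol hx] at h7
    rw [neg_apply]
    change fderiv ℝ J.inv x u + _ = _ at h7
    linear_combination (norm := module) h7
  rw [← h6]
  exact hdiff.hasFDerivAt

theorem inv_neg (x : V) : J.inv (-x) = -J.inv x := by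
  have e : J.pol (-x) (-x) = J.pol x x := by
    rw [← neg_one_smul ℝ x, pol_smul_left, pol_smul_right, smul_smul]; norm_num
  rw [inv, inv, e, map_neg]

theorem pol_neg_neg (x : V) : J.pol (-x) (-x) = J.pol x x := by
  rw [← neg_one_smul ℝ x, pol_smul_left, pol_smul_right, smul_smul]; norm_num

end InverseDerivative

section Structure

variable {V : Type*} [NormedAddCommGroup V] [NormedSpace ℝ V] [FiniteDimensional ℝ V]
  {J : JordanAlg V} (hJ : J.IsSimple) {α : V →ₗ[ℝ] V} (hα : J.IsEuclideanInvolution α)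

include hJ

theorem isSemiInvariant_jdet : J.IsSemiInvariant J.jdet :=
  ⟨isPolyFun_jdet, jdet_one_ne_zero hJ.one_mul, exists_jdet_expMul hJ.one_mul⟩

theorem isSemiInvariant_quadDet : J.IsSemiInvariant J.quadDet :=
  ⟨isPolyFun_quadDet, by rw [quadDet_one hJ.one_mul]; exact one_ne_zero,
    fun a => ⟨_, quadDet_expMul a⟩⟩

theorem rank_pos : 0 < J.rank := one_le_rankOn hJ.one_ne_zero Set.univ_nonempty

theorem finrank_pos : 0 < Module.finrank ℝ V := by
  have := hJ.nontrivial
  exact Module.finrank_pos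

omit hJ in
theorem IsSemiInvariant.pow {f : V → ℝ} (hf : J.IsSemiInvariant f) (k : ℕ) :
    J.IsSemiInvariant fun x => f x ^ k :=
  ⟨hf.isPolyFun.pow k, pow_ne_zero k hf.one_ne_zero, fun a => by
    obtain ⟨c, hc⟩ := hf.expMul a
    exact ⟨c ^ k, fun x => by rw [hc, mul_pow]⟩⟩

omit hJ in
theorem quadDet_smul_one (t : ℝ) :
    J.quadDet (t • J.one) = t ^ (2 * Module.finrank ℝ V) * J.quadDet J.one := by
  have e : J.quad (t • J.one) = t ^ 2 • J.quad J.one := by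
    rw [← pol_coe, ← pol_coe, pol_smul_left, pol_smul_right, smul_smul, ← sq]; rfl
  rw [quadDet, e, LinearMap.det_smul, quadDet, pow_mul]

include hα

omit hJ in
theorem quadDet_map (x : V) : J.quadDet (α x) = J.quadDet x := by
  have e : J.quad (α x) = α * J.quad x * α := by
    ext y
    simp only [Module.End.mul_apply, quad, LinearMap.sub_apply, LinearMap.smul_apply,
      LinearMap.comp_apply, map_sub, map_smul, hα.map_mul, hα.involutive]
  have h2 : α * α = 1 := by ext y; exact hα.involutive y
  have h3 : LinearMap.det α * LinearMap.det α = 1 := by rw [← map_mul, h2, map_one]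
  rw [quadDet, e, map_mul, map_mul, quadDet]
  linear_combination LinearMap.det (J.quad x) * h3

/-- The relation `(det P(x)) ^ r = Δ(x) ^ (2 n)`. -/
theorem quadDet_pow_rank (x : V) : J.quadDet x ^ J.rank = J.jdet x ^ (2 * Module.finrank ℝ V) := by
  -- Both sides are α-invariant semi-invariants of degree 2nr with value 1 at e.
  refine congrFun (IsSemiInvariant.eq_of_degree_eq hJ.one_mul hJ hα
    ((isSemiInvariant_quadDet hJ).pow J.rank)
    ((isSemiInvariant_jdet hJ).pow (2 * Module.finrank ℝ V)) ?_ ?_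
    (k := 2 * Module.finrank ℝ V * J.rank) ?_ ?_ ?_) x
  · intro x; rw [quadDet_map hα]
  · intro x; rw [jdet_map hα.injective hα.map_mul (hα.map_one hJ)]
  · intro t _; rw [quadDet_smul_one, mul_pow, ← pow_mul]
  · intro t ht; rw [jdet_smul ht, mul_pow, ← pow_mul]; ring
  · rw [quadDet_one hJ.one_mul, pow_mul, jdet_one_sq hJ.one_mul]; simp

theorem isUnit_pol_iff_jdet {x : V} : IsUnit (J.pol x x) ↔ J.jdet x ≠ 0 := by
  have h := quadDet_pow_rank hJ hα x
  have hr := (rank_pos hJ).ne'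
  have hn := (finrank_pos hJ).ne'
  rw [isUnit_pol_iff, Ne, Ne, not_iff_not]
  constructor
  · intro h0
    rw [h0, zero_pow hr] at h
    exact eq_zero_of_pow_eq_zero h.symm
  · intro h0
    rw [h0, zero_pow (by omega)] at h
    exact eq_zero_of_pow_eq_zero h

omit hα

/-- `Δ(P(x) y) = Δ(x) ^ 2 Δ(y)`. -/
theorem jdet_pol (x y : V) : J.jdet (J.pol x x y) = J.jdet x ^ 2 * J.jdet y := by
  have hs := isSemiInvariant_jdet hJ
  refine congrFun (J.analytic_ext J.one hJ.mul_one (F := fun x => J.jdet (J.pol x x y))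
    (G := fun x => J.jdet x ^ 2 * J.jdet y) (fun x _ => ?_) (fun x _ => ?_) fun a => ?_) x
  · exact (isPolyFun_jdet.analyticAt _).comp
      (J.analyticAt_pol_apply analyticAt_id analyticAt_id analyticAt_const)
  · exact ((isPolyFun_jdet.analyticAt x).pow 2).mul analyticAt_const
  · have h1 := jdet_one_sq hJ.one_mul
    rw [pol_expMul_one hJ.one_mul, mul_apply_eq_comp, hs.apply_expMul hJ.one_mul,
      hs.apply_expMul hJ.one_mul, hs.apply_expMul hJ.one_mul a J.one, mul_pow, h1]
    ring

/-- The Jordan trace: the logarithmic derivative of the Jordan polynomial at `e`. -/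
noncomputable abbrev _root_.JordanAlg.jtr (J : JordanAlg V) : V →L[ℝ] ℝ :=
  IsSemiInvariant.logDeriv J J.jdet

theorem jtr_assoc (x y z : V) : J.jtr (J.mul (J.mul x y) z) = J.jtr (J.mul y (J.mul x z)) := by
  rw [J.mul_comm _ z, J.mul_comm x y,
    (isSemiInvariant_jdet hJ).logDeriv_assoc hJ.one_mul z y x, J.mul_comm z x]

/-- L(a) is self-adjoint for the form jtr(uw), hence so is its exponential; the interpolating
function moves it continuously from one factor to the other. -/
theorem jtr_expMul (a u w : V) :
    J.jtr (J.mul (J.expMul a u) w) = J.jtr (J.mul u (J.expMul a w)) := by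
  let A := J.cmul a
  let F : ℝ → ℝ := fun t =>
    J.jtr (J.cmul (NormedSpace.exp (t • A) u) (NormedSpace.exp ((1 - t) • A) w))
  have hF : ∀ t, HasDerivAt F 0 t := by
    intro t
    have d1 : HasDerivAt (fun t : ℝ => NormedSpace.exp (t • A) u)
        (A (NormedSpace.exp (t • A) u)) t :=
      ((hasDerivAt_exp_smul_const' (𝕂 := ℝ) A t).clm_apply (hasDerivAt_const t u)).congr_deriv
        (by simp)
    have d2 : HasDerivAt (fun t : ℝ => NormedSpace.exp ((1 - t) • A) w)
        (-A (NormedSpace.exp ((1 - t) • A) w)) t := by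
      have e1 : HasDerivAt (fun t : ℝ => NormedSpace.exp (t • A) w)
          (A (NormedSpace.exp ((1 - t) • A) w)) (1 - t) :=
        ((hasDerivAt_exp_smul_const' (𝕂 := ℝ) A (1 - t)).clm_apply
          (hasDerivAt_const (1 - t) w)).congr_deriv (by simp)
      have e2 : HasDerivAt (fun t : ℝ => 1 - t) (-1) t := by
        simpa using (hasDerivAt_id t).const_sub 1
      exact (HasDerivAt.scomp (g₁ := fun t : ℝ => NormedSpace.exp (t • A) w) t e1 e2).congr_deriv
        (by simp)
    have d1' : HasDerivAt (fun t : ℝ => J.cmul (NormedSpace.exp (t • A) u))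
        (J.cmul (A (NormedSpace.exp (t • A) u))) t := J.cmul.hasFDerivAt.comp_hasDerivAt t d1
    have d3 := J.jtr.hasFDerivAt.comp_hasDerivAt t (d1'.clm_apply d2)
    refine d3.congr_deriv ?_
    simp only [map_add, map_neg, cmul_apply, A, jtr_assoc hJ]
    ring
  have h01 : F 1 = F 0 := is_const_of_deriv_eq_zero (fun t => (hF t).differentiableAt)
    (fun t => (hF t).deriv) 1 0
  simpa [F, A, expMul] using h01

theorem jtr_pol (x u w : V) : J.jtr (J.mul (J.pol x x u) w) = J.jtr (J.mul u (J.pol x x w)) := by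
  simp only [pol_apply, map_add, map_sub, LinearMap.add_apply, LinearMap.sub_apply, jtr_assoc hJ]

/-- The gradient of the Jordan polynomial. -/
theorem fderiv_jdet_pol (x v : V) :
    fderiv ℝ J.jdet x (J.pol x x v) = J.jdet x * J.jtr (J.mul x v) := by
  have hs := isSemiInvariant_jdet hJ
  refine congrFun (J.analytic_ext J.one hJ.mul_one
    (F := fun x => fderiv ℝ J.jdet x (J.pol x x v))
    (G := fun x => J.jdet x * J.jtr (J.mul x v)) (fun x _ => ?_) (fun x _ => ?_) fun a => ?_) x
  · exact ((ContinuousLinearMap.id ℝ (V →L[ℝ] ℝ)).analyticAt_bilinear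
      (fderiv ℝ J.jdet x, J.pol x x v)).comp₂ (isPolyFun_jdet.analyticAt x).fderiv
      (J.analyticAt_pol_apply analyticAt_id analyticAt_id analyticAt_const)
  · exact (isPolyFun_jdet.analyticAt x).mul ((J.jtr.analyticAt _).comp
      (J.analyticAt_cmul analyticAt_id analyticAt_const))
  · have h1 := jdet_one_ne_zero hJ.one_mul
    rw [pol_expMul_one hJ.one_mul, mul_apply_eq_comp, hs.fderiv_expMul hJ.one_mul,
      hs.apply_expMul hJ.one_mul, jtr_expMul hJ, hJ.one_mul]
    simp only [jtr, IsSemiInvariant.logDeriv, smul_apply, smul_eq_mul]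
    field_simp

/-- So x⁻¹ is the gradient of log |Δ|. This ties inversion to Δ, both for the structure group and
for bounding inverses in `exists_uniform_inv`. -/
theorem fderiv_jdet {x : V} (hx : IsUnit (J.pol x x)) (u : V) :
    fderiv ℝ J.jdet x u = J.jdet x * J.jtr (J.mul (J.inv x) u) := by
  have e : u = J.pol x x (Ring.inverse (J.pol x x) u) := by
    rw [← mul_apply_eq_comp, pol_mul_inverse hx]; rfl
  rw [e, fderiv_jdet_pol hJ, ← jtr_pol hJ, pol_apply_inv hx]

include hα

/-- The Jordan trace is r/n times tr L, by `functional_eq`. -/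
theorem jtr_nondegenerate {x : V} (h : ∀ y, J.jtr (J.mul x y) = 0) : x = 0 := by
  refine hJ.nondegenerate x fun y => ?_
  have hs := isSemiInvariant_jdet hJ
  have h1 := hJ.functional_eq hα J.jtr (hs.logDeriv_map
    (jdet_map hα.injective hα.map_mul (hα.map_one hJ)) (hα.map_one hJ))
    (hs.logDeriv_assoc hJ.one_mul) (J.mul x y)
  rw [h, hs.logDeriv_one (k := J.rank) (fun t ht => jdet_smul ht _), zero_mul] at h1
  have hr : (J.rank : ℝ) ≠ 0 := by exact_mod_cast (rank_pos hJ).ne'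
  exact (mul_eq_zero.1 h1.symm).resolve_left hr

omit hα

/-- The kernel relation `Δ(x⁻¹ - y⁻¹) ^ 2 Δ(x) ^ 2 Δ(y) ^ 2 = Δ(x - y) ^ 2`. -/
theorem jdet_inv_sub_inv {x y : V} (hx : IsUnit (J.pol x x)) (hy : IsUnit (J.pol y y)) :
    J.jdet (J.inv x - J.inv y) ^ 2 * J.jdet x ^ 2 * J.jdet y ^ 2 = J.jdet (x - y) ^ 2 := by
  have hy' : IsUnit (J.pol (-y) (-y)) := by rwa [pol_neg_neg]
  have h := pol_inv_add_inv hJ.one_mul hx hy'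
  rw [inv_neg y, pol_neg_neg, ← sub_eq_add_neg, ← sub_eq_add_neg] at h
  have h2 := congrArg (fun φ => J.jdet (φ J.one)) h
  simp only [mul_apply_eq_comp, jdet_pol hJ] at h2
  apply mul_right_cancel₀ (jdet_one_ne_zero hJ.one_mul)
  rw [← h2]; ring

theorem chi_eq {h : V →L[ℝ] V} {c : ℝ} (hc : ∀ x, J.jdet (h x) = c * J.jdet x) : J.chi h = c := by
  have h1 : ∀ x, J.jdet (h x) = J.chi h * J.jdet x :=
    Classical.epsilon_spec (p := fun c : ℝ => ∀ x, J.jdet (h x) = c * J.jdet x) ⟨c, hc⟩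
  have h2 := (h1 J.one).symm.trans (hc J.one)
  exact mul_right_cancel₀ (jdet_one_ne_zero hJ.one_mul) h2

omit hJ in
theorem jdet_chi (l : J.Str) (x : V) : J.jdet ((l : V ≃L[ℝ] V) x) =
    J.chi ((l : V ≃L[ℝ] V) : V →L[ℝ] V) * J.jdet x :=
  Classical.epsilon_spec (p := fun c : ℝ => ∀ x, J.jdet ((l : V ≃L[ℝ] V) x) = c * J.jdet x) l.2 x

theorem chi_ne_zero (l : J.Str) : J.chi ((l : V ≃L[ℝ] V) : V →L[ℝ] V) ≠ 0 := by
  intro h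
  have h1 := jdet_chi l ((l : V ≃L[ℝ] V).symm J.one)
  rw [h, zero_mul, ContinuousLinearEquiv.apply_symm_apply] at h1
  exact jdet_one_ne_zero hJ.one_mul h1

theorem chi_mul (l m : J.Str) : J.chi (((l * m : J.Str) : V ≃L[ℝ] V) : V →L[ℝ] V) =
    J.chi ((l : V ≃L[ℝ] V) : V →L[ℝ] V) * J.chi ((m : V ≃L[ℝ] V) : V →L[ℝ] V) := by
  refine chi_eq hJ fun x => ?_
  change J.jdet ((l : V ≃L[ℝ] V) ((m : V ≃L[ℝ] V) x)) = _
  rw [jdet_chi, jdet_chi, mul_assoc]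

theorem chi_one : J.chi (((1 : J.Str) : V ≃L[ℝ] V) : V →L[ℝ] V) = 1 :=
  chi_eq hJ fun _ => (_root_.one_mul _).symm

/-- The transformation `P(x)⁻¹`, for `x` invertible, as an element of the structure group. -/
theorem exists_str_inverse_pol {x : V} (hx : IsUnit (J.pol x x)) :
    ∃ l : J.Str, ((l : V ≃L[ℝ] V) : V →L[ℝ] V) = Ring.inverse (J.pol x x) ∧
      J.chi ((l : V ≃L[ℝ] V) : V →L[ℝ] V) * J.jdet x ^ 2 = 1 := by
  have e1 : ∀ v, J.pol x x (Ring.inverse (J.pol x x) v) = v := fun v => by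
    rw [← mul_apply_eq_comp, pol_mul_inverse hx]; rfl
  have e2 : ∀ v, Ring.inverse (J.pol x x) (J.pol x x v) = v := fun v => by
    rw [← mul_apply_eq_comp, inverse_mul_pol hx]; rfl
  have h0 : J.jdet x ^ 2 ≠ 0 := by
    intro h
    have := jdet_pol hJ x (Ring.inverse (J.pol x x) J.one)
    rw [e1, h, zero_mul] at this
    exact jdet_one_ne_zero hJ.one_mul this
  let l : V ≃L[ℝ] V := ContinuousLinearEquiv.equivOfInverse (Ring.inverse (J.pol x x)) (J.pol x x)
    e1 e2
  have hl : ∀ v, J.jdet (l v) = (J.jdet x ^ 2)⁻¹ * J.jdet v := by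
    intro v
    have := jdet_pol hJ x (Ring.inverse (J.pol x x) v)
    rw [e1] at this
    rw [this, inv_mul_cancel_left₀ h0]; rfl
  refine ⟨⟨l, (J.jdet x ^ 2)⁻¹, hl⟩, rfl, ?_⟩
  have hchi : J.chi (l : V →L[ℝ] V) = (J.jdet x ^ 2)⁻¹ := chi_eq hJ hl
  change J.chi (l : V →L[ℝ] V) * J.jdet x ^ 2 = 1
  rw [hchi, inv_mul_cancel₀ h0]

include hα

/-- The relation `|det l| ^ r = |χ(l)| ^ n` for `l` in the structure group. -/
theorem abs_det_pow_rank (l : J.Str) :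
    |LinearMap.det (((l : V ≃L[ℝ] V) : V →L[ℝ] V) : V →ₗ[ℝ] V)| ^ J.rank =
      |J.chi ((l : V ≃L[ℝ] V) : V →L[ℝ] V)| ^ Module.finrank ℝ V := by
  set c := J.chi ((l : V ≃L[ℝ] V) : V →L[ℝ] V) with hcdef
  let g : V →L[ℝ] V := ((l : V ≃L[ℝ] V) : V →L[ℝ] V)
  have hc : ∀ x, J.jdet (g x) = c * J.jdet x := jdet_chi l
  have hc0 : c ≠ 0 := chi_ne_zero hJ l
  have hg : ∀ {x}, IsUnit (J.pol x x) → IsUnit (J.pol (g x) (g x)) := by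
    intro x hx
    rw [isUnit_pol_iff_jdet hJ hα] at hx ⊢
    rw [hc]; exact mul_ne_zero hc0 hx
  have hdiff : Differentiable ℝ J.jdet := (isSemiInvariant_jdet hJ).differentiable
  -- Logarithmic differentiation of Δ(gx) = cΔ(x): the adjoint of g sends (gx)⁻¹ to x⁻¹.
  have hgrad : ∀ {x}, IsUnit (J.pol x x) → ∀ u,
      J.jtr (J.mul (J.inv (g x)) (g u)) = J.jtr (J.mul (J.inv x) u) := by
    intro x hx u
    have d1 : HasFDerivAt (fun x => J.jdet (g x)) ((fderiv ℝ J.jdet (g x)).comp g) x :=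
      (hdiff _).hasFDerivAt.comp x g.hasFDerivAt
    have d2 : HasFDerivAt (fun x => c * J.jdet x) (c • fderiv ℝ J.jdet x) x :=
      (hdiff x).hasFDerivAt.const_mul _
    rw [funext hc] at d1
    have h := congrArg (fun φ => φ u) (d1.unique d2)
    simp only [ContinuousLinearMap.comp_apply, smul_apply, smul_eq_mul, fderiv_jdet hJ hx,
      fderiv_jdet hJ (hg hx), hc] at h
    have h0 := (isUnit_pol_iff_jdet hJ hα).1 hx
    apply mul_left_cancel₀ (mul_ne_zero hc0 h0)
    rw [h]; ring
  have he := isUnit_pol_one hJ.one_mul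
  -- -A is the derivative of x ↦ (gx)⁻¹ at e. Differentiating `hgrad` there shows that A is inverse
  -- to the adjoint of g, so det A · det g = 1.
  let A : V →L[ℝ] V := Ring.inverse (J.pol (g J.one) (g J.one)) * g
  have hA : ∀ w u, J.jtr (J.mul (A w) (g u)) = J.jtr (J.mul w u) := by
    intro w u
    have i1 : HasFDerivAt (fun x => J.inv (g x)) (-A) J.one := by
      refine ((hasFDerivAt_inv hJ.one_mul (hg he)).comp J.one g.hasFDerivAt).congr_fderiv ?_
      ext v; rfl
    have i2 : HasFDerivAt J.inv (-1 : V →L[ℝ] V) J.one := by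
      have := hasFDerivAt_inv hJ.one_mul he
      rwa [pol_one_one hJ.one_mul, Ring.inverse_one] at this
    let T : V → V →L[ℝ] ℝ := fun u => J.jtr.comp (J.cmul.flip u)
    have d1 := (T (g u)).hasFDerivAt.comp J.one i1
    have d2 := (T u).hasFDerivAt.comp J.one i2
    have hev : (T u ∘ J.inv) =ᶠ[𝓝 J.one] (T (g u) ∘ fun x => J.inv (g x)) := by
      filter_upwards [isOpen_isUnit_pol.mem_nhds he] with x hx
      exact (hgrad hx u).symm
    have h := congrArg (fun φ => φ w) ((d1.congr_of_eventuallyEq hev).unique d2)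
    simpa [T] using h
  have hdet : LinearMap.det (A : V →ₗ[ℝ] V) * LinearMap.det (g : V →ₗ[ℝ] V) = 1 := by
    let B : V →ₗ[ℝ] Module.Dual ℝ V := J.mul.compr₂ (J.jtr : V →ₗ[ℝ] ℝ)
    have hB : Function.Injective B := by
      rw [← LinearMap.ker_eq_bot, LinearMap.ker_eq_bot']
      intro x hx
      exact jtr_nondegenerate hJ hα fun y => LinearMap.congr_fun hx y
    let E : V ≃ₗ[ℝ] Module.Dual ℝ V := LinearMap.linearEquivOfInjective B hB
      (Subspace.dual_finrank_eq (K := ℝ) (V := V)).symm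
    have hE : (g : V →ₗ[ℝ] V).dualMap ∘ₗ (E.toLinearMap ∘ₗ (A : V →ₗ[ℝ] V) ∘ₗ
        E.symm.toLinearMap) = LinearMap.id := by
      ext φ u
      obtain ⟨w, rfl⟩ := E.surjective φ
      simp only [LinearMap.comp_apply, LinearEquiv.coe_coe, LinearEquiv.symm_apply_apply,
        LinearMap.dualMap_apply, LinearMap.id_apply]
      exact hA w u
    have h := congrArg LinearMap.det hE
    rw [LinearMap.det_comp, LinearMap.det_dualMap, LinearMap.det_id, LinearMap.det_conj] at h
    rw [_root_.mul_comm, h]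
  have hdetA : LinearMap.det (A : V →ₗ[ℝ] V) * J.quadDet (g J.one) =
      LinearMap.det (g : V →ₗ[ℝ] V) := by
    have : J.pol (g J.one) (g J.one) * A = g := by
      rw [← mul_assoc, pol_mul_inverse (hg he), _root_.one_mul]
    rw [quadDet, ← pol_coe, _root_.mul_comm, ← LinearMap.det_comp]
    congr 1
    conv_rhs => rw [← this]
    rfl
  -- Combined with P(ge) A = g this yields (det g)² = det P(ge), whose r-th power is Δ(ge)^(2n) =
  -- c^(2n).
  have hsq : LinearMap.det (g : V →ₗ[ℝ] V) ^ 2 = J.quadDet (g J.one) := by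
    rw [sq]; nth_rewrite 1 [← hdetA]
    linear_combination J.quadDet (g J.one) * hdet
  have hfin := quadDet_pow_rank hJ hα (g J.one)
  rw [← hsq, hc, pow_mul, mul_pow, jdet_one_sq hJ.one_mul, _root_.mul_one, ← pow_mul, ← pow_mul,
    _root_.mul_comm 2, _root_.mul_comm 2, pow_mul, pow_mul, sq_eq_sq_iff_abs_eq_abs, abs_pow, abs_pow] at hfin
  exact hfin

end Structure

end JordanAlg

/-! ### Zariski-generic sets and maps up to generic equality. -/

section Generic

variable {V : Type*} [NormedAddCommGroup V] [NormedSpace ℝ V] [FiniteDimensional ℝ V]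

/-- The principal filters form a directed family because a product of nonzero polynomial functions
is nonzero; one polynomial therefore suffices. -/
theorem mem_genericFilter {S : Set V} :
    S ∈ genericFilter V ↔ ∃ p : V → ℝ, IsPolyFun V p ∧ p ≠ 0 ∧ ∀ x, p x ≠ 0 → x ∈ S := by
  rw [genericFilter, mem_biInf_of_directed]
  · simp only [mem_principal]
    constructor
    · rintro ⟨p, ⟨h1, h2⟩, h3⟩
      exact ⟨p, h1, h2, h3⟩
    · rintro ⟨p, h1, h2, h3⟩
      exact ⟨p, ⟨h1, h2⟩, h3⟩
  · rintro p ⟨hp, hp0⟩ q ⟨hq, hq0⟩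
    refine ⟨fun x => p x * q x, ⟨hp.mul hq, hp.mul_ne_zero hq hp0 hq0⟩, ?_, ?_⟩
    · exact principal_mono.2 fun x hx => left_ne_zero_of_mul hx
    · exact principal_mono.2 fun x hx => right_ne_zero_of_mul hx
  · refine ⟨fun _ => 1, IsPolyFun.const 1, fun h => ?_⟩
    simpa using congrFun h (0 : V)

theorem IsPolyFun.eventually_ne_zero {p : V → ℝ} (hp : IsPolyFun V p) (hp0 : p ≠ 0) :
    ∀ᶠ x in genericFilter V, p x ≠ 0 :=
  mem_genericFilter.2 ⟨p, hp, hp0, fun _ h => h⟩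

/-- Generic equality becomes equality of germs at generic points, so that derivatives do not depend
on the representative. -/
theorem eventually_generic_nhds {P : V → Prop} (h : ∀ᶠ x in genericFilter V, P x) :
    ∀ᶠ x in genericFilter V, ∀ᶠ y in 𝓝 x, P y := by
  obtain ⟨p, hp, hp0, h⟩ := mem_genericFilter.1 h
  refine mem_genericFilter.2 ⟨p, hp, hp0, fun x hx => ?_⟩
  filter_upwards [(isOpen_ne_fun hp.continuous continuous_const).mem_nhds hx] with y hy using h y hy

theorem mem_genericEnd {f : V → V}
    (h : ∀ p : V → ℝ, IsPolyFun V p → p ≠ 0 → ∀ᶠ x in genericFilter V, p (f x) ≠ 0) :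
    f ∈ genericEnd V := by
  intro S hS
  obtain ⟨p, hp, hp0, hS⟩ := mem_genericFilter.1 hS
  have h' := h p hp hp0
  exact Filter.mem_of_superset h' fun x hx => hS _ hx

namespace Represents

theorem one : Represents (1 : GenericAut V) id := ⟨(genericEnd V).one_mem, rfl⟩

theorem mul {u w : GenericAut V} {f g : V → V} (hf : Represents u f) (hg : Represents w g) :
    Represents (u * w) (f ∘ g) := by
  obtain ⟨h, hu⟩ := hf
  obtain ⟨h', hw⟩ := hg
  refine ⟨(genericEnd V).mul_mem h h', ?_⟩
  rw [Units.val_mul, hu, hw]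
  rfl

theorem eventuallyEq {u : GenericAut V} {f g : V → V} (hf : Represents u f)
    (hg : Represents u g) : f =ᶠ[genericFilter V] g := by
  obtain ⟨h, hu⟩ := hf
  obtain ⟨h', hu'⟩ := hg
  exact (Con.eq (genericCon V)).1 (hu.symm.trans hu')

theorem unique {u w : GenericAut V} {f g : V → V} (hf : Represents u f)
    (hg : Represents w g) (h : f =ᶠ[genericFilter V] g) : u = w := by
  obtain ⟨hf, hu⟩ := hf
  obtain ⟨hg, hw⟩ := hg
  refine Units.ext ?_
  rw [hu, hw]
  exact (Con.eq (genericCon V)).2 h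

theorem tendsto {u : GenericAut V} {f : V → V} (hf : Represents u f) :
    Tendsto f (genericFilter V) (genericFilter V) := hf.1

end Represents

/-- A generic two-sided inverse is what makes the choice in `genericAut` meaningful. -/
theorem represents_genericAut {f g : V → V} (hf : f ∈ genericEnd V) (hg : g ∈ genericEnd V)
    (hfg : f ∘ g =ᶠ[genericFilter V] id) (hgf : g ∘ f =ᶠ[genericFilter V] id) :
    Represents (genericAut f) f := by
  refine Classical.epsilon_spec (p := fun u => Represents u f) ⟨⟨((⟨f, hf⟩ : genericEnd V) :
    (genericCon V).Quotient), ((⟨g, hg⟩ : genericEnd V) : (genericCon V).Quotient), ?_, ?_⟩, hf, rfl⟩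
  · exact (Con.eq (genericCon V)).2 hfg
  · exact (Con.eq (genericCon V)).2 hgf

end Generic

/-! ### Generators and relations of the conformal group. -/

namespace JordanAlg

variable {V : Type*} [NormedAddCommGroup V] [NormedSpace ℝ V] [FiniteDimensional ℝ V]
  {J : JordanAlg V}

theorem add_mem_genericEnd (v : V) : (fun x => x + v) ∈ genericEnd V := by
  refine mem_genericEnd fun p hp hp0 => (hp.comp_add v).eventually_ne_zero fun h => hp0 ?_
  ext x
  simpa using congrFun h (x - v)

theorem equiv_mem_genericEnd (l : V ≃L[ℝ] V) : (fun x => l x) ∈ genericEnd V := by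
  refine mem_genericEnd fun p hp hp0 =>
    (hp.comp_linear (l : V →L[ℝ] V).toLinearMap).eventually_ne_zero fun h => hp0 ?_
  ext x
  simpa using congrFun h (l.symm x)

theorem represents_nn (v : V) : Represents (J.nn v : GenericAut V) (fun x => x + v) :=
  represents_genericAut (add_mem_genericEnd v) (add_mem_genericEnd (-v))
    (Eventually.of_forall fun x => by simp) (Eventually.of_forall fun x => by simp)

theorem represents_strConf (l : J.Str) :
    Represents (J.strConf l : GenericAut V) (fun x => (l : V ≃L[ℝ] V) x) :=
  represents_genericAut (equiv_mem_genericEnd _) (equiv_mem_genericEnd (l : V ≃L[ℝ] V).symm)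
    (Eventually.of_forall fun x => by simp) (Eventually.of_forall fun x => by simp)

section Inversion

variable (h1 : ∀ x, J.mul J.one x = x)

include h1

theorem eventually_isUnit_pol : ∀ᶠ x in genericFilter V, IsUnit (J.pol x x) := by
  filter_upwards [isPolyFun_quadDet.eventually_ne_zero (quadDet_ne_zero h1)] with x hx
    using isUnit_pol_iff.2 hx

theorem isUnit_pol_negInv {x : V} (hx : IsUnit (J.pol x x)) :
    IsUnit (J.pol (J.negInv x) (J.negInv x)) := by
  rw [negInv_eq hx, pol_neg_neg]
  exact isUnit_pol_inv h1 hx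

theorem negInv_negInv {x : V} (hx : IsUnit (J.pol x x)) : J.negInv (J.negInv x) = x := by
  rw [negInv_eq (isUnit_pol_negInv h1 hx), negInv_eq hx, inv_neg, neg_neg, inv_inv h1 hx]

theorem negInv_eq_adj {x : V} (hx : J.quadDet x ≠ 0) :
    J.quadDet x • J.negInv x = -J.adj x := by
  rw [negInv_eq (isUnit_pol_iff.2 hx), adj_eq (isUnit_pol_iff.2 hx), smul_neg]

/-- The entries of j(x) are polynomials divided by det P(x), so p ∘ j is polynomial after
multiplication by a power of det P. -/
theorem exists_isPolyFun_negInv {p : V → ℝ} (hp : IsPolyFun V p) :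
    ∃ (k : ℕ) (q : V → ℝ), IsPolyFun V q ∧
      ∀ x, J.quadDet x ≠ 0 → q x = J.quadDet x ^ k * p (J.negInv x) := by
  obtain ⟨P, hP⟩ := hp
  simp only [hP]
  clear hP
  induction P using MvPolynomial.induction_on with
  | C a => exact ⟨0, fun _ => a, IsPolyFun.const a, by simp⟩
  | add P Q hP hQ =>
    obtain ⟨k, q, hq, h⟩ := hP
    obtain ⟨k', q', hq', h'⟩ := hQ
    refine ⟨k + k', fun x => J.quadDet x ^ k' * q x + J.quadDet x ^ k * q' x,
      ((isPolyFun_quadDet.pow k').mul hq).add ((isPolyFun_quadDet.pow k).mul hq'), fun x hx => ?_⟩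
    simp only [h x hx, h' x hx, map_add]
    ring
  | mul_X P φ hP =>
    obtain ⟨k, q, hq, h⟩ := hP
    refine ⟨k + 1, fun x => q x * (0 - φ (J.adj x)),
      hq.mul ((IsPolyFun.const 0).sub (isPolyFun_dual_adj φ)), fun x hx => ?_⟩
    have e := congrArg φ (negInv_eq_adj h1 hx)
    rw [map_smul, map_neg, smul_eq_mul] at e
    simp only [h x hx, map_mul, MvPolynomial.eval_X]
    linear_combination (-J.quadDet x ^ k * MvPolynomial.eval (fun φ => φ (J.negInv x)) P) * e

theorem negInv_mem_genericEnd : J.negInv ∈ genericEnd V := by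
  refine mem_genericEnd fun p hp hp0 => ?_
  obtain ⟨k, q, hq, h⟩ := exists_isPolyFun_negInv h1 hp
  have hq0 : q ≠ 0 := by
    -- If the numerator vanished identically, p would vanish at y = j(j(y)) for every invertible y.
    intro h0
    refine hp.mul_ne_zero isPolyFun_quadDet hp0 (quadDet_ne_zero h1) (funext fun y => ?_)
    by_contra hy
    have hu := isUnit_pol_iff.2 (right_ne_zero_of_mul hy)
    have hx := isUnit_pol_iff.1 (isUnit_pol_negInv h1 hu)
    have := h _ hx
    rw [negInv_negInv h1 hu, h0] at this
    exact mul_ne_zero (pow_ne_zero k hx) (left_ne_zero_of_mul hy) this.symm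
  filter_upwards [isPolyFun_quadDet.eventually_ne_zero (quadDet_ne_zero h1),
    hq.eventually_ne_zero hq0] with x hx hqx hpx
  rw [h x hx, hpx, mul_zero] at hqx
  exact hqx rfl

theorem represents_jj : Represents (J.jj : GenericAut V) J.negInv := by
  have h : J.negInv ∘ J.negInv =ᶠ[genericFilter V] id := by
    filter_upwards [eventually_isUnit_pol h1] with x hx using negInv_negInv h1 hx
  exact represents_genericAut (negInv_mem_genericEnd h1) (negInv_mem_genericEnd h1) h h

theorem jj_mul_jj : J.jj * J.jj = 1 := by
  refine Subtype.ext (((represents_jj h1).mul (represents_jj h1)).unique Represents.one ?_)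
  filter_upwards [eventually_isUnit_pol h1] with x hx using negInv_negInv h1 hx

omit h1 in
theorem nn_add (v w : V) : J.nn (v + w) = J.nn v * J.nn w :=
  Subtype.ext ((represents_nn _).unique ((represents_nn v).mul (represents_nn w))
    (Eventually.of_forall fun x => by simp only [Function.comp_apply]; abel))

omit h1 in
theorem nn_zero : J.nn (0 : V) = 1 :=
  Subtype.ext ((represents_nn _).unique Represents.one (Eventually.of_forall fun x => by simp))

omit h1 in
theorem strConf_one : J.strConf (1 : J.Str) = 1 :=
  Subtype.ext ((represents_strConf _).unique Represents.one (Eventually.of_forall fun _ => rfl))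

omit h1 in
theorem strConf_mul (l m : J.Str) : J.strConf (l * m) = J.strConf l * J.strConf m :=
  Subtype.ext ((represents_strConf _).unique ((represents_strConf l).mul (represents_strConf m))
    (Eventually.of_forall fun _ => rfl))

omit h1 in
theorem strConf_mul_nn (l : J.Str) (x : V) :
    J.strConf l * J.nn x = J.nn ((l : V ≃L[ℝ] V) x) * J.strConf l :=
  Subtype.ext (((represents_strConf _).mul (represents_nn _)).unique
    ((represents_nn _).mul (represents_strConf _))
    (Eventually.of_forall fun z => by simp))

theorem nbar_zero : J.nbar (0 : V) = 1 := by rw [nbar, nn_zero, _root_.mul_one, jj_mul_jj h1]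

omit h1 in
theorem nn_inv (v : V) : (J.nn v)⁻¹ = J.nn (-v) := by
  rw [inv_eq_iff_mul_eq_one, ← nn_add, add_neg_cancel, nn_zero]

omit h1 in
theorem strConf_inv (l : J.Str) : (J.strConf l)⁻¹ = J.strConf l⁻¹ := by
  rw [inv_eq_iff_mul_eq_one, ← strConf_mul, mul_inv_cancel, strConf_one]

theorem jj_inv : J.jj⁻¹ = J.jj := by
  rw [inv_eq_iff_mul_eq_one, jj_mul_jj h1]

/-- The decomposition of `j n_x` in `N Str(V) N̄`, at an invertible `x`. -/
theorem jj_mul_nn {x : V} (hx : IsUnit (J.pol x x)) {l : J.Str}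
    (hl : ((l : V ≃L[ℝ] V) : V →L[ℝ] V) = Ring.inverse (J.pol x x)) :
    J.jj * J.nn x = J.nn (J.negInv x) * (J.strConf l * J.nbar (J.negInv x)) := by
  have hj := represents_jj h1
  refine Subtype.ext ((hj.mul (represents_nn x)).unique ((represents_nn _).mul
    ((represents_strConf l).mul ((hj.mul (represents_nn _)).mul hj))) ?_)
  filter_upwards [eventually_isUnit_pol h1, (add_mem_genericEnd x) (eventually_isUnit_pol h1)]
    with z hz hxz
  have hxz : IsUnit (J.pol (x + z) (x + z)) := by
    rw [add_comm]; exact hxz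
  -- Evaluated at z, the claimed decomposition is Hua's identity for (x + z)⁻¹.
  obtain ⟨hu, he⟩ := hua h1 hx hz hxz
  have hl' : ∀ w, (l : V ≃L[ℝ] V) w = Ring.inverse (J.pol x x) w := fun w => by rw [← hl]; rfl
  have e : J.negInv z + J.negInv x = -(J.inv z + J.inv x) := by
    rw [negInv_eq hz, negInv_eq hx, neg_add]
  have hu' : IsUnit (J.pol (-(J.inv z + J.inv x)) (-(J.inv z + J.inv x))) := by
    rwa [pol_neg_neg]
  simp only [Function.comp_apply, hl']
  rw [e, negInv_eq hu', add_comm z x, negInv_eq hxz, he, inv_neg, neg_neg, negInv_eq hx]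
  abel

/-- Each generating family is closed under inverses, so products are the only inductive step. -/
theorem conf_induction {P : J.Conf → Prop} (nn : ∀ v, P (J.nn v)) (str : ∀ l, P (J.strConf l))
    (jj : P J.jj) (mul : ∀ g h, P g → P h → P (g * h)) (g : J.Conf) : P g := by
  have key : ∀ g ∈ J.Conf, ∀ hg : g ∈ J.Conf, P ⟨g, hg⟩ := by
    intro g hg hg'
    refine Subgroup.closure_induction_left (p := fun g hg => P ⟨g, hg⟩) ?_ ?_ ?_ hg
    · have := nn 0
      rwa [nn_zero] at this
    · rintro x ((⟨v, rfl⟩ | ⟨l, rfl⟩) | rfl) y hy hP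
      · exact mul _ ⟨y, hy⟩ (nn v) hP
      · exact mul _ ⟨y, hy⟩ (str l) hP
      · exact mul _ ⟨y, hy⟩ jj hP
    · rintro x ((⟨v, rfl⟩ | ⟨l, rfl⟩) | rfl) y hy hP
      · have := mul _ ⟨y, hy⟩ (nn (-v)) hP
        rwa [← nn_inv] at this
      · have := mul _ ⟨y, hy⟩ (str l⁻¹) hP
        rwa [← strConf_inv] at this
      · have := mul _ ⟨y, hy⟩ jj hP
        rw [← jj_inv h1] at this
        exact this
  exact key g g.2 g.2

end Inversion

/-! ### The multiplier of a conformal transformation and the formula for π_s. -/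

section Multiplier

variable (hJ : J.IsSimple)

theorem indSpace_translate {s : ℂ} {F : J.Conf → ℂ} (hF : F ∈ J.indSpace s) (k : J.Conf) :
    (fun h => F (k * h)) ∈ J.indSpace s := by
  have := (J.indRep s k⁻¹ ⟨F, hF⟩).2
  simpa [indRep] using this

variable (J) in
/-- Where it is regular, a conformal transformation acts through its derivative. -/
def ActsAt (s : ℂ) (k : J.Conf) (φ : V → V) (x : V) : Prop :=
  ∃ l : J.Str, HasFDerivAt φ ((l : V ≃L[ℝ] V) : V →L[ℝ] V) x ∧ ∀ F ∈ J.indSpace s,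
    F (k * J.nn x) =
      ((|J.chi ((l : V ≃L[ℝ] V) : V →L[ℝ] V)| : ℝ) : ℂ) ^ J.expo s * F (J.nn (φ x))

theorem ActsAt.congr {s : ℂ} {k : J.Conf} {φ ψ : V → V} {x : V} (h : J.ActsAt s k φ x)
    (he : ψ =ᶠ[𝓝 x] φ) : J.ActsAt s k ψ x := by
  obtain ⟨l, hl, hF⟩ := h
  exact ⟨l, hl.congr_of_eventuallyEq he, by rw [he.eq_of_nhds]; exact hF⟩

theorem actsAt_nn (s : ℂ) (v x : V) (h1 : J.chi (1 : V →L[ℝ] V) = 1) :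
    J.ActsAt s (J.nn v) (fun x => x + v) x := by
  refine ⟨1, (hasFDerivAt_id x).add_const v, fun F _ => ?_⟩
  have : (((1 : J.Str) : V ≃L[ℝ] V) : V →L[ℝ] V) = 1 := rfl
  rw [this, h1, ← nn_add, add_comm v x]
  simp

include hJ

theorem actsAt_strConf (s : ℂ) (l : J.Str) (x : V) :
    J.ActsAt s (J.strConf l) (fun x => (l : V ≃L[ℝ] V) x) x := by
  refine ⟨l, (l : V ≃L[ℝ] V).hasFDerivAt, fun F hF => ?_⟩
  rw [strConf_mul_nn, ← hF.2 _ l 0, nbar_zero hJ.one_mul, _root_.mul_one]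

/-- In j n_x = n_{j(x)} l n̄ the Str(V)-component l = P(x)⁻¹ is also the derivative of j at x, so
the equivariance of F produces χ of the derivative. -/
theorem actsAt_jj (s : ℂ) {x : V} (hx : IsUnit (J.pol x x)) : J.ActsAt s J.jj J.negInv x := by
  obtain ⟨l, hl, -⟩ := exists_str_inverse_pol hJ hx
  refine ⟨l, ?_, fun F hF => ?_⟩
  · have h := (hasFDerivAt_inv hJ.one_mul hx).neg
    rw [neg_neg, ← hl] at h
    refine h.congr_of_eventuallyEq ?_
    filter_upwards [isOpen_isUnit_pol.mem_nhds hx] with y hy using negInv_eq hy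
  · rw [jj_mul_nn hJ.one_mul hx hl, hF.2]

theorem ActsAt.mul {s : ℂ} {g h : J.Conf} {φ ψ : V → V} {x : V} (hg : J.ActsAt s g φ (ψ x))
    (hh : J.ActsAt s h ψ x) : J.ActsAt s (g * h) (φ ∘ ψ) x := by
  obtain ⟨l, hl, hF⟩ := hg
  obtain ⟨m, hm, hG⟩ := hh
  refine ⟨l * m, hl.comp x hm, fun F hFs => ?_⟩
  have e : (((l * m : J.Str) : V ≃L[ℝ] V) : V →L[ℝ] V) =
    ((l : V ≃L[ℝ] V) : V →L[ℝ] V) * ((m : V ≃L[ℝ] V) : V →L[ℝ] V) := rfl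
  have h1 := hG _ (indSpace_translate hFs g)
  rw [mul_assoc, h1, hF F hFs, chi_mul hJ, abs_mul, Complex.ofReal_mul,
    Complex.mul_cpow_ofReal_nonneg (abs_nonneg _) (abs_nonneg _)]
  simp only [Function.comp_apply]
  ring

theorem exists_actsAt (s : ℂ) (k : J.Conf) : ∃ φ, Represents (k : GenericAut V) φ ∧
    ∀ᶠ x in genericFilter V, J.ActsAt s k φ x := by
  induction k using conf_induction hJ.one_mul with
  | nn v => exact ⟨_, represents_nn v, Eventually.of_forall fun x => actsAt_nn s v x (chi_one hJ)⟩
  | str l => exact ⟨_, represents_strConf l, Eventually.of_forall fun x => actsAt_strConf hJ s l x⟩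
  | jj =>
    refine ⟨_, represents_jj hJ.one_mul, ?_⟩
    filter_upwards [eventually_isUnit_pol hJ.one_mul] with x hx using actsAt_jj hJ s hx
  | mul g h hg hh =>
    obtain ⟨φ, hφ, hg⟩ := hg
    obtain ⟨ψ, hψ, hh⟩ := hh
    refine ⟨φ ∘ ψ, hφ.mul hψ, ?_⟩
    filter_upwards [hψ.tendsto.eventually hg, hh] with x h1 h2 using h1.mul hJ h2

/-- `exists_actsAt` treats only one representative, built from generators; any other has the same
germ at generic points. -/
theorem eventually_actsAt (s : ℂ) {k : J.Conf} {φ : V → V} (hφ : Represents (k : GenericAut V) φ) :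
    ∀ᶠ x in genericFilter V, J.ActsAt s k φ x := by
  obtain ⟨ψ, hψ, h⟩ := exists_actsAt hJ s k
  filter_upwards [h, eventually_generic_nhds (hφ.eventuallyEq hψ)] with x h1 h2 using h1.congr h2

omit hJ in
-- `rep` is defined through a chosen lift of f. It is enough later that f and π_s(g) f are read from
-- the same lift F.
theorem exists_rep_eq {s : ℂ} (g : J.Conf) (f : J.Ispace s) :
    ∃ F ∈ J.indSpace s, (∀ x, (f : V → ℂ) x = F (J.nn x)) ∧
      ∀ x, (J.rep s g f : V → ℂ) x = F (g⁻¹ * J.nn x) :=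
  ⟨f.2.choose, f.2.choose_spec.1, fun x => (congrFun f.2.choose_spec.2 x).symm, fun _ => rfl⟩

theorem rep_formula (s : ℂ) (g : J.Conf) (f : J.Ispace s) {φ : V → V}
    (hφ : Represents ((g⁻¹ : J.Conf) : GenericAut V) φ) :
    ∀ᶠ x in genericFilter V, DifferentiableAt ℝ φ x ∧ (J.rep s g f : V → ℂ) x =
      ((|J.chi (fderiv ℝ φ x)| : ℝ) : ℂ) ^ J.expo s * (f : V → ℂ) (φ x) := by
  obtain ⟨F, hF, hf, hrep⟩ := exists_rep_eq g f
  filter_upwards [eventually_actsAt hJ s hφ] with x ⟨l, hl, h⟩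
  refine ⟨hl.differentiableAt, ?_⟩
  rw [hrep, h F hF, hl.fderiv, hf]

end Multiplier

end JordanAlg

/-! ### Generic sets have full measure. -/

section NullSets

variable {V : Type*} [NormedAddCommGroup V] [NormedSpace ℝ V] [FiniteDimensional ℝ V]
  [MeasurableSpace V] [BorelSpace V] (μ : Measure V) [μ.IsAddHaarMeasure]

theorem IsPolyFun.exists_polynomial {p : V → ℝ} (hp : IsPolyFun V p) (y x : V) :
    ∃ P : Polynomial ℝ, ∀ t : ℝ, P.eval t = p (y + t • x) := by
  obtain ⟨Q, hQ⟩ := hp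
  simp only [hQ]
  clear hQ
  refine ⟨MvPolynomial.aeval (fun φ : Module.Dual ℝ V =>
    Polynomial.C (φ y) + Polynomial.X * Polynomial.C (φ x)) Q, fun t => ?_⟩
  induction Q using MvPolynomial.induction_on with
  | C a => simp
  | add P Q hP hQ => rw [map_add, map_add, Polynomial.eval_add, hP, hQ]
  | mul_X P φ hP => rw [map_mul, map_mul, Polynomial.eval_mul, hP]; simp [mul_comm t]

/-- On each line t ↦ y + tx through a point with p(y) ≠ 0 there are finitely many zeros. By Fubini
some t ≠ 0 works for almost every x, and x ↦ y + tx preserves null sets in both directions. -/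
theorem IsPolyFun.ae_ne_zero {p : V → ℝ} (hp : IsPolyFun V p) (hp0 : p ≠ 0) :
    ∀ᵐ x ∂μ, p x ≠ 0 := by
  obtain ⟨y, hy⟩ := Function.ne_iff.1 hp0
  have := FiniteDimensional.proper ℝ V
  have key : ∀ x : V, ∀ᵐ t : ℝ, p (y + t • x) ≠ 0 := by
    intro x
    obtain ⟨P, hP⟩ := hp.exists_polynomial y x
    have hP0 : P ≠ 0 := by
      rintro rfl
      have := hP 0
      simp only [Polynomial.eval_zero, zero_smul, add_zero] at this
      exact hy this.symm
    refine measure_mono_null (fun t ht => ?_) (P.roots.toFinset.finite_toSet.measure_zero volume)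
    have h0 : p (y + t • x) = 0 := not_not.1 ht
    simp [hP0, hP, h0]
  have hm : MeasurableSet {q : V × ℝ | p (y + q.2 • q.1) ≠ 0} :=
    (isOpen_ne_fun (hp.continuous.comp (by fun_prop)) continuous_const).measurableSet
  have h2 : ∀ᵐ t : ℝ, ∀ᵐ x ∂μ, p (y + t • x) ≠ 0 :=
    (Measure.ae_ae_comm (p := fun x t => p (y + t • x) ≠ 0) hm).1
      (Eventually.of_forall key)
  have h3 : ∀ᵐ t : ℝ, t ≠ 0 := by simp [ae_iff]
  obtain ⟨t, ht, ht0⟩ := (h2.and h3).exists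
  have e : {x | ¬ p (y + t • x) ≠ 0} = (t • ·) ⁻¹' ((y + ·) ⁻¹' {x | ¬ p x ≠ 0}) := rfl
  rw [ae_iff, e, Measure.addHaar_preimage_smul μ ht0, measure_preimage_add, mul_eq_zero] at ht
  rw [ae_iff]
  refine ht.resolve_left ?_
  simp [ht0]

theorem ae_of_generic {P : V → Prop} (h : ∀ᶠ x in genericFilter V, P x) : ∀ᵐ x ∂μ, P x := by
  obtain ⟨p, hp, hp0, h⟩ := mem_genericFilter.1 h
  filter_upwards [hp.ae_ne_zero μ hp0] with x hx using h x hx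

end NullSets

/-! ### Change of variables and invariance of the form. -/

namespace JordanAlg

section ChangeOfVariables

variable {V : Type*} [NormedAddCommGroup V] [NormedSpace ℝ V] [FiniteDimensional ℝ V]
  {J : JordanAlg V}

variable (J) in
/-- On the open set `U` the conformal transformation `k` is given by the injective map `φ`, which
transforms the kernel `Δ(x - y)` by its multiplier. -/
structure ConformalOn (s : ℂ) (k : J.Conf) (φ : V → V) (U : Set V) : Prop where
  isOpen : IsOpen U
  injOn : Set.InjOn φ U
  actsAt : ∀ x ∈ U, J.ActsAt s k φ x
  kernel : ∀ x ∈ U, ∀ y ∈ U, J.jdet (φ x - φ y) ^ 2 =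
    |J.chi (fderiv ℝ φ x)| * |J.chi (fderiv ℝ φ y)| * J.jdet (x - y) ^ 2

variable (hJ : J.IsSimple)

include hJ

theorem conformalOn_nn (s : ℂ) (v : V) :
    J.ConformalOn s (J.nn v) (fun x => x + v) Set.univ where
  isOpen := isOpen_univ
  injOn := (add_left_injective v).injOn
  actsAt x _ := actsAt_nn s v x (chi_one hJ)
  kernel x _ y _ := by
    have e : ∀ x, fderiv ℝ (fun x => x + v) x = (1 : V →L[ℝ] V) := fun x =>
      ((hasFDerivAt_id x).add_const v).fderiv
    have h1 : J.chi (1 : V →L[ℝ] V) = 1 := chi_one hJ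
    rw [e, e, h1, add_sub_add_right_eq_sub]
    simp

theorem conformalOn_strConf (s : ℂ) (l : J.Str) :
    J.ConformalOn s (J.strConf l) (fun x => (l : V ≃L[ℝ] V) x) Set.univ where
  isOpen := isOpen_univ
  injOn := (l : V ≃L[ℝ] V).injective.injOn
  actsAt x _ := actsAt_strConf hJ s l x
  kernel x _ y _ := by
    have e : ∀ x, fderiv ℝ (fun x => (l : V ≃L[ℝ] V) x) x = ((l : V ≃L[ℝ] V) : V →L[ℝ] V) :=
      fun x => (l : V ≃L[ℝ] V).hasFDerivAt.fderiv
    have h := jdet_chi l (x - y)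
    simp only [e, abs_mul_abs_self, ← map_sub]
    change J.jdet ((l : V ≃L[ℝ] V) (x - y)) ^ 2 = _
    rw [h]
    ring

theorem conformalOn_jj (s : ℂ) : J.ConformalOn s J.jj J.negInv {x | IsUnit (J.pol x x)} where
  isOpen := isOpen_isUnit_pol
  injOn := fun x hx y hy h => by
    rw [← negInv_negInv hJ.one_mul hx, h, negInv_negInv hJ.one_mul hy]
  actsAt x hx := actsAt_jj hJ s hx
  kernel := by
    -- The derivative of j at x is P(x)⁻¹, whose χ is Δ(x)⁻²; the kernel relation then is
    -- `jdet_inv_sub_inv`.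
    have key : ∀ x, IsUnit (J.pol x x) →
        |J.chi (fderiv ℝ J.negInv x)| * J.jdet x ^ 2 = 1 := by
      intro x hx
      obtain ⟨l, hl, hc⟩ := exists_str_inverse_pol hJ hx
      have h := (hasFDerivAt_inv hJ.one_mul hx).neg
      rw [neg_neg, ← hl] at h
      have h2 : J.negInv =ᶠ[𝓝 x] fun y => -J.inv y := by
        filter_upwards [isOpen_isUnit_pol.mem_nhds hx] with y hy using negInv_eq hy
      rw [(h.congr_of_eventuallyEq h2).fderiv, ← abs_sq (J.jdet x), ← abs_mul, hc, abs_one]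
    intro x hx y hy
    have h := jdet_inv_sub_inv hJ hx hy
    have e : J.negInv x - J.negInv y = J.inv y - J.inv x := by
      rw [negInv_eq hx, negInv_eq hy]; abel
    have h' := jdet_inv_sub_inv hJ hy hx
    have e2 : J.jdet (y - x) ^ 2 = J.jdet (x - y) ^ 2 := by
      rw [← neg_sub x y, ← neg_one_smul ℝ, jdet_smul (by norm_num), mul_pow, ← pow_mul,
        _root_.mul_comm J.rank, pow_mul]
      simp
    rw [e2] at h'
    have kx := key x hx
    have ky := key y hy
    rw [e]
    linear_combination (-J.jdet (J.inv y - J.inv x) ^ 2) * kx -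
      (J.jdet (J.inv y - J.inv x) ^ 2 * |J.chi (fderiv ℝ J.negInv x)| * J.jdet x ^ 2) * ky +
      |J.chi (fderiv ℝ J.negInv x)| * |J.chi (fderiv ℝ J.negInv y)| * h'

theorem ConformalOn.mul {s : ℂ} {g h : J.Conf} {φ ψ : V → V} {U W : Set V}
    (hg : J.ConformalOn s g φ U) (hh : J.ConformalOn s h ψ W) :
    J.ConformalOn s (g * h) (φ ∘ ψ) (W ∩ ψ ⁻¹' U) where
  isOpen := ContinuousOn.isOpen_inter_preimage (fun x hx => by
    obtain ⟨l, hl, -⟩ := hh.actsAt x hx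
    exact hl.continuousAt.continuousWithinAt) hh.isOpen hg.isOpen
  injOn := hg.injOn.comp (hh.injOn.mono Set.inter_subset_left) fun x hx => hx.2
  actsAt x hx := (hg.actsAt _ hx.2).mul hJ (hh.actsAt x hx.1)
  kernel := by
    have key : ∀ x ∈ W ∩ ψ ⁻¹' U, |J.chi (fderiv ℝ (φ ∘ ψ) x)| =
        |J.chi (fderiv ℝ φ (ψ x))| * |J.chi (fderiv ℝ ψ x)| := by
      rintro x ⟨hx, hx'⟩
      obtain ⟨l, hl, -⟩ := hg.actsAt _ hx'
      obtain ⟨m, hm, -⟩ := hh.actsAt x hx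
      rw [(hl.comp x hm).fderiv, hl.fderiv, hm.fderiv, ← abs_mul, ← chi_mul hJ]
      rfl
    intro x hx y hy
    rw [key x hx, key y hy, Function.comp_apply, Function.comp_apply,
      hg.kernel _ hx.2 _ hy.2, hh.kernel x hx.1 y hy.1]
    ring

omit hJ in
theorem ofReal_exp_cpow (a : ℝ) (z : ℂ) : ((Real.exp a : ℝ) : ℂ) ^ z = Complex.exp (a * z) := by
  rw [Complex.cpow_def_of_ne_zero (by exact_mod_cast (Real.exp_pos a).ne'), ← Complex.ofReal_log
    (Real.exp_pos a).le, Real.log_exp]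

variable {α : V →ₗ[ℝ] V} (hα : J.IsEuclideanInvolution α)

include hα

/-- Exponent count: the Jacobian contributes |χ|^(n/r), the kernel |χ|^(s - n/(2r)), and together
|χ|^(s + n/(2r)). Since k and k₀ may vanish, only the χ and det factors are written as exponentials.
-/
theorem abs_det_smul_kernel (s : ℂ) (l m : J.Str) {k k₀ : ℝ}
    (h : k ^ 2 = |J.chi ((l : V ≃L[ℝ] V) : V →L[ℝ] V)| * |J.chi ((m : V ≃L[ℝ] V) : V →L[ℝ] V)| *
      k₀ ^ 2) :
    ((|LinearMap.det (((l : V ≃L[ℝ] V) : V →L[ℝ] V) : V →ₗ[ℝ] V)| : ℝ) : ℂ) *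
      ((|LinearMap.det (((m : V ≃L[ℝ] V) : V →L[ℝ] V) : V →ₗ[ℝ] V)| : ℝ) : ℂ) *
      ((|k| : ℝ) : ℂ) ^ (2 * s - (Module.finrank ℝ V : ℂ) / (J.rank : ℂ)) =
    ((|J.chi ((l : V ≃L[ℝ] V) : V →L[ℝ] V)| : ℝ) : ℂ) ^ J.expo s *
      ((|J.chi ((m : V ≃L[ℝ] V) : V →L[ℝ] V)| : ℝ) : ℂ) ^ J.expo s *
      ((|k₀| : ℝ) : ℂ) ^ (2 * s - (Module.finrank ℝ V : ℂ) / (J.rank : ℂ)) := by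
  have hr : (J.rank : ℝ) ≠ 0 := by exact_mod_cast (rank_pos hJ).ne'
  have hr' : (J.rank : ℂ) ≠ 0 := by exact_mod_cast hr
  have hexp : ∀ l : J.Str, ∃ a : ℝ, |J.chi ((l : V ≃L[ℝ] V) : V →L[ℝ] V)| = Real.exp a ∧
      |LinearMap.det (((l : V ≃L[ℝ] V) : V →L[ℝ] V) : V →ₗ[ℝ] V)| =
        Real.exp (a * (Module.finrank ℝ V / J.rank)) := by
    intro l
    refine ⟨Real.log |J.chi ((l : V ≃L[ℝ] V) : V →L[ℝ] V)|, ?_, ?_⟩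
    · rw [Real.exp_log (abs_pos.2 (chi_ne_zero hJ l))]
    · have h1 := abs_det_pow_rank hJ hα l
      refine (pow_left_inj₀ (abs_nonneg _) (Real.exp_pos _).le (rank_pos hJ).ne').1 ?_
      rw [h1, ← Real.exp_nat_mul]
      have e : (J.rank : ℝ) * (Real.log |J.chi ((l : V ≃L[ℝ] V) : V →L[ℝ] V)| *
          (Module.finrank ℝ V / J.rank)) =
          Module.finrank ℝ V * Real.log |J.chi ((l : V ≃L[ℝ] V) : V →L[ℝ] V)| := by
        field_simp
      rw [e, Real.exp_nat_mul, Real.exp_log (abs_pos.2 (chi_ne_zero hJ l))]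
  obtain ⟨a, ha, hda⟩ := hexp l
  obtain ⟨b, hb, hdb⟩ := hexp m
  have hk : |k| = Real.exp (a / 2 + b / 2) * |k₀| := by
    refine (pow_left_inj₀ (abs_nonneg _) (by positivity) two_ne_zero).1 ?_
    rw [mul_pow, sq_abs, sq_abs, h, ha, hb, ← Real.exp_nat_mul, ← Real.exp_add]
    congr 2
    push_cast; ring
  rw [ha, hb, hda, hdb, hk, Complex.ofReal_mul (Real.exp _), Complex.mul_cpow_ofReal_nonneg
    (Real.exp_pos _).le (abs_nonneg _), ofReal_exp_cpow, ofReal_exp_cpow, ofReal_exp_cpow,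
    ← mul_assoc]
  congr 1
  rw [Complex.ofReal_exp, Complex.ofReal_exp, ← Complex.exp_add, ← Complex.exp_add,
    ← Complex.exp_add, expo]
  congr 1
  push_cast
  field_simp
  ring

variable [MeasurableSpace V] [BorelSpace V] (μ : Measure V) [μ.IsAddHaarMeasure]

theorem ConformalOn.formIntegrand_comp {s : ℂ} {k : J.Conf} {φ : V → V} {U : Set V}
    (h : J.ConformalOn s k φ U) {F G : J.Conf → ℂ} (hF : F ∈ J.indSpace s)
    (hG : G ∈ J.indSpace s) {p : V × V} (hp : p ∈ U ×ˢ U) :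
    |((fderiv ℝ φ p.1).prodMap (fderiv ℝ φ p.2)).det| •
      J.formIntegrand s (fun x => F (J.nn x)) (fun x => G (J.nn x)) (Prod.map φ φ p) =
    J.formIntegrand s (fun x => F (k * J.nn x)) (fun x => G (k * J.nn x)) p := by
  obtain ⟨l, hl, hlF⟩ := h.actsAt _ hp.1
  obtain ⟨m, hm, hmG⟩ := h.actsAt _ hp.2
  have hk := h.kernel _ hp.1 _ hp.2
  rw [hl.fderiv, hm.fderiv] at hk
  have key := abs_det_smul_kernel hJ hα s l m hk
  simp only [formIntegrand, hlF F hF, hmG G hG, Prod.map_fst, Prod.map_snd, hl.fderiv, hm.fderiv]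
  have hd : ((((l : V ≃L[ℝ] V) : V →L[ℝ] V)).prodMap ((m : V ≃L[ℝ] V) : V →L[ℝ] V)).det =
      LinearMap.det (((l : V ≃L[ℝ] V) : V →L[ℝ] V) : V →ₗ[ℝ] V) *
      LinearMap.det (((m : V ≃L[ℝ] V) : V →L[ℝ] V) : V →ₗ[ℝ] V) := LinearMap.det_prodMap _ _
  rw [hd, abs_mul, Complex.real_smul, Complex.ofReal_mul]
  linear_combination F (J.nn (φ p.1)) * G (J.nn (φ p.2)) * key

omit hJ hα in
theorem ConformalOn.hasFDerivWithinAt {s : ℂ} {k : J.Conf} {φ : V → V} {U : Set V}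
    (h : J.ConformalOn s k φ U) {E : Set (V × V)} (hE : E ⊆ U ×ˢ U) (p : V × V) (hp : p ∈ E) :
    HasFDerivWithinAt (Prod.map φ φ) ((fderiv ℝ φ p.1).prodMap (fderiv ℝ φ p.2)) E p := by
  obtain ⟨l, hl, -⟩ := h.actsAt _ (hE hp).1
  obtain ⟨m, hm, -⟩ := h.actsAt _ (hE hp).2
  exact (hl.differentiableAt.hasFDerivAt.prodMap p
    hm.differentiableAt.hasFDerivAt).hasFDerivWithinAt

theorem ConformalOn.integrableOn_iff {s : ℂ} {k : J.Conf} {φ : V → V} {U : Set V}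
    (h : J.ConformalOn s k φ U) {F G : J.Conf → ℂ} (hF : F ∈ J.indSpace s)
    (hG : G ∈ J.indSpace s) {E : Set (V × V)} (hE : E ⊆ U ×ˢ U) (hm : MeasurableSet E) :
    IntegrableOn (J.formIntegrand s (fun x => F (J.nn x)) fun x => G (J.nn x))
      (Prod.map φ φ '' E) (μ.prod μ) ↔
    IntegrableOn (J.formIntegrand s (fun x => F (k * J.nn x)) fun x => G (k * J.nn x))
      E (μ.prod μ) := by
  have := FiniteDimensional.proper ℝ V
  rw [integrableOn_image_iff_integrableOn_abs_det_fderiv_smul (μ.prod μ) hm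
    (h.hasFDerivWithinAt hE) ((h.injOn.prodMap h.injOn).mono hE)]
  exact integrableOn_congr_fun (fun p hp => h.formIntegrand_comp hJ hα hF hG (hE hp)) hm

theorem ConformalOn.setIntegral_eq {s : ℂ} {k : J.Conf} {φ : V → V} {U : Set V}
    (h : J.ConformalOn s k φ U) {F G : J.Conf → ℂ} (hF : F ∈ J.indSpace s)
    (hG : G ∈ J.indSpace s) {E : Set (V × V)} (hE : E ⊆ U ×ˢ U) (hm : MeasurableSet E) :
    ∫ p in Prod.map φ φ '' E,
      J.formIntegrand s (fun x => F (J.nn x)) (fun x => G (J.nn x)) p ∂(μ.prod μ) =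
    ∫ p in E, J.formIntegrand s (fun x => F (k * J.nn x)) (fun x => G (k * J.nn x)) p
      ∂(μ.prod μ) := by
  have := FiniteDimensional.proper ℝ V
  rw [integral_image_eq_integral_abs_det_fderiv_smul (μ.prod μ) hm
    (h.hasFDerivWithinAt hE) ((h.injOn.prodMap h.injOn).mono hE)]
  exact setIntegral_congr_fun hm fun p hp => h.formIntegrand_comp hJ hα hF hG (hE hp)

omit hJ hα in
theorem setIntegral_prod_of_ae {U : Set V} (hU : ∀ᵐ x ∂μ, x ∈ U) (f : V × V → ℂ) :
    ∫ p in U ×ˢ U, f p ∂(μ.prod μ) = ∫ p, f p ∂(μ.prod μ) := by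
  rw [← Measure.prod_restrict, Measure.restrict_eq_self_of_ae_mem hU]

/-- Domain and image both have full measure, so the injective change of variables relates integrals
over all of V × V. No integrability is needed: if the integrals diverge, both take the default value
0. -/
theorem ConformalOn.integral_eq {s : ℂ} {k : J.Conf} {φ : V → V} {U : Set V}
    (h : J.ConformalOn s k φ U) {F G : J.Conf → ℂ} (hF : F ∈ J.indSpace s)
    (hG : G ∈ J.indSpace s) (hU : ∀ᵐ x ∂μ, x ∈ U) (hU' : ∀ᵐ x ∂μ, x ∈ φ '' U) :
    ∫ p, J.formIntegrand s (fun x => F (k * J.nn x)) (fun x => G (k * J.nn x)) p ∂(μ.prod μ) =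
    ∫ p, J.formIntegrand s (fun x => F (J.nn x)) (fun x => G (J.nn x)) p ∂(μ.prod μ) := by
  rw [← setIntegral_prod_of_ae μ hU, ← setIntegral_prod_of_ae μ hU', ← Set.prodMap_image_prod,
    h.setIntegral_eq hJ hα μ hF hG subset_rfl
      (h.isOpen.measurableSet.prod h.isOpen.measurableSet)]

/-- The form is invariant under the conformal group. -/
theorem integral_translate {s : ℂ} (k : J.Conf) {F G : J.Conf → ℂ} (hF : F ∈ J.indSpace s)
    (hG : G ∈ J.indSpace s) :
    ∫ p, J.formIntegrand s (fun x => F (k * J.nn x)) (fun x => G (k * J.nn x)) p ∂(μ.prod μ) =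
    ∫ p, J.formIntegrand s (fun x => F (J.nn x)) (fun x => G (J.nn x)) p ∂(μ.prod μ) := by
  induction k using conf_induction hJ.one_mul generalizing F G with
  | nn v =>
    refine (conformalOn_nn hJ s v).integral_eq hJ hα μ hF hG (by simp) ?_
    exact Eventually.of_forall fun x => ⟨x - v, trivial, by simp⟩
  | str l =>
    refine (conformalOn_strConf hJ s l).integral_eq hJ hα μ hF hG (by simp) ?_
    exact Eventually.of_forall fun x => ⟨(l : V ≃L[ℝ] V).symm x, trivial, by simp⟩
  | jj =>
    have h := ae_of_generic μ (eventually_isUnit_pol hJ.one_mul)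
    refine (conformalOn_jj hJ s).integral_eq hJ hα μ hF hG h ?_
    filter_upwards [h] with x hx
    exact ⟨_, isUnit_pol_negInv hJ.one_mul hx, negInv_negInv hJ.one_mul hx⟩
  | mul g h hg hh =>
    simp only [mul_assoc]
    -- The left translates of F and G by g are again in the induced space, so the case of h applies
    -- to them.
    rw [hh (indSpace_translate hF g) (indSpace_translate hG g), hg hF hG]

end ChangeOfVariables

end JordanAlg

/-! ### Bounding a logarithmic derivative by finitely many evaluations. -/

section UniformEvaluation

/-- A finite-dimensional space of functions is determined by the values at finitely many points. -/
theorem Submodule.FG.exists_finset_separating {X : Type*} {W : Submodule ℝ (X → ℝ)} (hW : W.FG) :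
    ∃ T : Finset X, ∀ q ∈ W, (∀ v ∈ T, q v = 0) → q = 0 := by
  classical
  have : FiniteDimensional ℝ W := Module.Finite.iff_fg.2 hW
  let ev : X → Module.Dual ℝ W := fun v => (LinearMap.proj v : (X → ℝ) →ₗ[ℝ] ℝ) ∘ₗ W.subtype
  -- Finitely many evaluations span all of them in the dual of W.
  obtain ⟨S, hS, hspan⟩ := (Submodule.fg_span_iff_fg_span_finset_subset (Set.range ev)).1
    (IsNoetherian.noetherian (Submodule.span ℝ (Set.range ev)))
  obtain ⟨T, hT⟩ : ∃ T : Finset X, ∀ φ ∈ S, ∃ v ∈ T, ev v = φ := by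
    choose f hf using fun φ : S => hS φ.2
    exact ⟨Finset.univ.image f, fun φ hφ =>
      ⟨f ⟨φ, hφ⟩, Finset.mem_image_of_mem f (Finset.mem_univ _), hf ⟨φ, hφ⟩⟩⟩
  refine ⟨T, fun q hq h0 => funext fun v => ?_⟩
  have hv : ev v ∈ Submodule.span ℝ (S : Set (Module.Dual ℝ W)) :=
    hspan ▸ Submodule.subset_span ⟨v, rfl⟩
  have hle : Submodule.span ℝ (S : Set (Module.Dual ℝ W)) ≤
      LinearMap.ker (Module.Dual.eval ℝ W ⟨q, hq⟩) := by
    rw [Submodule.span_le]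
    intro φ hφ
    obtain ⟨w, hw, rfl⟩ := hT φ hφ
    exact h0 w hw
  exact hle hv

variable {V : Type*} [NormedAddCommGroup V] [NormedSpace ℝ V] [FiniteDimensional ℝ V]

variable (V) in
/-- The affine functions on `V`. -/
noncomputable def affineFuns : Submodule ℝ (V → ℝ) :=
  Submodule.span ℝ (insert 1 (Set.range fun i => (Module.finBasis ℝ V).coord i))

theorem affineFuns_fg : (affineFuns V).FG :=
  Submodule.fg_span ((Set.finite_range _).insert 1)

theorem one_le_affineFuns : 1 ≤ affineFuns V := by
  rw [Submodule.one_le]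
  exact Submodule.subset_span (Set.mem_insert _ _)

theorem affineFuns_pow_mono {k m : ℕ} (h : k ≤ m) : affineFuns V ^ k ≤ affineFuns V ^ m :=
  pow_le_pow_right' one_le_affineFuns h

theorem IsPolyFun.exists_mem_affineFuns_pow {p : V → ℝ} (hp : IsPolyFun V p) :
    ∃ k, p ∈ affineFuns V ^ k := by
  obtain ⟨P, hP⟩ := isPolyFun_iff.1 hp
  obtain rfl : p = fun x => coordEval x P := funext hP
  clear hp hP
  induction P using MvPolynomial.induction_on with
  | C a =>
    refine ⟨0, ?_⟩
    rw [pow_zero, Submodule.mem_one]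
    exact ⟨a, funext fun x => by simp [coordEval]⟩
  | add P Q hP hQ =>
    obtain ⟨k, hk⟩ := hP
    obtain ⟨m, hm⟩ := hQ
    refine ⟨k + m, ?_⟩
    simp only [map_add]
    exact Submodule.add_mem _ (affineFuns_pow_mono (Nat.le_add_right k m) hk)
      (affineFuns_pow_mono (Nat.le_add_left m k) hm)
  | mul_X P i hP =>
    obtain ⟨k, hk⟩ := hP
    refine ⟨k + 1, ?_⟩
    have e : (fun x : V => coordEval x (P * MvPolynomial.X i)) =
        (fun x => coordEval x P) * (Module.finBasis ℝ V).coord i := by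
      ext x; simp [coordEval]
    rw [e, pow_succ]
    exact Submodule.mul_mem_mul hk (Submodule.subset_span (Or.inr ⟨i, rfl⟩))

theorem isPolyFun_of_mem_affineFuns {p : V → ℝ} (hp : p ∈ affineFuns V) : IsPolyFun V p := by
  induction hp using Submodule.span_induction with
  | mem q hq =>
    rcases hq with rfl | ⟨i, rfl⟩
    · exact IsPolyFun.const 1
    · exact IsPolyFun.dual _
  | zero => exact IsPolyFun.const 0
  | add p q _ _ hp hq => exact hp.add hq
  | smul a p _ hp => exact (IsPolyFun.const a).mul hp

theorem isPolyFun_of_mem_affineFuns_pow {k : ℕ} {p : V → ℝ} (hp : p ∈ affineFuns V ^ k) :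
    IsPolyFun V p := by
  induction hp using Submodule.pow_induction_on_left' with
  | algebraMap r => exact IsPolyFun.const r
  | add p q _ _ _ hp hq => exact hp.add hq
  | mem_mul m hm i x _ hx => exact (isPolyFun_of_mem_affineFuns hm).mul hx

/-- All the functions v ↦ p(x - v), as x varies, stay in the same finite-dimensional space of
polynomials. -/
theorem affineFuns_pow_reflect {k : ℕ} {p : V → ℝ} (hp : p ∈ affineFuns V ^ k) (x : V) :
    (fun v => p (x - v)) ∈ affineFuns V ^ k := by
  let τ : (V → ℝ) →ₐ[ℝ] (V → ℝ) :=
    { toFun := fun p v => p (x - v)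
      map_one' := rfl
      map_mul' := fun _ _ => rfl
      map_zero' := rfl
      map_add' := fun _ _ => rfl
      commutes' := fun _ => rfl }
  have h1 : (affineFuns V).map τ.toLinearMap ≤ affineFuns V := by
    rw [affineFuns, Submodule.map_span, Submodule.span_le]
    rintro _ ⟨q, rfl | ⟨i, rfl⟩, rfl⟩
    · exact Submodule.subset_span (Or.inl rfl)
    · have e : τ.toLinearMap ((Module.finBasis ℝ V).coord i) =
          (Module.finBasis ℝ V).coord i x • (1 : V → ℝ) -
            ⇑((Module.finBasis ℝ V).coord i) := by
        ext v
        exact map_sub ((Module.finBasis ℝ V).coord i) x v |>.trans (by simp)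
      rw [e]
      exact Submodule.sub_mem _ (Submodule.smul_mem _ _ (Submodule.subset_span (Or.inl rfl)))
        (Submodule.subset_span (Or.inr ⟨i, rfl⟩))
  have h2 : (affineFuns V ^ k).map τ.toLinearMap ≤ affineFuns V ^ k := by
    rw [Submodule.map_pow]
    exact pow_le_pow_left' h1 k
  exact h2 ⟨p, hp, rfl⟩

/-- The restriction of functions to a finite set. -/
def restrictFun {X : Type*} (T : Finset X) : (X → ℝ) →ₗ[ℝ] (T → ℝ) :=
  LinearMap.funLeft ℝ ℝ (fun t : T => (t : X))

/-- Measure v ↦ p(x - v) by its maximum over T. Products of two normalized elements are nonzero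
polynomials, so by compactness their maximum over T is at least some m > 0. At a point of T where
this is attained both factors are at least m, each being at most 1. Derivatives on T are bounded by
the norm, so C/m works for all x and y. -/
theorem exists_uniform_evaluation {p : V → ℝ} (hp : IsPolyFun V p) (hp0 : p ≠ 0) :
    ∃ (T : Finset V) (C : ℝ), ∀ x y : V, ∃ v ∈ T, (p (x - v) ≠ 0 ∧ p (y - v) ≠ 0) ∧
      ‖fderiv ℝ p (x - v)‖ ≤ C * |p (x - v)| ∧ ‖fderiv ℝ p (y - v)‖ ≤ C * |p (y - v)| := by
  obtain ⟨k, hk⟩ := hp.exists_mem_affineFuns_pow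
  -- T must separate degree 2k, so that it also detects products of two elements of W.
  obtain ⟨T, hT⟩ := (affineFuns_fg (V := V)).pow (k + k) |>.exists_finset_separating
  set W := affineFuns V ^ k with hW
  have hT' : ∀ q ∈ W, (∀ v ∈ T, q v = 0) → q = 0 := fun q hq =>
    hT q (affineFuns_pow_mono (Nat.le_add_right k k) hq)
  let r : W →ₗ[ℝ] (T → ℝ) := restrictFun T ∘ₗ W.subtype
  have hr : Function.Injective r := by
    rw [← LinearMap.ker_eq_bot, LinearMap.ker_eq_bot']
    intro q hq
    exact Subtype.ext (hT' q q.2 fun v hv => congrFun hq ⟨v, hv⟩)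
  have hr0 : ∀ q : W, q ≠ 0 → 0 < ‖r q‖ := fun q hq => norm_pos_iff.2 fun h => hq
    (hr (h.trans (map_zero r).symm))
  let M := LinearMap.range r
  let e : W ≃ₗ[ℝ] M := LinearEquiv.ofInjective r hr
  -- products of normalized elements are bounded below
  obtain ⟨m, hm, hmin⟩ : ∃ m > 0, ∀ a b : M, ‖a‖ = 1 → ‖b‖ = 1 → m ≤ ‖(a : T → ℝ) * b‖ := by
    have hcomp : IsCompact (Metric.sphere (0 : M) 1 ×ˢ Metric.sphere (0 : M) 1) :=
      (isCompact_sphere _ _).prod (isCompact_sphere _ _)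
    have hcont : Continuous fun z : M × M => ‖(z.1 : T → ℝ) * z.2‖ := by fun_prop
    obtain ⟨m, hm, h⟩ := hcomp.exists_forall_le' hcont.continuousOn (a := 0) (by
      rintro ⟨⟨_, a, rfl⟩, ⟨_, b, rfl⟩⟩ ⟨ha, hb⟩
      simp only [mem_sphere_zero_iff_norm] at ha hb
      refine norm_pos_iff.2 fun h0 => ?_
      have h2 : (a : V → ℝ) * b = 0 := by
        refine hT _ ?_ fun v hv => congrFun h0 ⟨v, hv⟩
        rw [pow_add]
        exact Submodule.mul_mem_mul a.2 b.2
      have ha0 : (a : V → ℝ) ≠ 0 := by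
        intro h
        have : a = 0 := Subtype.ext h
        subst this
        simp at ha
      have hb0 : (b : V → ℝ) ≠ 0 := by
        intro h
        have : b = 0 := Subtype.ext h
        subst this
        simp at hb
      exact (isPolyFun_of_mem_affineFuns_pow a.2).mul_ne_zero
        (isPolyFun_of_mem_affineFuns_pow b.2) ha0 hb0 h2)
    exact ⟨m, hm, fun a b ha hb => h (a, b) ⟨by simpa using ha, by simpa using hb⟩⟩
  -- the derivatives are bounded by the values on `T`
  obtain ⟨C, hC0, hC⟩ : ∃ C ≥ 0, ∀ v ∈ T, ∀ q : W, ‖fderiv ℝ (q : V → ℝ) v‖ ≤ C * ‖r q‖ := by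
    let D : V → W →ₗ[ℝ] (V →L[ℝ] ℝ) := fun v =>
      { toFun := fun q => fderiv ℝ (q : V → ℝ) v
        map_add' := fun q q' => fderiv_add
          ((isPolyFun_of_mem_affineFuns_pow q.2).analyticAt v).differentiableAt
          ((isPolyFun_of_mem_affineFuns_pow q'.2).analyticAt v).differentiableAt
        map_smul' := fun a q => fderiv_const_smul
          ((isPolyFun_of_mem_affineFuns_pow q.2).analyticAt v).differentiableAt a }
    let E : V → M →L[ℝ] (V →L[ℝ] ℝ) := fun v =>
      LinearMap.toContinuousLinearMap (D v ∘ₗ e.symm.toLinearMap)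
    refine ⟨∑ v ∈ T, ‖E v‖, Finset.sum_nonneg fun v _ => norm_nonneg (E v), fun v hv q => ?_⟩
    have h1 : fderiv ℝ (q : V → ℝ) v = E v (e q) := by simp [E, D]
    have h2 : ‖r q‖ = ‖e q‖ := rfl
    rw [h1, h2]
    exact ((E v).le_opNorm _).trans (mul_le_mul_of_nonneg_right
      (Finset.single_le_sum (f := fun v => ‖E v‖) (fun v _ => norm_nonneg (E v)) hv) (norm_nonneg _))
  let pr : V → W := fun x => ⟨fun v => p (x - v), affineFuns_pow_reflect hk x⟩
  have hpr : ∀ x, pr x ≠ 0 := by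
    intro x h
    apply hp0
    ext z
    have := congrFun (congrArg Subtype.val h) (x - z)
    simpa [pr] using this
  have hder : ∀ x v, ‖fderiv ℝ (pr x : V → ℝ) v‖ = ‖fderiv ℝ p (x - v)‖ := by
    intro x v
    have h1 : HasFDerivAt (fun v => x - v) (-ContinuousLinearMap.id ℝ V) v :=
      (hasFDerivAt_id v).const_sub x
    have h2 := (hp.analyticAt (x - v)).differentiableAt.hasFDerivAt.comp v h1
    have h3 : fderiv ℝ (pr x : V → ℝ) v = _ := h2.fderiv
    rw [h3, ContinuousLinearMap.comp_neg, norm_neg, ContinuousLinearMap.comp_id]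
  refine ⟨T, C * m⁻¹, fun x y => ?_⟩
  have hnorm : ∀ x, ‖(‖r (pr x)‖⁻¹ • e (pr x) : M)‖ = 1 := by
    intro x
    have h2 : ‖e (pr x)‖ = ‖r (pr x)‖ := rfl
    rw [norm_smul, norm_inv, norm_norm, h2, inv_mul_cancel₀ (hr0 _ (hpr x)).ne']
  have hprod := hmin _ _ (hnorm x) (hnorm y)
  obtain ⟨t, ht⟩ : ∃ t : T, m ≤ ‖‖r (pr x)‖⁻¹ * p (x - t)‖ * ‖‖r (pr y)‖⁻¹ * p (y - t)‖ := by
    by_contra! h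
    refine absurd hprod (not_le.2 ((pi_norm_lt_iff hm).2 fun t => ?_))
    have := h t
    rw [← norm_mul] at this
    exact this
  have hle : ∀ x, ‖‖r (pr x)‖⁻¹ * p (x - t)‖ ≤ 1 := by
    intro x
    rw [← hnorm x]
    exact norm_le_pi_norm ((‖r (pr x)‖⁻¹ • e (pr x) : M) : T → ℝ) t
  have hbound : ∀ x, m ≤ ‖‖r (pr x)‖⁻¹ * p (x - t)‖ → p (x - t) ≠ 0 ∧
      ‖fderiv ℝ p (x - t)‖ ≤ C * m⁻¹ * |p (x - t)| := by
    intro x hx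
    have h0 := hr0 _ (hpr x)
    rw [norm_mul, norm_inv, norm_norm, Real.norm_eq_abs, inv_mul_eq_div, le_div_iff₀ h0] at hx
    constructor
    · intro h
      rw [h, abs_zero] at hx
      exact absurd hx (not_le.2 (mul_pos hm h0))
    · rw [← hder, mul_assoc]
      refine (hC t t.2 (pr x)).trans (mul_le_mul_of_nonneg_left ?_ hC0)
      rw [inv_mul_eq_div, le_div_iff₀ hm, mul_comm]
      exact hx
  obtain ⟨hx1, hx2⟩ := hbound x (ht.trans (mul_le_of_le_one_right (norm_nonneg _) (hle y)))
  obtain ⟨hy1, hy2⟩ := hbound y (ht.trans (mul_le_of_le_one_left (norm_nonneg _) (hle x)))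
  exact ⟨t, t.2, ⟨hx1, hy1⟩, hx2, hy2⟩

end UniformEvaluation

/-! ### Finitely many inversion charts for pairs of points. -/

namespace JordanAlg

variable {V : Type*} [NormedAddCommGroup V] [NormedSpace ℝ V] [FiniteDimensional ℝ V]
  {J : JordanAlg V} (hJ : J.IsSimple) {α : V →ₗ[ℝ] V} (hα : J.IsEuclideanInvolution α)

include hJ hα

/-- Finitely many of the charts `x ↦ -(x - v)⁻¹` suffice to bring any two points into a ball. -/
theorem exists_uniform_inv : ∃ (T : Finset V) (R : ℝ), ∀ x y : V, ∃ v ∈ T,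
    (IsUnit (J.pol (x - v) (x - v)) ∧ IsUnit (J.pol (y - v) (y - v))) ∧
      ‖J.negInv (x - v)‖ ≤ R ∧ ‖J.negInv (y - v)‖ ≤ R := by
  obtain ⟨T, C, hT⟩ := exists_uniform_evaluation (isPolyFun_jdet (J := J))
    (jdet_ne_zero hJ.one_mul)
  let τ : V →ₗ[ℝ] (V →L[ℝ] ℝ) :=
    (ContinuousLinearMap.compL ℝ V V ℝ J.jtr ∘L J.cmul : V →L[ℝ] V →L[ℝ] ℝ)
  have hτ : ∀ x y, τ x y = J.jtr (J.mul x y) := fun x y => rfl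
  obtain ⟨K, hK, hanti⟩ := τ.exists_antilipschitzWith (LinearMap.ker_eq_bot'.2 fun x hx =>
    jtr_nondegenerate hJ hα fun y => by rw [← hτ, hx]; rfl)
  have key : ∀ z, J.jdet z ≠ 0 → ‖fderiv ℝ J.jdet z‖ ≤ C * |J.jdet z| →
      IsUnit (J.pol z z) ∧ ‖J.negInv z‖ ≤ K * C := by
    intro z hz hC
    have hu := (isUnit_pol_iff_jdet hJ hα).2 hz
    refine ⟨hu, ?_⟩
    rw [negInv_eq hu, norm_neg]
    have h2 := hanti.le_mul_dist (J.inv z) 0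
    rw [map_zero, dist_zero_right, dist_zero_right] at h2
    refine h2.trans (mul_le_mul_of_nonneg_left ?_ K.2)
    -- The gradient formula turns the bound on dΔ/Δ into a bound on τ(z⁻¹), hence on z⁻¹ since τ is
    -- injective.
    have e : fderiv ℝ J.jdet z = J.jdet z • τ (J.inv z) := by
      ext u
      rw [fderiv_jdet hJ hu, smul_apply, hτ, smul_eq_mul]
    rw [e, norm_smul, Real.norm_eq_abs, _root_.mul_comm] at hC
    exact le_of_mul_le_mul_right hC (abs_pos.2 hz)
  refine ⟨T, K * C, fun x y => ?_⟩
  obtain ⟨v, hv, ⟨hx, hy⟩, hx', hy'⟩ := hT x y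
  obtain ⟨h1, h2⟩ := key _ hx hx'
  obtain ⟨h3, h4⟩ := key _ hy hy'
  exact ⟨v, hv, ⟨h1, h3⟩, h2, h4⟩

end JordanAlg

/-! ### Absolute convergence. -/

namespace JordanAlg

variable {V : Type*} [NormedAddCommGroup V] [NormedSpace ℝ V] [FiniteDimensional ℝ V]
  {J : JordanAlg V} (hJ : J.IsSimple) {α : V →ₗ[ℝ] V} (hα : J.IsEuclideanInvolution α)

include hJ

theorem continuous_restr {s : ℂ} {F : J.Conf → ℂ} (hF : F ∈ J.indSpace s) :
    Continuous fun x => F (J.nn x) := by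
  obtain ⟨Φ, hΦ, h⟩ := hF.1 1
  have e : (fun x => F (J.nn x)) = Φ ∘ fun x : V => (x, (1 : V →L[ℝ] V), (0 : V)) := by
    ext x
    have h2 := h x 1 0
    rw [_root_.one_mul, strConf_one, nbar_zero hJ.one_mul, _root_.mul_one, _root_.mul_one] at h2
    exact h2.symm
  rw [e]
  exact hΦ.continuousOn.comp_continuous (by fun_prop) fun x => isUnit_one

include hα

/-- From 1 ≤ r₀ ≤ r follows n/(2r) ≤ n/(2r₀). A positive real part makes the kernel continuous
across the zeros of Δ. -/
theorem re_exponent_pos {s : ℂ}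
    (hs : (Module.finrank ℝ V : ℝ) / (2 * (J.rankOn {x | α x = x} : ℝ)) < s.re) :
    0 < (2 * s - (Module.finrank ℝ V : ℂ) / (J.rank : ℂ)).re := by
  have hne : {x | α x = x}.Nonempty := ⟨J.one, hα.map_one hJ⟩
  have h1 : (1 : ℝ) ≤ J.rankOn {x | α x = x} := by
    exact_mod_cast one_le_rankOn hJ.one_ne_zero hne
  have h2 : (J.rankOn {x | α x = x} : ℝ) ≤ J.rank := by
    exact_mod_cast rankOn_le_rank hne
  have h3 : (Module.finrank ℝ V : ℝ) / (2 * J.rank) ≤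
      Module.finrank ℝ V / (2 * (J.rankOn {x | α x = x} : ℝ)) := by gcongr
  have e : (2 * s - (Module.finrank ℝ V : ℂ) / (J.rank : ℂ)).re =
      2 * (s.re - (Module.finrank ℝ V : ℝ) / (2 * J.rank)) := by
    have h4 : ((Module.finrank ℝ V : ℂ) / (J.rank : ℂ)) =
      (((Module.finrank ℝ V : ℝ) / (J.rank : ℝ) : ℝ) : ℂ) := by push_cast; rfl
    rw [h4, Complex.sub_re, Complex.ofReal_re, Complex.mul_re]
    have : (J.rank : ℝ) ≠ 0 := by linarith
    simp
    field_simp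
  rw [e]
  linarith

variable [MeasurableSpace V] [BorelSpace V] (μ : Measure V) [μ.IsAddHaarMeasure]

/-- In the coordinate φ the functions become restrictions of translates by k⁻¹, which are continuous
on all of V. The integrand there is continuous on a bounded set, and integrability is carried back
through φ. -/
theorem integrableOn_chart {s : ℂ} (hs : 0 < (2 * s - (Module.finrank ℝ V : ℂ) / (J.rank : ℂ)).re)
    {k : J.Conf} {φ : V → V} {U : Set V} (h : J.ConformalOn s k φ U) (R : ℝ) {F G : J.Conf → ℂ}
    (hF : F ∈ J.indSpace s) (hG : G ∈ J.indSpace s) :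
    IntegrableOn (J.formIntegrand s (fun x => F (J.nn x)) fun x => G (J.nn x))
      ((U ∩ φ ⁻¹' Metric.ball 0 R) ×ˢ (U ∩ φ ⁻¹' Metric.ball 0 R)) (μ.prod μ) := by
  have := FiniteDimensional.proper ℝ V
  have hA : IsOpen (U ∩ φ ⁻¹' Metric.ball 0 R) :=
    ContinuousOn.isOpen_inter_preimage (fun x hx => by
      obtain ⟨l, hl, -⟩ := h.actsAt x hx
      exact hl.continuousAt.continuousWithinAt) h.isOpen Metric.isOpen_ball
  have hF' := indSpace_translate hF k⁻¹
  have hG' := indSpace_translate hG k⁻¹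
  have hsub : (U ∩ φ ⁻¹' Metric.ball 0 R) ×ˢ (U ∩ φ ⁻¹' Metric.ball 0 R) ⊆ U ×ˢ U :=
    Set.prod_mono Set.inter_subset_left Set.inter_subset_left
  have key := h.integrableOn_iff hJ hα μ hF' hG' hsub (hA.measurableSet.prod hA.measurableSet)
  simp only [inv_mul_cancel_left] at key
  refine key.1 ?_
  have hcont : Continuous (J.formIntegrand s (fun x => F (k⁻¹ * J.nn x))
      fun x => G (k⁻¹ * J.nn x)) := by
    have hΔ : Continuous J.jdet := isPolyFun_jdet.continuous
    have h1 := continuous_restr hJ hF'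
    have h2 := continuous_restr hJ hG'
    have h3 := (Complex.continuous_ofReal_cpow_const hs).comp
      ((hΔ.comp (continuous_fst.sub continuous_snd)).abs)
    exact (h3.mul (h1.comp continuous_fst)).mul (h2.comp continuous_snd)
  refine (hcont.continuousOn.integrableOn_compact ((isCompact_closedBall (0 : V) R).prod
    (isCompact_closedBall (0 : V) R))).mono_set ?_
  rintro _ ⟨p, hp, rfl⟩
  exact ⟨Metric.ball_subset_closedBall hp.1.2, Metric.ball_subset_closedBall hp.2.2⟩

/-- The sets A_v × A_v must cover V × V, so one chart has to serve both points of a pair; covering V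
by the A_v would not suffice. -/
theorem integrable_formIntegrand {s : ℂ}
    (hs : 0 < (2 * s - (Module.finrank ℝ V : ℂ) / (J.rank : ℂ)).re) {F G : J.Conf → ℂ}
    (hF : F ∈ J.indSpace s) (hG : G ∈ J.indSpace s) :
    Integrable (J.formIntegrand s (fun x => F (J.nn x)) fun x => G (J.nn x)) (μ.prod μ) := by
  obtain ⟨T, R, hT⟩ := exists_uniform_inv hJ hα
  let A : V → Set V := fun v => (Set.univ ∩ (fun x => x + -v) ⁻¹' {x | IsUnit (J.pol x x)}) ∩
    (J.negInv ∘ fun x => x + -v) ⁻¹' Metric.ball 0 (R + 1)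
  have hA : (⋃ v ∈ T, A v ×ˢ A v) = Set.univ := by
    refine Set.eq_univ_of_forall fun ⟨x, y⟩ => ?_
    obtain ⟨v, hv, ⟨hx, hy⟩, hx', hy'⟩ := hT x y
    rw [sub_eq_add_neg] at hx hy hx' hy'
    refine Set.mem_biUnion hv ⟨⟨⟨trivial, hx⟩, ?_⟩, ⟨⟨trivial, hy⟩, ?_⟩⟩
    · exact mem_ball_zero_iff.2 (hx'.trans_lt (lt_add_one R))
    · exact mem_ball_zero_iff.2 (hy'.trans_lt (lt_add_one R))
  rw [← integrableOn_univ, ← hA, integrableOn_finset_iUnion]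
  intro v _
  exact integrableOn_chart hJ hα μ hs ((conformalOn_jj hJ s).mul hJ (conformalOn_nn hJ s (-v)))
    (R + 1) hF hG

theorem integrable_formIntegrand_Ispace {s : ℂ}
    (hs : 0 < (2 * s - (Module.finrank ℝ V : ℂ) / (J.rank : ℂ)).re) (f₁ f₂ : J.Ispace s) :
    Integrable (J.formIntegrand s f₁ f₂) (μ.prod μ) := by
  obtain ⟨F, hF, hf₁, -⟩ := exists_rep_eq 1 f₁
  obtain ⟨G, hG, hf₂, -⟩ := exists_rep_eq 1 f₂
  rw [show (f₁ : V → ℂ) = fun x => F (J.nn x) from funext hf₁,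
    show (f₂ : V → ℂ) = fun x => G (J.nn x) from funext hf₂]
  exact integrable_formIntegrand hJ hα μ hs hF hG

end JordanAlg

/-! ### Assembly of the theorem. -/

theorem mainTheorem6 {V : Type*} [NormedAddCommGroup V] [NormedSpace ℝ V] [FiniteDimensional ℝ V]
    [MeasurableSpace V] [BorelSpace V] (μ : Measure V) [μ.IsAddHaarMeasure]
    (J : JordanAlg V) (hJ : J.IsSimple)
    (α : V →ₗ[ℝ] V) (hα : J.IsEuclideanInvolution α)
    (s : ℂ) (hs : (Module.finrank ℝ V : ℝ) / (2 * (J.rankOn {x | α x = x} : ℝ)) < s.re) :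
    -- the operators of `π_s` are given by `π_s(g) f(x) = |χ((D g⁻¹)_x)| ^ (s + n/(2r)) f(g⁻¹ x)`
    (∀ (g : J.Conf) (f : J.Ispace s) (φ : V → V), Represents ((g⁻¹ : J.Conf) : GenericAut V) φ →
      ∀ᶠ x in genericFilter V, DifferentiableAt ℝ φ x ∧
        (J.rep s g f : V → ℂ) x =
          ((|J.chi (fderiv ℝ φ x)| : ℝ) : ℂ) ^ J.expo s * (f : V → ℂ) (φ x)) ∧
    -- the form is a well defined, invariant bilinear form on `I_s × I_s`
    ∃ B : J.Ispace s →ₗ[ℂ] J.Ispace s →ₗ[ℂ] ℂ,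
      (∀ f₁ f₂ : J.Ispace s,
        Integrable (J.formIntegrand s f₁ f₂) (μ.prod μ) ∧
        B f₁ f₂ = ∫ p, J.formIntegrand s f₁ f₂ p ∂(μ.prod μ)) ∧
      ∀ (g : J.Conf) (f₁ f₂ : J.Ispace s), B (J.rep s g f₁) (J.rep s g f₂) = B f₁ f₂ := by
  refine ⟨fun g f φ hφ => JordanAlg.rep_formula hJ s g f hφ, ?_⟩
  have hint := JordanAlg.integrable_formIntegrand_Ispace hJ hα μ (JordanAlg.re_exponent_pos hJ hα hs)
  refine ⟨LinearMap.mk₂ ℂ (fun f₁ f₂ : J.Ispace s => ∫ p, J.formIntegrand s f₁ f₂ p ∂(μ.prod μ))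
    (fun f₁ f₂ f₃ => ?_) (fun c f₁ f₂ => ?_) (fun f₁ f₂ f₃ => ?_) (fun c f₁ f₂ => ?_),
    fun f₁ f₂ => ⟨hint f₁ f₂, rfl⟩, fun g f₁ f₂ => ?_⟩
  -- Additivity of the integral in each variable rests on the absolute convergence `hint`.
  · rw [← integral_add (hint f₁ f₃) (hint f₂ f₃)]
    congr 1 with p
    simp only [JordanAlg.formIntegrand, Submodule.coe_add, Pi.add_apply]
    ring
  · rw [← integral_smul]
    congr 1 with p
    simp only [JordanAlg.formIntegrand, Submodule.coe_smul, Pi.smul_apply, smul_eq_mul]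
    ring
  · rw [← integral_add (hint f₁ f₂) (hint f₁ f₃)]
    congr 1 with p
    simp only [JordanAlg.formIntegrand, Submodule.coe_add, Pi.add_apply]
    ring
  · rw [← integral_smul]
    congr 1 with p
    simp only [JordanAlg.formIntegrand, Submodule.coe_smul, Pi.smul_apply, smul_eq_mul]
    ring
  · obtain ⟨F, hF, hf₁, hr₁⟩ := JordanAlg.exists_rep_eq g f₁
    obtain ⟨G, hG, hf₂, hr₂⟩ := JordanAlg.exists_rep_eq g f₂
    simp only [LinearMap.mk₂_apply]
    rw [show (f₁ : V → ℂ) = fun x => F (J.nn x) from funext hf₁,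
      show (f₂ : V → ℂ) = fun x => G (J.nn x) from funext hf₂,
      show (J.rep s g f₁ : V → ℂ) = fun x => F (g⁻¹ * J.nn x) from funext hr₁,
      show (J.rep s g f₂ : V → ℂ) = fun x => G (g⁻¹ * J.nn x) from funext hr₂]
    exact JordanAlg.integral_translate hJ hα μ g⁻¹ hF hG
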